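/- Let $M$ be a connected smooth surface oriented by a volume element, and let $\mathbb{R}^4$ carry the symplectic form $\Omega(X,Y)={}^tXJY$, $J=\begin{pmatrix}0&I_2\\-I_2&0\end{pmatrix}$. Let $f:M\to\mathbb{R}^4$ be a smooth Lagrangian immersion. A first order frame along $f$ on an open set $U\subset M$ is a smooth map $X=(X_1,X_2,X_3,X_4):U\to \mathrm{Sp}(4,\mathbb{R})$ such that $X_1,X_2$ span $df(T_qM)$, positively oriented for the orientation opposite to the one that $df$ carries over from $M$. Write $df=\sum_j\tau^jX_j$ and $X^{-1}dX=\begin{pmatrix}\alpha&\beta\\ \gamma&-{}^t\alpha\end{pmatrix}$, with entries $\alpha^i_j$, $\gamma^i_j$ in row $i$ and column $j$. The immersion $f$ is called elliptic if its Gauss map into the oriented Lagrangian Grassmannian is a spacelike immersion, that is, if $-\gamma^1_1\gamma^2_2+(\gamma^2_1)^2$ is positive definite for first order frames. Put $$\omega=\tfrac12(\gamma^1_1-\gamma^2_2)+i\gamma^2_1,\qquad \tau=\tau^1-i\tau^2,\qquad \eta=\tfrac12(\alpha^1_1-\alpha^2_2)-\tfrac i2(\alpha^2_1+\alpha^1_2).$$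 Let $f$ be elliptic. A first order frame is of second order if $\gamma^1_1+\gamma^2_2=0$; then $\tau=t\omega$ and $\eta=h\omega+\ell\bar\omega$ for functions $t,h,\ell$. It is of third order if moreover $\ell=0$, and it is adapted to a local complex coordinate $z$ if moreover $\omega=dz$ and $\alpha^1_1+\alpha^2_2=\alpha^2_1-\alpha^1_2=0$. Such frames exist locally. The Fubini cubic form $\mathcal{F}=\tau^2\omega$ (second order frames) and the normalized Hopf differential $\mathcal{H}=|t|^{2/3}\eta\,\omega$ (third order frames) do not depend on the frame. If $\mathcal{H}$ has no zeros, the Hermitian form $$\mathcal{P}=\Big(\big(\bar h_z\,\bar h^{-1}\big)_{\bar z}-\big(h_{\bar z}\,h^{-1}\big)_z\Big)\,dz\,d\bar z,\qquad \eta=h\,dz,$$ computed with adapted frames, does not depend on the frame and the coordinate either. The immersion $f$ is called generic if $\mathcal{H}(q)\neq0$ and $\mathcal{P}(q)\neq0$ for every $q\in M$. Proposition. A generic elliptic Lagrangian immersion is uniquely determined, up to affine symplectic transformation, by its Fubini cubic form: if $f:M\to\mathbb{R}^4$ is a generic elliptic Lagrangian immersion and $\tilde f:M\to\mathbb{R}^4$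 is any elliptic Lagrangian immersion with the same Fubini cubic form, then there are $b\in\mathbb{R}^4$ and $S\in\mathrm{Sp}(4,\mathbb{R})$ such that $\tilde f=b+Sf$ on $M$. -/

import Mathlib

open scoped Manifold ContDiff Matrix ComplexConjugate

noncomputable section

namespace LagrangianSurface

/-- Index set of the coordinates of `ℝ⁴`: `inl 0, inl 1, inr 0, inr 1` stand for `1, 2, 3, 4`. -/
abbrev Idx : Type := Fin 2 ⊕ Fin 2

/-- Real four-space. -/
abbrev R4 : Type := Idx → ℝ

/-- Real `4 × 4` matrices, in `2 × 2` blocks. -/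
abbrev Mat4 : Type := Matrix Idx Idx ℝ

/-- The standard symplectic form `Ω(X, Y) = ᵗX J Y` with `J = [[0, I₂], [-I₂, 0]]`. -/
def Omega (x y : R4) : ℝ :=
  x ⬝ᵥ ((Matrix.fromBlocks 0 1 (-1) 0 : Mat4) *ᵥ y)

/-- The linear symplectic group of `Omega`, which is Mathlib's `symplecticGroup`
(Mathlib's `J` is the negative of the one above, which gives the same group). -/
theorem mem_symplecticGroup_iff (X : Mat4) :
    X ∈ Matrix.symplecticGroup (Fin 2) ℝ ↔
      Xᵀ * (Matrix.fromBlocks 0 1 (-1) 0 : Mat4) * X = Matrix.fromBlocks 0 1 (-1) 0 := by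
  have h : (Matrix.fromBlocks 0 1 (-1) 0 : Mat4) = -Matrix.J (Fin 2) ℝ := by
    simp [Matrix.J, Matrix.fromBlocks_neg]
  rw [SymplecticGroup.mem_iff', h, Matrix.mul_neg, Matrix.neg_mul, neg_inj]

/-- The model of surfaces. -/
abbrev Plane : Type := EuclideanSpace ℝ (Fin 2)

section Surface

variable {M : Type*} [TopologicalSpace M] [ChartedSpace Plane M]

variable (M) in
/-- A volume element on the surface `M`: a smooth, nowhere vanishing exterior 2-form.
Smoothness: near every point the form is `a dx ∧ dy` with smooth functions `a, x, y`. -/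
structure VolumeElement where
  form : ∀ q : M, TangentSpace (𝓡 2) q [⋀^Fin 2]→ₗ[ℝ] ℝ
  ne_zero : ∀ q, form q ≠ 0
  smooth : ∀ q₀ : M, ∃ (U : Set M) (a x y : M → ℝ), IsOpen U ∧ q₀ ∈ U ∧
    ContMDiffOn (𝓡 2) 𝓘(ℝ, ℝ) ∞ a U ∧ ContMDiffOn (𝓡 2) 𝓘(ℝ, ℝ) ∞ x U ∧
    ContMDiffOn (𝓡 2) 𝓘(ℝ, ℝ) ∞ y U ∧
    ∀ q ∈ U, ∀ v w : TangentSpace (𝓡 2) q, form q ![v, w] =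
      a q * (mvfderiv (𝓡 2) x q v * mvfderiv (𝓡 2) y q w
        - mvfderiv (𝓡 2) x q w * mvfderiv (𝓡 2) y q v)

/-- The plane of the Gauss map: `df(T_q M)`, translated to the origin. -/
def gaussPlane (f : M → R4) (q : M) : Submodule ℝ R4 :=
  LinearMap.range (mvfderiv (𝓡 2) f q).toLinearMap

/-- Smooth Lagrangian immersions of the surface `M` into `(ℝ⁴, Ω)`. -/
structure IsLagrangianImmersion (f : M → R4) : Prop where
  smooth : ContMDiff (𝓡 2) 𝓘(ℝ, R4) ∞ f
  immersion : ∀ q, Function.Injective (mvfderiv (𝓡 2) f q)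
  lagrangian : ∀ q, ∀ x ∈ gaussPlane f q, ∀ y ∈ gaussPlane f q, Omega x y = 0

/-! ### Frames and pulled back Maurer-Cartan forms -/

/-- `X : U → Sp(4, ℝ)` smooth on the open set `U`. Together with `f` it is the
symplectic frame field `(f, X)` along `f`, whose vectors are the columns of `X`. -/
structure IsFrameField (U : Set M) (X : M → Mat4) : Prop where
  isOpen : IsOpen U
  smooth : ∀ i j, ContMDiffOn (𝓡 2) 𝓘(ℝ, ℝ) ∞ (fun q => X q i j) U
  symplectic : ∀ q ∈ U, X q ∈ Matrix.symplecticGroup (Fin 2) ℝ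

/-- The forms `τʲ` of the frame `(f, X)`: `df = ∑ τʲ X_j`. -/
def tauForm (f : M → R4) (X : M → Mat4) (q : M) (v : TangentSpace (𝓡 2) q) : R4 :=
  (X q)⁻¹ *ᵥ mvfderiv (𝓡 2) f q v

/-- The forms `θⁱ_j` of the frame `(f, X)`: `dX_j = ∑ θⁱ_j X_i`, that is `θ = X⁻¹ dX`. -/
def thetaForm (X : M → Mat4) (q : M) (v : TangentSpace (𝓡 2) q) : Mat4 :=
  (X q)⁻¹ * Matrix.of fun i j => mvfderiv (𝓡 2) (fun p => X p i j) q v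

/-- `α`, where `θ = [[α, β], [γ, -ᵗα]]`; the entry `αⁱ_j` is in row `i` and column `j`. -/
def alphaForm (X : M → Mat4) (q : M) (v : TangentSpace (𝓡 2) q) : Matrix (Fin 2) (Fin 2) ℝ :=
  (thetaForm X q v).toBlocks₁₁

/-- `γ`, where `θ = [[α, β], [γ, -ᵗα]]`. -/
def gammaForm (X : M → Mat4) (q : M) (v : TangentSpace (𝓡 2) q) : Matrix (Fin 2) (Fin 2) ℝ :=
  (thetaForm X q v).toBlocks₂₁

/-- The quadratic form `-γ¹₁ γ²₂ + (γ²₁)²`. On the frame bundle `Sp(4, ℝ) → Λ₂⁺` over the oriented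
Lagrangian Grassmannian it is semibasic and defines, up to positive factors,
the conformal structure of `Λ₂⁺`. -/
def conformalForm (X : M → Mat4) (q : M) (v : TangentSpace (𝓡 2) q) : ℝ :=
  -(gammaForm X q v 0 0 * gammaForm X q v 1 1) + gammaForm X q v 1 0 ^ 2

/-- `ω = ω¹ + i ω²` with `ω¹ = (γ¹₁ - γ²₂) / 2` and `ω² = γ²₁`. -/
def omegaForm (X : M → Mat4) (q : M) (v : TangentSpace (𝓡 2) q) : ℂ :=
  (((gammaForm X q v 0 0 - gammaForm X q v 1 1) / 2 : ℝ) : ℂ)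
    + Complex.I * ((gammaForm X q v 1 0 : ℝ) : ℂ)

/-- `τ = τ¹ - i τ²`. -/
def tauComplex (f : M → R4) (X : M → Mat4) (q : M) (v : TangentSpace (𝓡 2) q) : ℂ :=
  ((tauForm f X q v (Sum.inl 0) : ℝ) : ℂ) - Complex.I * ((tauForm f X q v (Sum.inl 1) : ℝ) : ℂ)

/-- `η = (α¹₁ - α²₂) / 2 - (i / 2) (α²₁ + α¹₂)`. -/
def etaForm (X : M → Mat4) (q : M) (v : TangentSpace (𝓡 2) q) : ℂ :=
  (((alphaForm X q v 0 0 - alphaForm X q v 1 1) / 2 : ℝ) : ℂ)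
    - Complex.I * (((alphaForm X q v 1 0 + alphaForm X q v 0 1) / 2 : ℝ) : ℂ)

/-! ### Frame reductions -/

/-- First order frame fields along `f` on `U`: the oriented plane `[X₁ ∧ X₂]` is the value of the
Gauss map, that is the plane `df(T_q M)` with the orientation opposite to the one carried over
from `M` by `df`. So `(τ¹ ∧ τ²)(v, w) < 0` for positive bases `(v, w)`. -/
structure IsFirstOrder (A : VolumeElement M) (f : M → R4) (U : Set M) (X : M → Mat4) : Prop
    extends IsFrameField U X where
  span_eq : ∀ q ∈ U, Submodule.span ℝ {(X q).col (Sum.inl 0), (X q).col (Sum.inl 1)}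
    = gaussPlane f q
  orientation : ∀ q ∈ U, ∀ v w : TangentSpace (𝓡 2) q, 0 < A.form q ![v, w] →
    tauForm f X q v (Sum.inl 0) * tauForm f X q w (Sum.inl 1)
      - tauForm f X q w (Sum.inl 0) * tauForm f X q v (Sum.inl 1) < 0

/-- Elliptic Lagrangian immersions: the Gauss map is a spacelike immersion into `Λ₂⁺`, that is, the
pull-back of the conformal structure of `Λ₂⁺` is positive definite. The pull-back is computed,
up to a positive factor, with a lift of the Gauss map to `Sp(4, ℝ)`, that is with
a first order frame field; lifts exist near every point, and another lift
multiplies the form by a positive function. -/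
structure IsElliptic (A : VolumeElement M) (f : M → R4) : Prop
    extends IsLagrangianImmersion f where
  spacelike : ∀ q, ∃ (U : Set M) (X : M → Mat4), q ∈ U ∧ IsFirstOrder A f U X ∧
    ∀ v : TangentSpace (𝓡 2) q, v ≠ 0 → 0 < conformalForm X q v

/-- Second order frame fields: first order and `(γ¹₁ + γ²₂) / 2 = 0`. -/
structure IsSecondOrder (A : VolumeElement M) (f : M → R4) (U : Set M) (X : M → Mat4) : Prop
    extends IsFirstOrder A f U X where
  trace_gamma : ∀ q ∈ U, ∀ v : TangentSpace (𝓡 2) q,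
    gammaForm X q v 0 0 + gammaForm X q v 1 1 = 0

/-- Third order frame fields: second order, and in `η = h ω + ℓ ω̄` the coefficient `ℓ` is `0`. -/
structure IsThirdOrder (A : VolumeElement M) (f : M → R4) (U : Set M) (X : M → Mat4) : Prop
    extends IsSecondOrder A f U X where
  eta_bidegree : ∀ q ∈ U, ∃ h : ℂ, ∀ v : TangentSpace (𝓡 2) q, etaForm X q v = h * omegaForm X q v

/-! ### The Fubini cubic form and the normalized Hopf differential -/

/-- `F` is the form `τ² ω` at `q`, computed with some second order frame field around `q`. -/
def IsFubiniAt (A : VolumeElement M) (f : M → R4) (q : M)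
    (F : TangentSpace (𝓡 2) q → ℂ) : Prop :=
  ∃ (U : Set M) (X : M → Mat4), q ∈ U ∧ IsSecondOrder A f U X ∧
    F = fun v => tauComplex f X q v ^ 2 * omegaForm X q v

/-- The Fubini cubic form `τ² ω` of an elliptic Lagrangian immersion (a cubic form is regarded as
a function of one tangent vector). Second order frame fields exist around every
point, and the value does not depend on the one that is used. -/
def fubiniCubicForm (A : VolumeElement M) (f : M → R4) (q : M) : TangentSpace (𝓡 2) q → ℂ :=
  Classical.epsilon (IsFubiniAt A f q)

/-- `H` is the form `|t|^(2/3) η ω` at `q`, where `τ = t ω`, computed with some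
third order frame field around `q`. -/
def IsHopfAt (A : VolumeElement M) (f : M → R4) (q : M)
    (H : TangentSpace (𝓡 2) q → ℂ) : Prop :=
  ∃ (U : Set M) (X : M → Mat4) (t : ℂ), q ∈ U ∧ IsThirdOrder A f U X ∧
    (∀ v : TangentSpace (𝓡 2) q, tauComplex f X q v = t * omegaForm X q v) ∧
    H = fun v => ((‖t‖ ^ (2 / 3 : ℝ) : ℝ) : ℂ) * etaForm X q v * omegaForm X q v

/-- The normalized Hopf differential of an elliptic Lagrangian immersion. Third order frame
fields exist around every point, and the value does not depend on the one that is used. -/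
def normalizedHopf (A : VolumeElement M) (f : M → R4) (q : M) : TangentSpace (𝓡 2) q → ℂ :=
  Classical.epsilon (IsHopfAt A f q)

/-! ### Adapted frames and the Hermitian form `𝒫` -/

/-- `z` is a complex-valued coordinate on the open set `U`. -/
structure IsComplexCoordinate (U : Set M) (z : M → ℂ) : Prop where
  isOpen : IsOpen U
  smooth : ContMDiffOn (𝓡 2) 𝓘(ℝ, ℂ) ∞ z U
  injOn : Set.InjOn z U
  bijective : ∀ q ∈ U, Function.Bijective (mvfderiv (𝓡 2) z q)

/-- `∂u/∂z = (∂u/∂x - i ∂u/∂y) / 2` for a complex-valued coordinate `z = x + i y`; the vectors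
`∂/∂x`, `∂/∂y` are the preimages of `1`, `i` under `dz`. -/
def dZ (z u : M → ℂ) (q : M) : ℂ :=
  (mvfderiv (𝓡 2) u q ((mvfderiv (𝓡 2) z q).inverse 1)
    - Complex.I * mvfderiv (𝓡 2) u q ((mvfderiv (𝓡 2) z q).inverse Complex.I)) / 2

/-- `∂u/∂z̄ = (∂u/∂x + i ∂u/∂y) / 2`. -/
def dZbar (z u : M → ℂ) (q : M) : ℂ :=
  (mvfderiv (𝓡 2) u q ((mvfderiv (𝓡 2) z q).inverse 1)
    + Complex.I * mvfderiv (𝓡 2) u q ((mvfderiv (𝓡 2) z q).inverse Complex.I)) / 2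

/-- Frame fields adapted to `(U, z)`: third order, `ω = dz` and `α¹₁ + α²₂ = α²₁ - α¹₂ = 0`.
The equation `ω = dz` contains the holomorphy of `z`, as `ω` has bidegree `(1, 0)` for the complex
structure of `M` that belongs to its orientation and to the conformal class of the Gauss map. -/
structure IsAdapted (A : VolumeElement M) (f : M → R4) (U : Set M) (z : M → ℂ)
    (X : M → Mat4) : Prop extends IsThirdOrder A f U X where
  coordinate : IsComplexCoordinate U z
  omega_eq : ∀ q ∈ U, ∀ v : TangentSpace (𝓡 2) q, omegaForm X q v = mvfderiv (𝓡 2) z q v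
  trace_alpha : ∀ q ∈ U, ∀ v : TangentSpace (𝓡 2) q,
    alphaForm X q v 0 0 + alphaForm X q v 1 1 = 0
  skew_alpha : ∀ q ∈ U, ∀ v : TangentSpace (𝓡 2) q,
    alphaForm X q v 1 0 - alphaForm X q v 0 1 = 0

/-- `(h̄_z / h̄)_z̄ - (h_z̄ / h)_z`. -/
def hermitianCoeff (z h : M → ℂ) (q : M) : ℂ :=
  dZbar z (fun p => dZ z (fun x => conj (h x)) p * (conj (h p))⁻¹) q
    - dZ z (fun p => dZbar z h p * (h p)⁻¹) q

/-- `P` is the form `((h̄_z / h̄)_z̄ - (h_z̄ / h)_z) dz dz̄` at `q`, computed with some complex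
coordinate `(U, z)` around `q` and a frame field adapted to it, where `η = h dz`. -/
def IsHermitianFormAt (A : VolumeElement M) (f : M → R4) (q : M)
    (P : TangentSpace (𝓡 2) q → ℂ) : Prop :=
  ∃ (U : Set M) (z : M → ℂ) (X : M → Mat4) (h : M → ℂ), q ∈ U ∧ IsAdapted A f U z X ∧
    (∀ p ∈ U, ∀ v : TangentSpace (𝓡 2) p, etaForm X p v = h p * mvfderiv (𝓡 2) z p v) ∧
    P = fun v => hermitianCoeff z h q * (mvfderiv (𝓡 2) z q v * conj (mvfderiv (𝓡 2) z q v))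

/-- The Hermitian form `𝒫` of an elliptic Lagrangian immersion whose normalized Hopf differential
has no zeros. Adapted frame fields exist around every point, and the value does not depend on the
coordinate and the frame field that are used. -/
def hermitianForm (A : VolumeElement M) (f : M → R4) (q : M) : TangentSpace (𝓡 2) q → ℂ :=
  Classical.epsilon (IsHermitianFormAt A f q)

/-- Generic elliptic Lagrangian immersions: the normalized Hopf differential and the Hermitian
form `𝒫` have no zeros. -/
structure IsGeneric (A : VolumeElement M) (f : M → R4) : Prop extends IsElliptic A f where
  hopf_ne_zero : ∀ q, normalizedHopf A f q ≠ 0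
  hermitian_ne_zero : ∀ q, hermitianForm A f q ≠ 0

end Surface

end LagrangianSurface

end

/-! A real 2 × 2 matrix acts on ℂ by w ↦ a w + b w̄ with a = `lin` and b = `cnj`; all blocks of the
Maurer-Cartan form θ are read this way. For a second order frame `lin γ = 0` and `cnj γ = ω`. Write
ρ = `lin α`; then `cnj α` is η̄, and `tauBar` is τ̄. Ellipticity makes ω injective on tangent
spaces, so forms are compared by wedging with ω and ω̄. Two second order frames differ by a block
upper triangular gauge whose leading block is multiplication by some a ≠ 0, and then ω becomes ā²ω
and τ becomes ā⁻¹τ.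

Matching. If the cubic forms agree, the pairs (ω, τ) of the two immersions differ by such a scaling
(`cubic_rigidity`), so frames exist with equal ω and τ (`exists_matching_gamma_tau`). The structure
equation dω = 2ρ̄ ∧ ω and the equations from d(df) = 0 then leave a difference bω̄ in ρ and rω in
η̄, with r real, and a shear of X₃, X₄ absorbs it (`exists_matching`). Only β can still differ.

The difference of the β. The equation for dα shows that its linear part vanishes and that its
antilinear part is σ = δω̄ (`lin_beta`). The equation for dβ gives dσ = -2ρ ∧ σ and a reality
condition (`betaDiff_structure`). Suppose σ ≠ 0 at a point. Near it a square root of the invariant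
quadratic differential σ̄ω is a closed form dz, and a frame adapted to z exists
(`AgreesUpToBeta.exists_adapted`); isothermal coordinates need not be known beforehand. In adapted
frames ρ = 0, so δ_z = 0, and hδ is real. The logarithmic z-derivative of h̄δ̄ = hδ is h̄_z/h̄ =
h_z/h - δ̄_z/δ̄. Its z̄-derivative says that the coefficient of 𝒫 vanishes
(`hermitianCoeff_eq_zero`), where ℋ ≠ 0 ensures h ≠ 0. This contradicts genericity, so σ = 0 and the
two forms θ coincide (`thetaForm_eq`).

Congruence. Equal forms θ make S = X'X⁻¹ locally constant, and then f' - S f is locally constant.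
The pair (b, S) is determined by f' on any open set, because an elliptic immersion lies locally in
no proper affine subspace (`affine_unique`). Connectedness of M finishes the proof. -/

noncomputable section

namespace LagrangianSurface

/-! ### Calculus of vector-valued functions on a surface -/

section Calculus

variable {M : Type*} [TopologicalSpace M] [ChartedSpace Plane M]
variable {E F G : Type*} [NormedAddCommGroup E] [NormedSpace ℝ E]
  [NormedAddCommGroup F] [NormedSpace ℝ F] [NormedAddCommGroup G] [NormedSpace ℝ G]

/-- Smoothness of a vector-valued function on a subset of the surface. -/
abbrev SmoothOn (U : Set M) (u : M → E) : Prop := ContMDiffOn (𝓡 2) 𝓘(ℝ, E) ∞ u U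

/-- Differentiability of a vector-valued function at a point of the surface. -/
abbrev DiffAt (u : M → E) (q : M) : Prop := MDifferentiableAt (𝓡 2) 𝓘(ℝ, E) u q

theorem SmoothOn.diffAt {U : Set M} {u : M → E} (h : SmoothOn U u) (hU : IsOpen U) {q : M}
    (hq : q ∈ U) : DiffAt u q :=
  (h.contMDiffAt (hU.mem_nhds hq)).mdifferentiableAt (by simp)

theorem SmoothOn.comp_contDiffOn {U : Set M} {u : M → E} {g : E → F} {T : Set E}
    (hg : ContDiffOn ℝ ∞ g T) (h : SmoothOn U u) (hT : Set.MapsTo u U T) :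
    SmoothOn U (fun q => g (u q)) :=
  (contMDiffOn_iff_contDiffOn.2 hg).comp h hT

theorem SmoothOn.comp_contDiff {U : Set M} {u : M → E} {g : E → F}
    (hg : ContDiff ℝ ∞ g) (h : SmoothOn U u) : SmoothOn U (fun q => g (u q)) :=
  h.comp_contDiffOn hg.contDiffOn (Set.mapsTo_univ _ _)

theorem SmoothOn.const {U : Set M} (c : E) : SmoothOn U (fun _ : M => c) := contMDiffOn_const

theorem SmoothOn.add {U : Set M} {u w : M → E} (hu : SmoothOn U u) (hw : SmoothOn U w) :
    SmoothOn U (fun q => u q + w q) :=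
  SmoothOn.comp_contDiff (g := fun p : E × E => p.1 + p.2) (by fun_prop) (hu.prodMk_space hw)

theorem SmoothOn.sub {U : Set M} {u w : M → E} (hu : SmoothOn U u) (hw : SmoothOn U w) :
    SmoothOn U (fun q => u q - w q) :=
  SmoothOn.comp_contDiff (g := fun p : E × E => p.1 - p.2) (by fun_prop) (hu.prodMk_space hw)

theorem SmoothOn.neg {U : Set M} {u : M → E} (hu : SmoothOn U u) :
    SmoothOn U (fun q => - u q) :=
  hu.comp_contDiff (g := fun p : E => - p) (by fun_prop)

theorem SmoothOn.mul {𝔸 : Type*} [NormedRing 𝔸] [NormedAlgebra ℝ 𝔸] {U : Set M} {u w : M → 𝔸}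
    (hu : SmoothOn U u) (hw : SmoothOn U w) : SmoothOn U (fun q => u q * w q) :=
  SmoothOn.comp_contDiff (g := fun p : 𝔸 × 𝔸 => p.1 * p.2) (by fun_prop) (hu.prodMk_space hw)

theorem SmoothOn.inv {𝔸 : Type*} [NormedField 𝔸] [NormedAlgebra ℝ 𝔸] [CompleteSpace 𝔸]
    {U : Set M} {u : M → 𝔸}
    (hu : SmoothOn U u) (h0 : ∀ q ∈ U, u q ≠ 0) : SmoothOn U (fun q => (u q)⁻¹) :=
  hu.comp_contDiffOn (g := fun p : 𝔸 => p⁻¹) (T := {0}ᶜ)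
    (fun _ hx => (contDiffAt_inv ℝ hx).contDiffWithinAt) h0

theorem SmoothOn.div {𝔸 : Type*} [NormedField 𝔸] [NormedAlgebra ℝ 𝔸] [CompleteSpace 𝔸]
    {U : Set M} {u w : M → 𝔸}
    (hu : SmoothOn U u) (hw : SmoothOn U w) (h0 : ∀ q ∈ U, w q ≠ 0) :
    SmoothOn U (fun q => u q / w q) := by
  simpa only [div_eq_mul_inv] using hu.mul (hw.inv h0)

theorem SmoothOn.sum {ι : Type*} {U : Set M} {s : Finset ι} {u : ι → M → E}
    (hu : ∀ i ∈ s, SmoothOn U (u i)) : SmoothOn U (fun q => ∑ i ∈ s, u i q) := by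
  classical
  induction s using Finset.induction_on with
  | empty => simpa using SmoothOn.const (0 : E)
  | insert i s hi ih =>
    simp only [Finset.sum_insert hi]
    exact (hu i (by simp)).add (ih fun j hj => hu j (by simp [hj]))

theorem SmoothOn.conj {U : Set M} {u : M → ℂ} (hu : SmoothOn U u) :
    SmoothOn U (fun q => conj (u q)) :=
  hu.comp_contDiff Complex.conjCLE.contDiff

theorem SmoothOn.re {U : Set M} {u : M → ℂ} (hu : SmoothOn U u) :
    SmoothOn U (fun q => (u q).re) :=
  hu.comp_contDiff Complex.reCLM.contDiff

theorem SmoothOn.im {U : Set M} {u : M → ℂ} (hu : SmoothOn U u) :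
    SmoothOn U (fun q => (u q).im) :=
  hu.comp_contDiff Complex.imCLM.contDiff

theorem SmoothOn.ofReal {U : Set M} {u : M → ℝ} (hu : SmoothOn U u) :
    SmoothOn U (fun q => (u q : ℂ)) :=
  hu.comp_contDiff Complex.ofRealCLM.contDiff

theorem SmoothOn.eventually_ne {U : Set M} {u : M → E} (hu : SmoothOn U u) (hU : IsOpen U)
    {q : M} (hq : q ∈ U) {c : E} (h : u q ≠ c) : ∀ᶠ p in nhds q, u p ≠ c :=
  (hu.continuousOn.continuousAt (hU.mem_nhds hq)).eventually_ne h

/-! Rules for the differential at a point. -/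

theorem mvfderiv_eq_fderiv_chart {u : M → E} {q : M} (h : DiffAt u q) :
    mvfderiv (𝓡 2) u q = fderiv ℝ (u ∘ (chartAt Plane q).symm) (chartAt Plane q q) := by
  rw [MDifferentiableAt.mvfderiv h]
  simp only [writtenInExtChartAt, extChartAt_model_space_eq_id, PartialEquiv.refl_coe]
  simp
  rfl

theorem DiffAt.comp_differentiableAt {u : M → E} {g : E → F} {q : M}
    (hg : DifferentiableAt ℝ g (u q)) (h : DiffAt u q) : DiffAt (fun p => g (u p)) q :=
  MDifferentiableAt.comp q (mdifferentiableAt_iff_differentiableAt.2 hg) h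

theorem mvfderiv_comp_fderiv {u : M → E} {g : E → F} {q : M}
    (hg : DifferentiableAt ℝ g (u q)) (h : DiffAt u q) (v : TangentSpace (𝓡 2) q) :
    mvfderiv (𝓡 2) (fun p => g (u p)) q v = fderiv ℝ g (u q) (mvfderiv (𝓡 2) u q v) := by
  have := mfderiv_comp_apply q (mdifferentiableAt_iff_differentiableAt.2 hg) h v
  rw [mfderiv_eq_fderiv] at this
  exact this

theorem mvfderiv_prodMk {u : M → E} {w : M → F} {q : M} (hu : DiffAt u q) (hw : DiffAt w q)
    (v : TangentSpace (𝓡 2) q) :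
    mvfderiv (𝓡 2) (fun p => (u p, w p)) q v = (mvfderiv (𝓡 2) u q v, mvfderiv (𝓡 2) w q v) := by
  have h : DiffAt (fun p => (u p, w p)) q := hu.prodMk_space hw
  have h1 := mvfderiv_comp_fderiv (g := Prod.fst) differentiableAt_fst h v
  have h2 := mvfderiv_comp_fderiv (g := Prod.snd) differentiableAt_snd h v
  rw [fderiv_fst] at h1
  rw [fderiv_snd] at h2
  exact Prod.ext h1.symm h2.symm

theorem mvfderiv_clm (L : E →L[ℝ] F) {u : M → E} {q : M} (h : DiffAt u q)
    (v : TangentSpace (𝓡 2) q) :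
    mvfderiv (𝓡 2) (fun p => L (u p)) q v = L (mvfderiv (𝓡 2) u q v) := by
  rw [mvfderiv_comp_fderiv L.differentiableAt h, L.fderiv]

theorem mvfderiv_mul' {𝔸 : Type*} [NormedRing 𝔸] [NormedAlgebra ℝ 𝔸] {u w : M → 𝔸} {q : M}
    (hu : DiffAt u q) (hw : DiffAt w q) (v : TangentSpace (𝓡 2) q) :
    mvfderiv (𝓡 2) (fun p => u p * w p) q v
      = u q * mvfderiv (𝓡 2) w q v + mvfderiv (𝓡 2) u q v * w q := by
  have h := mvfderiv_comp_fderiv (g := fun p : 𝔸 × 𝔸 => p.1 * p.2) (by fun_prop)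
    (hu.prodMk_space hw) v
  rw [h, mvfderiv_prodMk hu hw]
  have : HasFDerivAt (fun p : 𝔸 × 𝔸 => p.1 * p.2) _ (u q, w q) :=
    (hasFDerivAt_fst (𝕜 := ℝ) (p := (u q, w q))).mul' (hasFDerivAt_snd (𝕜 := ℝ) (p := (u q, w q)))
  rw [this.fderiv]
  simp

theorem DiffAt.mul' {𝔸 : Type*} [NormedRing 𝔸] [NormedAlgebra ℝ 𝔸] {u w : M → 𝔸} {q : M}
    (hu : DiffAt u q) (hw : DiffAt w q) : DiffAt (fun p => u p * w p) q :=
  DiffAt.comp_differentiableAt (g := fun p : 𝔸 × 𝔸 => p.1 * p.2) (by fun_prop)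
    (hu.prodMk_space hw)

theorem mvfderiv_add' {u w : M → E} {q : M}
    (hu : DiffAt u q) (hw : DiffAt w q) (v : TangentSpace (𝓡 2) q) :
    mvfderiv (𝓡 2) (fun p => u p + w p) q v
      = mvfderiv (𝓡 2) u q v + mvfderiv (𝓡 2) w q v := by
  rw [mvfderiv_fun_add hu hw]; rfl

theorem mvfderiv_sub' {u w : M → E} {q : M}
    (hu : DiffAt u q) (hw : DiffAt w q) (v : TangentSpace (𝓡 2) q) :
    mvfderiv (𝓡 2) (fun p => u p - w p) q v
      = mvfderiv (𝓡 2) u q v - mvfderiv (𝓡 2) w q v := by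
  rw [mvfderiv_fun_sub hu hw]; rfl

theorem mvfderiv_const' (c : E) (q : M) (v : TangentSpace (𝓡 2) q) :
    mvfderiv (𝓡 2) (fun _ : M => c) q v = 0 := by
  rw [mvfderiv_const]; rfl

theorem mvfderiv_sum {ι : Type*} {s : Finset ι} {u : ι → M → E} {q : M}
    (hu : ∀ i ∈ s, DiffAt (u i) q) (v : TangentSpace (𝓡 2) q) :
    DiffAt (fun p => ∑ i ∈ s, u i p) q ∧
    mvfderiv (𝓡 2) (fun p => ∑ i ∈ s, u i p) q v = ∑ i ∈ s, mvfderiv (𝓡 2) (u i) q v := by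
  classical
  induction s using Finset.induction_on with
  | empty => simpa using ⟨mdifferentiableAt_const, mvfderiv_const' (0 : E) q v⟩
  | insert i s hi ih =>
    obtain ⟨h1, h2⟩ := ih fun j hj => hu j (by simp [hj])
    have hi' := hu i (by simp)
    simp only [Finset.sum_insert hi]
    exact ⟨hi'.add h1, by rw [mvfderiv_add' hi' h1, h2]⟩

theorem mvfderiv_congr {u w : M → E} {q : M} (h : u =ᶠ[nhds q] w) :
    mvfderiv (𝓡 2) u q = mvfderiv (𝓡 2) w q := by
  ext v
  have h1 := h.mfderiv_eq (I := 𝓡 2) (I' := 𝓘(ℝ, E))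
  exact congr($h1 v)

theorem mvfderiv_congr_of_mem {u w : M → E} {U : Set M} (hU : IsOpen U) {q : M} (hq : q ∈ U)
    (h : ∀ p ∈ U, u p = w p) : mvfderiv (𝓡 2) u q = mvfderiv (𝓡 2) w q :=
  mvfderiv_congr (Filter.eventuallyEq_of_mem (hU.mem_nhds hq) h)

theorem mvfderiv_conj {u : M → ℂ} {q : M} (h : DiffAt u q) (v : TangentSpace (𝓡 2) q) :
    mvfderiv (𝓡 2) (fun p => conj (u p)) q v = conj (mvfderiv (𝓡 2) u q v) :=
  mvfderiv_clm Complex.conjCLE.toContinuousLinearMap h v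

theorem mvfderiv_re {u : M → ℂ} {q : M} (h : DiffAt u q) (v : TangentSpace (𝓡 2) q) :
    mvfderiv (𝓡 2) (fun p => (u p).re) q v = (mvfderiv (𝓡 2) u q v).re :=
  mvfderiv_clm Complex.reCLM h v

theorem mvfderiv_im {u : M → ℂ} {q : M} (h : DiffAt u q) (v : TangentSpace (𝓡 2) q) :
    mvfderiv (𝓡 2) (fun p => (u p).im) q v = (mvfderiv (𝓡 2) u q v).im :=
  mvfderiv_clm Complex.imCLM h v

theorem mvfderiv_apply {ι : Type*} [Fintype ι] {u : M → ι → ℝ} {q : M} (h : DiffAt u q)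
    (i : ι) (v : TangentSpace (𝓡 2) q) :
    mvfderiv (𝓡 2) (fun p => u p i) q v = mvfderiv (𝓡 2) u q v i :=
  mvfderiv_clm (ContinuousLinearMap.proj (R := ℝ) (φ := fun _ : ι => ℝ) i) h v

theorem fderiv_clm_apply_fixed {c : E → F →L[ℝ] G} {x : E} (hc : DifferentiableAt ℝ c x)
    (w : F) (y : E) : fderiv ℝ (fun x => c x w) x y = fderiv ℝ c x y w := by
  rw [fderiv_clm_apply hc (differentiableAt_const w)]
  simp

/-! ### Coordinate vector fields -/

/-- The differential of the inverse of the preferred chart at `q₀`. -/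
def coordMap (q₀ q : M) : Plane →L[ℝ] TangentSpace (𝓡 2) q :=
  mfderiv 𝓘(ℝ, Plane) (𝓡 2) (chartAt Plane q₀).symm (chartAt Plane q₀ q)

/-- The `k`-th coordinate vector field of the preferred chart at `q₀`. -/
def coordField (q₀ : M) (k : Fin 2) (q : M) : TangentSpace (𝓡 2) q :=
  coordMap q₀ q (EuclideanSpace.basisFun (Fin 2) ℝ k)

/-- The derivative in the direction of the `k`-th coordinate vector field. -/
def pd (q₀ : M) (k : Fin 2) (u : M → E) (q : M) : E := mvfderiv (𝓡 2) u q (coordField q₀ k q)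

variable [IsManifold (𝓡 2) ∞ M]

theorem pd_eq_fderiv (q₀ : M) (k : Fin 2) {u : M → E} {q : M}
    (hq : q ∈ (chartAt Plane q₀).source) (hu : DiffAt u q) :
    pd q₀ k u q = fderiv ℝ (u ∘ (chartAt Plane q₀).symm) (chartAt Plane q₀ q)
      (EuclideanSpace.basisFun (Fin 2) ℝ k) := by
  have : IsManifold (𝓡 2) 1 M := IsManifold.of_le (n := ∞) (by simp)
  have hc := (mdifferentiable_chart (I := 𝓡 2) q₀).mdifferentiableAt_symm
    ((chartAt Plane q₀).map_source hq)
  rw [pd, coordField]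
  have hs : (chartAt Plane q₀).symm (chartAt Plane q₀ q) = q := (chartAt Plane q₀).left_inv hq
  have := mfderiv_comp_apply_of_eq (chartAt Plane q₀ q) hu hc hs
    (EuclideanSpace.basisFun (Fin 2) ℝ k)
  rw [← mfderiv_eq_fderiv]
  exact this.symm

/-- With `coordField_independent` this makes the coordinate fields a basis over the chart domain, so
identities between 1-forms are checked on the two components k = 0, 1. -/
theorem exists_eq_smul_coordField (q₀ : M) {q : M} (hq : q ∈ (chartAt Plane q₀).source)
    (v : TangentSpace (𝓡 2) q) :
    ∃ a : Fin 2 → ℝ, v = a 0 • coordField q₀ 0 q + a 1 • coordField q₀ 1 q := by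
  have : IsManifold (𝓡 2) 1 M := IsManifold.of_le (n := ∞) (by simp)
  have h := (mdifferentiable_chart (I := 𝓡 2) q₀).symm_comp_deriv hq
  have h2 := congr($h v)
  set w : Plane := mfderiv (𝓡 2) (𝓡 2) (chartAt Plane q₀) q v with hw
  refine ⟨fun i => w i, ?_⟩
  have h3 : w = w 0 • EuclideanSpace.basisFun (Fin 2) ℝ 0
      + w 1 • EuclideanSpace.basisFun (Fin 2) ℝ 1 := by
    ext i; fin_cases i <;> simp
  rw [coordField, coordField, ← (coordMap q₀ q).map_smul, ← (coordMap q₀ q).map_smul,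
    ← (coordMap q₀ q).map_add, ← h3]
  exact h2.symm

theorem coordField_independent (q₀ : M) {q : M} (hq : q ∈ (chartAt Plane q₀).source)
    {a b : ℝ} (h : a • coordField q₀ 0 q + b • coordField q₀ 1 q = 0) : a = 0 ∧ b = 0 := by
  have : IsManifold (𝓡 2) 1 M := IsManifold.of_le (n := ∞) (by simp)
  have hc := (mdifferentiable_chart (I := 𝓡 2) q₀).comp_symm_deriv
    ((chartAt Plane q₀).map_source hq)
  rw [coordField, coordField, ← (coordMap q₀ q).map_smul, ← (coordMap q₀ q).map_smul,
    ← (coordMap q₀ q).map_add] at h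
  set w : Plane := a • EuclideanSpace.basisFun (Fin 2) ℝ 0
    + b • EuclideanSpace.basisFun (Fin 2) ℝ 1 with hw
  have h2 : w = 0 := by
    have h3 : w = (ContinuousLinearMap.id ℝ Plane) w := rfl
    have h4 := congr($hc w)
    refine h3.trans (h4.symm.trans ?_)
    exact (congrArg _ h).trans (ContinuousLinearMap.map_zero _)
  have e0 := congr($h2 0)
  have e1 := congr($h2 1)
  simp [hw] at e0 e1
  exact ⟨e0, e1⟩

omit [IsManifold (𝓡 2) ∞ M] in
theorem isOpen_chart_image (q₀ : M) {U : Set M} (hU : IsOpen U) :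
    IsOpen ((chartAt Plane q₀).target ∩ (chartAt Plane q₀).symm ⁻¹' U) :=
  (chartAt Plane q₀).isOpen_inter_preimage_symm hU

theorem SmoothOn.contDiffOn_chart (q₀ : M) {U : Set M} {u : M → E} (hu : SmoothOn U u) :
    ContDiffOn ℝ ∞ (u ∘ (chartAt Plane q₀).symm)
      ((chartAt Plane q₀).target ∩ (chartAt Plane q₀).symm ⁻¹' U) := by
  rw [← contMDiffOn_iff_contDiffOn]
  exact hu.comp ((contMDiffOn_chart_symm (I := 𝓡 2) (x := q₀) (n := ∞)).mono
    Set.inter_subset_left) fun x hx => hx.2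

theorem smoothOn_of_contDiffOn_chart (q₀ : M) {U : Set M} (hU : U ⊆ (chartAt Plane q₀).source)
    {u : M → E} {g : Plane → E} {T : Set Plane} (hg : ContDiffOn ℝ ∞ g T)
    (hT : ∀ q ∈ U, chartAt Plane q₀ q ∈ T) (h : ∀ q ∈ U, u q = g (chartAt Plane q₀ q)) :
    SmoothOn U u := by
  have : SmoothOn U (fun q => g (chartAt Plane q₀ q)) :=
    SmoothOn.comp_contDiffOn hg
      ((contMDiffOn_chart (I := 𝓡 2) (x := q₀) (n := ∞)).mono hU) hT
  exact this.congr h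

theorem SmoothOn.pd (q₀ : M) (k : Fin 2) {U : Set M} (hU : IsOpen U)
    (hS : U ⊆ (chartAt Plane q₀).source) {u : M → E} (hu : SmoothOn U u) :
    SmoothOn U (pd q₀ k u) := by
  have h1 := hu.contDiffOn_chart q₀
  have hO := isOpen_chart_image q₀ hU
  have h2 := h1.fderiv_of_isOpen (m := ∞) hO (by simp)
  refine smoothOn_of_contDiffOn_chart q₀ hS
    (h2.clm_apply (contDiffOn_const (c := EuclideanSpace.basisFun (Fin 2) ℝ k)))
    (fun q hq => ⟨(chartAt Plane q₀).map_source (hS hq), ?_⟩)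
    fun q hq => pd_eq_fderiv q₀ k (hS hq) (hu.diffAt hU hq)
  rw [Set.mem_preimage, (chartAt Plane q₀).left_inv (hS hq)]
  exact hq

/-- Coordinate fields commute. Hence dφ(∂₀, ∂₁) is `pd 0 φ₁ - pd 1 φ₀`, and every use of d² = 0
below, for X, f or z, is this symmetry of second derivatives. -/
theorem pd_comm (q₀ : M) {U : Set M} (hU : IsOpen U)
    (hS : U ⊆ (chartAt Plane q₀).source) {u : M → E} (hu : SmoothOn U u) {q : M} (hq : q ∈ U) :
    pd q₀ 0 (pd q₀ 1 u) q = pd q₀ 1 (pd q₀ 0 u) q := by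
  have h1 := hu.contDiffOn_chart q₀
  have hO := isOpen_chart_image q₀ hU
  have hqO : chartAt Plane q₀ q ∈
      (chartAt Plane q₀).target ∩ (chartAt Plane q₀).symm ⁻¹' U := by
    refine ⟨(chartAt Plane q₀).map_source (hS hq), ?_⟩
    rw [Set.mem_preimage, (chartAt Plane q₀).left_inv (hS hq)]
    exact hq
  have key : ∀ j k : Fin 2, LagrangianSurface.pd q₀ j (LagrangianSurface.pd q₀ k u) q =
      fderiv ℝ (fderiv ℝ (u ∘ (chartAt Plane q₀).symm)) (chartAt Plane q₀ q)
        (EuclideanSpace.basisFun (Fin 2) ℝ j) (EuclideanSpace.basisFun (Fin 2) ℝ k) := by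
    intro j k
    rw [pd_eq_fderiv q₀ j (hS hq) ((hu.pd q₀ k hU hS).diffAt hU hq)]
    have : (LagrangianSurface.pd q₀ k u ∘ (chartAt Plane q₀).symm)
        =ᶠ[nhds (chartAt Plane q₀ q)] fun x => fderiv ℝ (u ∘ (chartAt Plane q₀).symm) x
          (EuclideanSpace.basisFun (Fin 2) ℝ k) := by
      refine Filter.eventuallyEq_of_mem (hO.mem_nhds hqO) fun x hx => ?_
      rw [Function.comp_apply, pd_eq_fderiv q₀ k (hS hx.2) (hu.diffAt hU hx.2),
        (chartAt Plane q₀).right_inv hx.1]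
    rw [this.fderiv_eq, fderiv_clm_apply_fixed]
    exact ((h1.fderiv_of_isOpen (m := ∞) hO (by simp)).contDiffAt
      (hO.mem_nhds hqO)).differentiableAt (by simp)
  rw [key, key]
  exact (h1.contDiffAt (hO.mem_nhds hqO)).isSymmSndFDerivAt
    (by rw [minSmoothness_of_isRCLikeNormedField]; exact WithTop.coe_le_coe.2 le_top) _ _

omit [IsManifold (𝓡 2) ∞ M] in
/-- Every neighbourhood of `q₀` contains a coordinate disc around `q₀`. -/
theorem exists_coordinate_disc (q₀ : M) {N : Set M} (hN : N ∈ nhds q₀) :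
    ∃ (W : Set M) (r : ℝ), 0 < r ∧ IsOpen W ∧ q₀ ∈ W ∧ W ⊆ N ∧ W ⊆ (chartAt Plane q₀).source ∧
      (chartAt Plane q₀).target ∩ (chartAt Plane q₀).symm ⁻¹' W
        = Metric.ball (chartAt Plane q₀ q₀) r := by
  set φ := chartAt Plane q₀
  have h1 : φ.target ∩ φ.symm ⁻¹' interior N ∈ nhds (φ q₀) := by
    refine (isOpen_chart_image q₀ isOpen_interior).mem_nhds ⟨mem_chart_target Plane q₀, ?_⟩
    rw [Set.mem_preimage, φ.left_inv (mem_chart_source Plane q₀)]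
    exact mem_interior_iff_mem_nhds.2 hN
  obtain ⟨r, hr, hb⟩ := Metric.mem_nhds_iff.1 h1
  refine ⟨φ.source ∩ φ ⁻¹' Metric.ball (φ q₀) r, r, hr,
    φ.isOpen_inter_preimage Metric.isOpen_ball,
    ⟨mem_chart_source Plane q₀, by simpa using hr⟩, ?_, Set.inter_subset_left, ?_⟩
  · intro q hq
    have := (hb hq.2).2
    rw [Set.mem_preimage, φ.left_inv hq.1] at this
    exact interior_subset this
  · ext x
    refine ⟨fun hx => ?_, fun hx => ⟨(hb hx).1, φ.map_target (hb hx).1, ?_⟩⟩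
    · have := hx.2.2
      rwa [Set.mem_preimage, φ.right_inv hx.1] at this
    · rw [Set.mem_preimage, φ.right_inv (hb hx).1]
      exact hx

theorem fderiv_eq_zero_of_basis {g : Plane →L[ℝ] E}
    (h : ∀ k, g (EuclideanSpace.basisFun (Fin 2) ℝ k) = 0) : g = 0 := by
  ext w
  have h3 : w = w 0 • EuclideanSpace.basisFun (Fin 2) ℝ 0
      + w 1 • EuclideanSpace.basisFun (Fin 2) ℝ 1 := by
    ext i; fin_cases i <;> simp
  rw [h3, map_add, map_smul, map_smul, h, h]
  simp

theorem eq_of_pd_eq_zero (q₀ : M) {W : Set M} {r : ℝ} (hW : IsOpen W)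
    (hS : W ⊆ (chartAt Plane q₀).source)
    (hb : (chartAt Plane q₀).target ∩ (chartAt Plane q₀).symm ⁻¹' W
        = Metric.ball (chartAt Plane q₀ q₀) r) {u : M → E} (hu : SmoothOn W u)
    (h0 : ∀ k, ∀ q ∈ W, pd q₀ k u q = 0) {p q : M} (hp : p ∈ W) (hq : q ∈ W) : u p = u q := by
  have h1 := hu.contDiffOn_chart q₀
  rw [hb] at h1
  have hmem : ∀ q ∈ W, chartAt Plane q₀ q ∈ Metric.ball (chartAt Plane q₀ q₀) r := by
    intro q hq
    rw [← hb]
    refine ⟨(chartAt Plane q₀).map_source (hS hq), ?_⟩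
    rw [Set.mem_preimage, (chartAt Plane q₀).left_inv (hS hq)]
    exact hq
  have := Metric.isOpen_ball.is_const_of_fderiv_eq_zero (𝕜 := ℝ)
    (convex_ball (chartAt Plane q₀ q₀) r).isPreconnected
    (h1.differentiableOn (by simp)) (fun x hx => ?_) (hmem p hp) (hmem q hq)
  · simpa only [Function.comp_apply, (chartAt Plane q₀).left_inv (hS hp),
      (chartAt Plane q₀).left_inv (hS hq)] using this
  · rw [← hb] at hx
    refine fderiv_eq_zero_of_basis fun k => ?_
    have h2 := pd_eq_fderiv q₀ k (hS hx.2) (hu.diffAt hW hx.2)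
    rw [(chartAt Plane q₀).right_inv hx.1] at h2
    rw [← h2]
    exact h0 k _ hx.2

/-- Closed forms on coordinate discs are exact. -/
theorem exists_primitive [CompleteSpace E] (q₀ : M) {W : Set M} {r : ℝ} (hW : IsOpen W)
    (hS : W ⊆ (chartAt Plane q₀).source)
    (hb : (chartAt Plane q₀).target ∩ (chartAt Plane q₀).symm ⁻¹' W
        = Metric.ball (chartAt Plane q₀ q₀) r) {a : Fin 2 → M → E} (ha : ∀ k, SmoothOn W (a k))
    (hd : ∀ q ∈ W, pd q₀ 0 (a 1) q = pd q₀ 1 (a 0) q) :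
    ∃ u : M → E, SmoothOn W u ∧ ∀ k, ∀ q ∈ W, pd q₀ k u q = a k q := by
  set φ := chartAt Plane q₀ with hφ
  set B := Metric.ball (φ q₀) r with hB
  have hmem : ∀ q ∈ W, φ q ∈ B := by
    intro q hq
    rw [← hb]
    refine ⟨φ.map_source (hS hq), ?_⟩
    rw [Set.mem_preimage, φ.left_inv (hS hq)]
    exact hq
  have hBW : ∀ x ∈ B, φ.symm x ∈ W ∧ φ (φ.symm x) = x := by
    intro x hx
    rw [← hb] at hx
    exact ⟨hx.2, φ.right_inv hx.1⟩
  have h1 : ∀ k, ContDiffOn ℝ ∞ (a k ∘ φ.symm) B := by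
    intro k
    have := (ha k).contDiffOn_chart q₀
    rwa [hb] at this
  -- The form a₀ dx⁰ + a₁ dx¹ in the chart. By `hd` its derivative is symmetric, so the Poincaré
  -- lemma on the convex ball applies.
  let ζ : Plane → Plane →L[ℝ] E := fun x =>
    (EuclideanSpace.proj (𝕜 := ℝ) (0 : Fin 2)).smulRight (a 0 (φ.symm x))
      + (EuclideanSpace.proj (𝕜 := ℝ) (1 : Fin 2)).smulRight (a 1 (φ.symm x))
  have hζ : ContDiffOn ℝ ∞ ζ B :=
    ((contDiffOn_const (c := EuclideanSpace.proj (𝕜 := ℝ) (0 : Fin 2))).smulRight (h1 0)).add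
      ((contDiffOn_const (c := EuclideanSpace.proj (𝕜 := ℝ) (1 : Fin 2))).smulRight (h1 1))
  have hζd : ∀ x ∈ B, ∀ y w : Plane, fderiv ℝ ζ x y w
      = w 0 • fderiv ℝ (a 0 ∘ φ.symm) x y + w 1 • fderiv ℝ (a 1 ∘ φ.symm) x y := by
    intro x hx y w
    have hdiff := (hζ.contDiffAt (Metric.isOpen_ball.mem_nhds hx)).differentiableAt (by simp)
    rw [← fderiv_clm_apply_fixed hdiff]
    have h0 := ((h1 0).contDiffAt (Metric.isOpen_ball.mem_nhds hx)).differentiableAt (by simp)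
    have h1 := ((h1 1).contDiffAt (Metric.isOpen_ball.mem_nhds hx)).differentiableAt (by simp)
    have : (fun x => ζ x w) = w 0 • (a 0 ∘ φ.symm) + w 1 • (a 1 ∘ φ.symm) := by
      funext x; simp [ζ]
    rw [this, ((h0.hasFDerivAt.const_smul (w 0)).add (h1.hasFDerivAt.const_smul (w 1))).fderiv]
    simp
  obtain ⟨g, hg⟩ := (convex_ball (φ q₀) r).exists_forall_hasFDerivAt_of_fderiv_symmetric
    Metric.isOpen_ball (hζ.differentiableOn (n := ∞) (by simp)) (by
      intro x hx y w
      rw [hζd x hx, hζd x hx]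
      have hc := hd _ (hBW x hx).1
      rw [pd_eq_fderiv q₀ 0 (hS (hBW x hx).1) ((ha 1).diffAt hW (hBW x hx).1),
        pd_eq_fderiv q₀ 1 (hS (hBW x hx).1) ((ha 0).diffAt hW (hBW x hx).1), ← hφ,
        (hBW x hx).2] at hc
      have h3 : ∀ w : Plane, w = w 0 • EuclideanSpace.basisFun (Fin 2) ℝ 0
          + w 1 • EuclideanSpace.basisFun (Fin 2) ℝ 1 := by
        intro w; ext i; fin_cases i <;> simp
      have e : ∀ k, ∀ y : Plane, fderiv ℝ (a k ∘ φ.symm) x y =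
          y 0 • fderiv ℝ (a k ∘ φ.symm) x (EuclideanSpace.basisFun (Fin 2) ℝ 0)
          + y 1 • fderiv ℝ (a k ∘ φ.symm) x (EuclideanSpace.basisFun (Fin 2) ℝ 1) := by
        intro k y
        conv_lhs => rw [h3 y]
        rw [map_add, map_smul, map_smul]
      rw [e 0 y, e 1 y, e 0 w, e 1 w, hc]
      module)
  have hgs : ContDiffOn ℝ ∞ g B := by
    rw [contDiffOn_infty_iff_fderiv_of_isOpen Metric.isOpen_ball]
    refine ⟨fun x hx => (hg x hx).differentiableAt.differentiableWithinAt,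
      hζ.congr fun x hx => (hg x hx).fderiv⟩
  have hu : SmoothOn W (fun q => g (φ q)) :=
    smoothOn_of_contDiffOn_chart q₀ hS hgs hmem fun q _ => rfl
  refine ⟨fun q => g (φ q), hu, fun k q hq => ?_⟩
  rw [pd_eq_fderiv q₀ k (hS hq) (hu.diffAt hW hq), ← hφ]
  have : ((fun q => g (φ q)) ∘ φ.symm) =ᶠ[nhds (φ q)] g :=
    Filter.eventuallyEq_of_mem (Metric.isOpen_ball.mem_nhds (hmem q hq)) fun x hx =>
      congrArg g (hBW x hx).2
  rw [this.fderiv_eq, (hg _ (hmem q hq)).fderiv]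
  fin_cases k <;> simp [ζ, φ.left_inv (hS hq)]

/-- A smooth function whose differential at `q` is bijective is injective near `q`. -/
theorem exists_injOn_of_bijective [CompleteSpace E] {U : Set M} (hU : IsOpen U) {u : M → E}
    (hu : SmoothOn U u) {q : M} (hq : q ∈ U) (hb : Function.Bijective (mvfderiv (𝓡 2) u q)) :
    ∃ V : Set M, IsOpen V ∧ q ∈ V ∧ V ⊆ U ∧ Set.InjOn u V := by
  set φ := chartAt Plane q with hφ
  have hO := isOpen_chart_image q hU
  have hqs : q ∈ φ.source := mem_chart_source Plane q
  have hqO : φ q ∈ φ.target ∩ φ.symm ⁻¹' U := by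
    refine ⟨φ.map_source hqs, ?_⟩
    rw [Set.mem_preimage, φ.left_inv hqs]
    exact hq
  have h1 := (hu.contDiffOn_chart q).contDiffAt (hO.mem_nhds hqO)
  rw [mvfderiv_eq_fderiv_chart (hu.diffAt hU hq)] at hb
  let L : Plane ≃L[ℝ] E := ContinuousLinearEquiv.ofBijective
    (fderiv ℝ (u ∘ φ.symm) (φ q)) (LinearMap.ker_eq_bot.2 hb.1) (LinearMap.range_eq_top.2 hb.2)
  have hs : HasStrictFDerivAt (u ∘ φ.symm) (L : Plane →L[ℝ] E) (φ q) :=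
    h1.hasStrictFDerivAt (by simp)
  set ψ := hs.toOpenPartialHomeomorph
  refine ⟨U ∩ (φ.source ∩ φ ⁻¹' ψ.source),
    hU.inter (φ.isOpen_inter_preimage ψ.open_source),
    ⟨hq, hqs, hs.mem_toOpenPartialHomeomorph_source⟩, Set.inter_subset_left, ?_⟩
  intro x hx y hy hxy
  refine φ.injOn hx.2.1 hy.2.1 (ψ.injOn hx.2.2 hy.2.2 ?_)
  change (u ∘ φ.symm) (φ x) = (u ∘ φ.symm) (φ y)
  simp only [Function.comp_apply, φ.left_inv hx.2.1, φ.left_inv hy.2.1, hxy]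

end Calculus

/-! ### Complex-linear and antilinear parts of real `2 × 2` matrices -/

section Parts

/-- The complex number `a` in `N w = a w + b w̄`. -/
def lin (N : Matrix (Fin 2) (Fin 2) ℝ) : ℂ := ⟨(N 0 0 + N 1 1) / 2, (N 1 0 - N 0 1) / 2⟩

/-- The complex number `b` in `N w = a w + b w̄`. -/
def cnj (N : Matrix (Fin 2) (Fin 2) ℝ) : ℂ := ⟨(N 0 0 - N 1 1) / 2, (N 1 0 + N 0 1) / 2⟩

/-- The complex number with the given coordinates. -/
def cx (w : Fin 2 → ℝ) : ℂ := ⟨w 0, w 1⟩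

/-- The matrix of `w ↦ a w + b w̄`. -/
def matOf (a b : ℂ) : Matrix (Fin 2) (Fin 2) ℝ :=
  !![a.re + b.re, b.im - a.im; a.im + b.im, a.re - b.re]

@[simp] theorem lin_matOf (a b : ℂ) : lin (matOf a b) = a := by
  apply Complex.ext <;> simp [lin, matOf] <;> ring

@[simp] theorem cnj_matOf (a b : ℂ) : cnj (matOf a b) = b := by
  apply Complex.ext <;> simp [cnj, matOf] <;> ring

theorem parts_ext {N N' : Matrix (Fin 2) (Fin 2) ℝ} (h1 : lin N = lin N') (h2 : cnj N = cnj N') :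
    N = N' := by
  simp only [lin, cnj, Complex.mk.injEq] at h1 h2
  ext i j
  fin_cases i <;> fin_cases j <;> simp <;> linarith [h1.1, h1.2, h2.1, h2.2]

/-- Compose w ↦ a w + b w̄ with w ↦ a' w + b' w̄; the conjugates come from the inner map being
conjugated by the outer antilinear term. -/
theorem lin_mul (N N' : Matrix (Fin 2) (Fin 2) ℝ) :
    lin (N * N') = lin N * lin N' + cnj N * conj (cnj N') := by
  apply Complex.ext <;> simp [lin, cnj, Matrix.mul_apply, Fin.sum_univ_two] <;> ring

theorem cnj_mul (N N' : Matrix (Fin 2) (Fin 2) ℝ) :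
    cnj (N * N') = lin N * cnj N' + cnj N * conj (lin N') := by
  apply Complex.ext <;> simp [lin, cnj, Matrix.mul_apply, Fin.sum_univ_two] <;> ring

theorem cx_mulVec (N : Matrix (Fin 2) (Fin 2) ℝ) (w : Fin 2 → ℝ) :
    cx (N *ᵥ w) = lin N * cx w + cnj N * conj (cx w) := by
  apply Complex.ext <;>
    simp [lin, cnj, cx, Matrix.mulVec, dotProduct, Fin.sum_univ_two] <;> ring

@[simp] theorem lin_transpose (N : Matrix (Fin 2) (Fin 2) ℝ) : lin Nᵀ = conj (lin N) := by
  apply Complex.ext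
  · simp [lin]
  · simp [lin]; ring

@[simp] theorem cnj_transpose (N : Matrix (Fin 2) (Fin 2) ℝ) : cnj Nᵀ = cnj N := by
  apply Complex.ext
  · simp [cnj]
  · simp [cnj]; ring

@[simp] theorem lin_add (N N' : Matrix (Fin 2) (Fin 2) ℝ) : lin (N + N') = lin N + lin N' := by
  apply Complex.ext <;> simp [lin] <;> ring

@[simp] theorem cnj_add (N N' : Matrix (Fin 2) (Fin 2) ℝ) : cnj (N + N') = cnj N + cnj N' := by
  apply Complex.ext <;> simp [cnj] <;> ring

@[simp] theorem lin_sub (N N' : Matrix (Fin 2) (Fin 2) ℝ) : lin (N - N') = lin N - lin N' := by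
  apply Complex.ext <;> simp [lin] <;> ring

@[simp] theorem cnj_sub (N N' : Matrix (Fin 2) (Fin 2) ℝ) : cnj (N - N') = cnj N - cnj N' := by
  apply Complex.ext <;> simp [cnj] <;> ring

@[simp] theorem lin_one : lin 1 = 1 := by apply Complex.ext <;> simp [lin]

@[simp] theorem cnj_one : cnj 1 = 0 := by apply Complex.ext <;> simp [cnj]

/-- Used twice over: `lin γ = 0` turns the conformal form -det γ into |ω|², and a positive
determinant forces `lin ≠ 0`. -/
theorem det_eq_normSq_sub (N : Matrix (Fin 2) (Fin 2) ℝ) :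
    N.det = Complex.normSq (lin N) - Complex.normSq (cnj N) := by
  simp only [Matrix.det_fin_two, lin, cnj, Complex.normSq_mk]
  ring

theorem cx_eq_zero {w : Fin 2 → ℝ} (h : cx w = 0) : w = 0 := by
  have h1 := congrArg Complex.re h
  have h2 := congrArg Complex.im h
  simp only [cx, Complex.zero_re, Complex.zero_im] at h1 h2
  ext i; fin_cases i <;> simp [h1, h2]

end Parts

/-! ### Matrix-valued functions -/

section MatrixCalculus

variable {M : Type*} [TopologicalSpace M] [ChartedSpace Plane M]
variable {l m n : Type*} [Fintype l] [Fintype m] [Fintype n]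

/-- Smoothness of the entries of a matrix-valued function. -/
def SmoothMat (U : Set M) (X : M → Matrix m n ℝ) : Prop := ∀ i j, SmoothOn U (fun q => X q i j)

/-- The differential of a matrix-valued function. -/
def dMat (X : M → Matrix m n ℝ) (q : M) (v : TangentSpace (𝓡 2) q) : Matrix m n ℝ :=
  Matrix.of fun i j => mvfderiv (𝓡 2) (fun p => X p i j) q v

omit [Fintype m] [Fintype n] in
theorem SmoothMat.mono {U V : Set M} {X : M → Matrix m n ℝ} (h : SmoothMat U X) (hV : V ⊆ U) :
    SmoothMat V X := fun i j => (h i j).mono hV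

omit [Fintype l] [Fintype n] in
theorem SmoothMat.mul {U : Set M} {X : M → Matrix l m ℝ} {Y : M → Matrix m n ℝ}
    (hX : SmoothMat U X) (hY : SmoothMat U Y) : SmoothMat U (fun q => X q * Y q) := by
  intro i j
  simp only [Matrix.mul_apply]
  exact SmoothOn.sum fun k _ => (hX i k).mul (hY k j)

omit [Fintype m] [Fintype n] in
theorem SmoothMat.transpose {U : Set M} {X : M → Matrix m n ℝ}
    (hX : SmoothMat U X) : SmoothMat U (fun q => (X q)ᵀ) := fun i j => hX j i

omit [Fintype m] [Fintype n] in
theorem SmoothMat.const {U : Set M} (C : Matrix m n ℝ) : SmoothMat U (fun _ : M => C) :=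
  fun i j => SmoothOn.const (C i j)

theorem SmoothMat.fromBlocks {U : Set M} {A B C D : M → Matrix (Fin 2) (Fin 2) ℝ}
    (hA : SmoothMat U A) (hB : SmoothMat U B) (hC : SmoothMat U C) (hD : SmoothMat U D) :
    SmoothMat U (fun q => Matrix.fromBlocks (A q) (B q) (C q) (D q)) := by
  rintro (i | i) (j | j)
  · exact hA i j
  · exact hB i j
  · exact hC i j
  · exact hD i j

omit [Fintype m] [Fintype n] in
theorem dMat_congr {U : Set M} (hU : IsOpen U) {X Y : M → Matrix m n ℝ} {q : M} (hq : q ∈ U)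
    (h : ∀ p ∈ U, X p = Y p) : dMat X q = dMat Y q := by
  funext v
  ext i j
  simp only [dMat, Matrix.of_apply]
  rw [mvfderiv_congr_of_mem hU hq fun p hp => by rw [h p hp]]

omit [Fintype l] [Fintype n] in
theorem dMat_mul {U : Set M} (hU : IsOpen U) {X : M → Matrix l m ℝ} {Y : M → Matrix m n ℝ}
    (hX : SmoothMat U X) (hY : SmoothMat U Y) {q : M} (hq : q ∈ U) (v : TangentSpace (𝓡 2) q) :
    dMat (fun p => X p * Y p) q v = dMat X q v * Y q + X q * dMat Y q v := by
  ext i j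
  simp only [dMat, Matrix.of_apply, Matrix.mul_apply, Matrix.add_apply]
  have hx := fun k => (hX i k).diffAt hU hq
  have hy := fun k => (hY k j).diffAt hU hq
  rw [(mvfderiv_sum (fun k _ => (hx k).mul' (hy k)) v).2, ← Finset.sum_add_distrib]
  refine Finset.sum_congr rfl fun k _ => ?_
  rw [mvfderiv_mul' (hx k) (hy k)]
  ring

omit [Fintype m] [Fintype n] in
theorem dMat_const (C : Matrix m n ℝ) (q : M) (v : TangentSpace (𝓡 2) q) :
    dMat (fun _ : M => C) q v = 0 := by
  ext i j
  exact mvfderiv_const' (C i j) q v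

omit [Fintype m] [Fintype n] in
theorem dMat_transpose (X : M → Matrix m n ℝ) (q : M) (v : TangentSpace (𝓡 2) q) :
    dMat (fun p => (X p)ᵀ) q v = (dMat X q v)ᵀ := rfl

theorem dMat_fromBlocks (A B C D : M → Matrix (Fin 2) (Fin 2) ℝ) (q : M)
    (v : TangentSpace (𝓡 2) q) :
    dMat (fun p => Matrix.fromBlocks (A p) (B p) (C p) (D p)) q v
      = Matrix.fromBlocks (dMat A q v) (dMat B q v) (dMat C q v) (dMat D q v) := by
  ext (i | i) (j | j) <;> rfl

theorem SmoothMat.lin {U : Set M} {X : M → Matrix (Fin 2) (Fin 2) ℝ} (hX : SmoothMat U X) :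
    SmoothOn U (fun q => lin (X q)) := by
  have h : ∀ q, LagrangianSurface.lin (X q) = (((X q 0 0 + X q 1 1 : ℝ) : ℂ)
      + ((X q 1 0 - X q 0 1 : ℝ) : ℂ) * Complex.I) * (1 / 2 : ℂ) := fun q => by
    apply Complex.ext <;> simp [LagrangianSurface.lin] <;> ring
  simp only [h]
  exact (((hX 0 0).add (hX 1 1)).ofReal.add
    (((hX 1 0).sub (hX 0 1)).ofReal.mul (SmoothOn.const _))).mul (SmoothOn.const _)

theorem SmoothMat.cnj {U : Set M} {X : M → Matrix (Fin 2) (Fin 2) ℝ} (hX : SmoothMat U X) :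
    SmoothOn U (fun q => cnj (X q)) := by
  have h : ∀ q, LagrangianSurface.cnj (X q) = (((X q 0 0 - X q 1 1 : ℝ) : ℂ)
      + ((X q 1 0 + X q 0 1 : ℝ) : ℂ) * Complex.I) * (1 / 2 : ℂ) := fun q => by
    apply Complex.ext <;> simp [LagrangianSurface.cnj] <;> ring
  simp only [h]
  exact (((hX 0 0).sub (hX 1 1)).ofReal.add
    (((hX 1 0).add (hX 0 1)).ofReal.mul (SmoothOn.const _))).mul (SmoothOn.const _)

theorem SmoothMat.matOf {U : Set M} {a b : M → ℂ} (ha : SmoothOn U a) (hb : SmoothOn U b) :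
    SmoothMat U (fun q => matOf (a q) (b q)) := by
  intro i j
  fin_cases i <;> fin_cases j
  · exact ha.re.add hb.re
  · exact hb.im.sub ha.im
  · exact ha.im.add hb.im
  · exact ha.re.sub hb.re

theorem mvfderiv_lin {U : Set M} (hU : IsOpen U) {X : M → Matrix (Fin 2) (Fin 2) ℝ}
    (hX : SmoothMat U X) {q : M} (hq : q ∈ U) (v : TangentSpace (𝓡 2) q) :
    mvfderiv (𝓡 2) (fun p => lin (X p)) q v = lin (dMat X q v) := by
  have h := hX.lin.diffAt hU hq
  have e := fun i j => (hX i j).diffAt hU hq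
  apply Complex.ext
  · rw [← mvfderiv_re h]
    simp only [lin, div_eq_mul_inv]
    have e' : DiffAt (fun p => X p 0 0 + X p 1 1) q := (e 0 0).add (e 1 1)
    rw [mvfderiv_mul' e' mdifferentiableAt_const, mvfderiv_add' (e 0 0) (e 1 1),
      mvfderiv_const']
    simp [dMat]
  · rw [← mvfderiv_im h]
    simp only [lin, div_eq_mul_inv]
    have e' : DiffAt (fun p => X p 1 0 - X p 0 1) q := (e 1 0).sub (e 0 1)
    rw [mvfderiv_mul' e' mdifferentiableAt_const, mvfderiv_sub' (e 1 0) (e 0 1),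
      mvfderiv_const']
    simp [dMat]

theorem mvfderiv_cnj {U : Set M} (hU : IsOpen U) {X : M → Matrix (Fin 2) (Fin 2) ℝ}
    (hX : SmoothMat U X) {q : M} (hq : q ∈ U) (v : TangentSpace (𝓡 2) q) :
    mvfderiv (𝓡 2) (fun p => cnj (X p)) q v = cnj (dMat X q v) := by
  have h := hX.cnj.diffAt hU hq
  have e := fun i j => (hX i j).diffAt hU hq
  apply Complex.ext
  · rw [← mvfderiv_re h]
    simp only [cnj, div_eq_mul_inv]
    have e' : DiffAt (fun p => X p 0 0 - X p 1 1) q := (e 0 0).sub (e 1 1)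
    rw [mvfderiv_mul' e' mdifferentiableAt_const, mvfderiv_sub' (e 0 0) (e 1 1),
      mvfderiv_const']
    simp [dMat]
  · rw [← mvfderiv_im h]
    simp only [cnj, div_eq_mul_inv]
    have e' : DiffAt (fun p => X p 1 0 + X p 0 1) q := (e 1 0).add (e 0 1)
    rw [mvfderiv_mul' e' mdifferentiableAt_const, mvfderiv_add' (e 1 0) (e 0 1),
      mvfderiv_const']
    simp [dMat]

end MatrixCalculus

/-! ### The Maurer-Cartan form of a frame field -/

section MaurerCartan

variable {M : Type*} [TopologicalSpace M] [ChartedSpace Plane M]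

theorem symplectic_isUnit_det {X : Mat4} (h : X ∈ Matrix.symplecticGroup (Fin 2) ℝ) :
    IsUnit X.det := SymplecticGroup.symplectic_det h

theorem symplectic_inv_mem {X : Mat4} (h : X ∈ Matrix.symplecticGroup (Fin 2) ℝ) :
    X⁻¹ ∈ Matrix.symplecticGroup (Fin 2) ℝ := by
  have := SymplecticGroup.coe_inv' (⟨X, h⟩ : Matrix.symplecticGroup (Fin 2) ℝ)
  rw [← this]
  exact SetLike.coe_mem _

namespace IsFrameField

variable {U : Set M} {X : M → Mat4}

theorem smoothMat (h : IsFrameField U X) : SmoothMat U X := h.smooth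

theorem mono (h : IsFrameField U X) {V : Set M} (hV : IsOpen V) (hVU : V ⊆ U) :
    IsFrameField V X :=
  ⟨hV, fun i j => (h.smooth i j).mono hVU, fun q hq => h.symplectic q (hVU hq)⟩

theorem inv_mul (h : IsFrameField U X) {q : M} (hq : q ∈ U) : (X q)⁻¹ * X q = 1 :=
  Matrix.nonsing_inv_mul _ (symplectic_isUnit_det (h.symplectic q hq))

theorem mul_inv (h : IsFrameField U X) {q : M} (hq : q ∈ U) : X q * (X q)⁻¹ = 1 :=
  Matrix.mul_nonsing_inv _ (symplectic_isUnit_det (h.symplectic q hq))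

/-- The inverse of a symplectic matrix is -J ᵗX J, which is linear in the entries of X. -/
theorem smoothMat_inv (h : IsFrameField U X) : SmoothMat U (fun q => (X q)⁻¹) := by
  have h1 : SmoothMat U (fun q => (-Matrix.J (Fin 2) ℝ) * (X q)ᵀ * Matrix.J (Fin 2) ℝ) :=
    ((SmoothMat.const _).mul h.smoothMat.transpose).mul (SmoothMat.const _)
  intro i j
  refine (h1 i j).congr fun q hq => ?_
  exact congrFun (congrFun (SymplecticGroup.inv_eq_symplectic_inv _ (h.symplectic q hq)) i) j

theorem dMat_eq (h : IsFrameField U X) {q : M} (hq : q ∈ U) (v : TangentSpace (𝓡 2) q) :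
    dMat X q v = X q * thetaForm X q v := by
  change _ = X q * ((X q)⁻¹ * dMat X q v)
  rw [← mul_assoc, h.mul_inv hq, one_mul]

/-- The derivative of ᵗX J X = J. Read in blocks, in `gammaForm_symm`, it is the symmetry of β and γ
and the block -ᵗα. -/
theorem thetaForm_symplectic (h : IsFrameField U X) {q : M} (hq : q ∈ U)
    (v : TangentSpace (𝓡 2) q) :
    (thetaForm X q v)ᵀ * Matrix.J (Fin 2) ℝ + Matrix.J (Fin 2) ℝ * thetaForm X q v = 0 := by
  have hc := SmoothMat.const (U := U) (Matrix.J (Fin 2) ℝ)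
  have hX := h.smoothMat
  have h1 : dMat (fun p => (X p)ᵀ * Matrix.J (Fin 2) ℝ * X p) q v = 0 := by
    rw [dMat_congr h.isOpen hq fun p hp => SymplecticGroup.mem_iff'.1 (h.symplectic p hp),
      dMat_const]
  rw [dMat_mul h.isOpen (hX.transpose.mul hc) hX hq, dMat_mul h.isOpen hX.transpose hc hq,
    dMat_const, dMat_transpose, h.dMat_eq hq, Matrix.mul_zero, add_zero, Matrix.transpose_mul] at h1
  have h2 := SymplecticGroup.mem_iff'.1 (h.symplectic q hq)
  rw [← h1]
  conv_lhs => rw [← h2]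
  simp only [Matrix.mul_assoc]

theorem gammaForm_symm (h : IsFrameField U X) {q : M} (hq : q ∈ U) (v : TangentSpace (𝓡 2) q) :
    (gammaForm X q v)ᵀ = gammaForm X q v ∧ (thetaForm X q v).toBlocks₁₂ᵀ
      = (thetaForm X q v).toBlocks₁₂ ∧ (thetaForm X q v).toBlocks₂₂ = -(alphaForm X q v)ᵀ := by
  have h1 := h.thetaForm_symplectic hq v
  rw [← Matrix.fromBlocks_toBlocks (thetaForm X q v), Matrix.J, Matrix.fromBlocks_transpose,
    Matrix.fromBlocks_multiply, Matrix.fromBlocks_multiply, Matrix.fromBlocks_add,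
    ← Matrix.fromBlocks_zero, Matrix.fromBlocks_inj] at h1
  simp only [mul_zero, mul_one, zero_mul, one_mul, zero_add, add_zero, mul_neg, neg_mul] at h1
  refine ⟨?_, ?_, ?_⟩
  · rw [gammaForm]; exact eq_of_sub_eq_zero (by rw [sub_eq_add_neg]; exact h1.1)
  · refine (eq_of_sub_eq_zero ?_).symm
    rw [sub_eq_add_neg, add_comm]; exact h1.2.2.2
  · rw [alphaForm, eq_comm]
    refine eq_of_sub_eq_zero ?_
    rw [sub_eq_add_neg]; exact h1.2.1

variable [IsManifold (𝓡 2) ∞ M]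

theorem smoothMat_dMat (h : IsFrameField U X) {q₀ : M} (hS : U ⊆ (chartAt Plane q₀).source)
    (k : Fin 2) : SmoothMat U (fun q => dMat X q (coordField q₀ k q)) :=
  fun i j => SmoothOn.pd q₀ k h.isOpen hS (h.smooth i j)

theorem smoothMat_theta (h : IsFrameField U X) {q₀ : M} (hS : U ⊆ (chartAt Plane q₀).source)
    (k : Fin 2) : SmoothMat U (fun q => thetaForm X q (coordField q₀ k q)) :=
  h.smoothMat_inv.mul (h.smoothMat_dMat hS k)

/-- The Maurer-Cartan equation `dθ = -θ ∧ θ`. -/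
theorem maurerCartan (h : IsFrameField U X) {q₀ : M} (hS : U ⊆ (chartAt Plane q₀).source)
    {q : M} (hq : q ∈ U) :
    dMat (fun p => thetaForm X p (coordField q₀ 1 p)) q (coordField q₀ 0 q)
      - dMat (fun p => thetaForm X p (coordField q₀ 0 p)) q (coordField q₀ 1 q)
    = thetaForm X q (coordField q₀ 1 q) * thetaForm X q (coordField q₀ 0 q)
      - thetaForm X q (coordField q₀ 0 q) * thetaForm X q (coordField q₀ 1 q) := by
  -- Differentiating dX = Xθ once more gives ∂ⱼ∂ₖX = X(θⱼθₖ + ∂ⱼθₖ); symmetry in j and k is the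
  -- Maurer-Cartan equation.
  have key : ∀ j k, dMat (fun p => dMat X p (coordField q₀ k p)) q (coordField q₀ j q)
      = X q * (thetaForm X q (coordField q₀ j q) * thetaForm X q (coordField q₀ k q)
        + dMat (fun p => thetaForm X p (coordField q₀ k p)) q (coordField q₀ j q)) := by
    intro j k
    rw [dMat_congr h.isOpen hq fun p hp => h.dMat_eq hp (coordField q₀ k p),
      dMat_mul h.isOpen h.smoothMat (h.smoothMat_theta hS k) hq, h.dMat_eq hq, mul_add, mul_assoc]
  have hc : dMat (fun p => dMat X p (coordField q₀ 1 p)) q (coordField q₀ 0 q)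
      = dMat (fun p => dMat X p (coordField q₀ 0 p)) q (coordField q₀ 1 q) := by
    ext i j
    exact pd_comm q₀ h.isOpen hS (h.smooth i j) hq
  rw [key, key] at hc
  have h2 := congrArg (fun N => (X q)⁻¹ * N) hc
  simp only [← mul_assoc, h.inv_mul hq, one_mul] at h2
  rw [sub_eq_sub_iff_add_eq_add, add_comm, h2, add_comm]

end IsFrameField

end MaurerCartan

/-! ### Changes of frame -/

section Gauge

variable {M : Type*} [TopologicalSpace M] [ChartedSpace Plane M]

/-- Smooth maps into the group of block upper triangular symplectic matrices. -/
structure IsGauge (W : Set M) (g : M → Mat4) : Prop extends IsFrameField W g where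
  lower : ∀ q ∈ W, (g q).toBlocks₂₁ = 0

theorem blocks_of_lower {g : Mat4} (hg : g ∈ Matrix.symplecticGroup (Fin 2) ℝ)
    (h : g.toBlocks₂₁ = 0) :
    g.toBlocks₁₁ᵀ * g.toBlocks₂₂ = 1 ∧
    g⁻¹ = Matrix.fromBlocks g.toBlocks₂₂ᵀ (-g.toBlocks₁₂ᵀ) 0 g.toBlocks₁₁ᵀ := by
  obtain ⟨A, B, C, D, rfl⟩ : ∃ A B C D, g = Matrix.fromBlocks A B C D :=
    ⟨_, _, _, _, (Matrix.fromBlocks_toBlocks g).symm⟩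
  simp only [Matrix.toBlocks_fromBlocks₂₁] at h
  subst h
  have h1 := (SymplecticGroup.fromBlocks_mem_iff.1 hg).2.2
  refine ⟨by simpa using h1, ?_⟩
  rw [SymplecticGroup.inv_eq_symplectic_inv _ hg, Matrix.J, Matrix.fromBlocks_transpose,
    Matrix.fromBlocks_neg, Matrix.fromBlocks_multiply, Matrix.fromBlocks_multiply]
  simp

theorem det_mul_det_of_lower {g : Mat4} (hg : g ∈ Matrix.symplecticGroup (Fin 2) ℝ)
    (h : g.toBlocks₂₁ = 0) : g.toBlocks₁₁.det * g.toBlocks₂₂.det = 1 := by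
  have := congrArg Matrix.det (blocks_of_lower hg h).1
  rwa [Matrix.det_mul, Matrix.det_transpose, Matrix.det_one] at this

namespace IsGauge

variable {W : Set M} {g : M → Mat4}

theorem of_blocks {A C D : M → Matrix (Fin 2) (Fin 2) ℝ} (hW : IsOpen W)
    (hA : SmoothMat W A) (hC : SmoothMat W C) (hD : SmoothMat W D)
    (hAD : ∀ q ∈ W, (A q)ᵀ * D q = 1) (hCD : ∀ q ∈ W, (C q)ᵀ * D q = (D q)ᵀ * C q) :
    IsGauge W (fun q => Matrix.fromBlocks (A q) (C q) 0 (D q)) where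
  isOpen := hW
  smooth := hA.fromBlocks hC (SmoothMat.const 0) hD
  symplectic q hq := by
    rw [SymplecticGroup.fromBlocks_mem_iff]
    exact ⟨by simp, hCD q hq, by simpa using hAD q hq⟩
  lower q _ := by simp

/-- The gauge given by a conformal change of `X₁, X₂`. -/
theorem conformal {a : M → ℂ} (hW : IsOpen W) (ha : SmoothOn W a) (h0 : ∀ q ∈ W, a q ≠ 0) :
    IsGauge W (fun q => Matrix.fromBlocks (matOf (a q) 0) 0 0 (matOf (conj (a q))⁻¹ 0)) := by
  refine of_blocks (C := fun _ => 0) hW (SmoothMat.matOf ha (SmoothOn.const 0)) (SmoothMat.const 0)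
    (SmoothMat.matOf (ha.conj.inv fun q hq => by simpa using h0 q hq) (SmoothOn.const 0))
    (fun q hq => parts_ext ?_ ?_) (fun q _ => by simp)
  · have := h0 q hq
    simp [lin_mul, this]
  · simp [cnj_mul]

/-- The gauge that adds multiples of `X₁, X₂` to `X₃, X₄`. -/
theorem shear {r : M → ℝ} {b : M → ℂ} (hW : IsOpen W) (hr : SmoothOn W r) (hb : SmoothOn W b) :
    IsGauge W (fun q => Matrix.fromBlocks 1 (matOf (r q : ℂ) (b q)) 0 1) := by
  refine of_blocks (A := fun _ => 1) (D := fun _ => 1) hW (SmoothMat.const 1)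
    (SmoothMat.matOf (SmoothOn.ofReal hr) hb) (SmoothMat.const 1) (fun q _ => by simp)
    fun q _ => ?_
  apply parts_ext <;> simp

end IsGauge

theorem IsFrameField.gauge {W : Set M} {X g : M → Mat4} (hX : IsFrameField W X)
    (hg : IsFrameField W g) : IsFrameField W (fun q => X q * g q) where
  isOpen := hX.isOpen
  smooth := hX.smoothMat.mul hg.smoothMat
  symplectic q hq := (Matrix.symplecticGroup (Fin 2) ℝ).mul_mem (hX.symplectic q hq)
    (hg.symplectic q hq)

theorem IsFrameField.thetaForm_gauge {W : Set M} {X g : M → Mat4} (hX : IsFrameField W X)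
    (hg : IsFrameField W g) {q : M} (hq : q ∈ W) (v : TangentSpace (𝓡 2) q) :
    thetaForm (fun p => X p * g p) q v
      = (g q)⁻¹ * thetaForm X q v * g q + (g q)⁻¹ * dMat g q v := by
  change (X q * g q)⁻¹ * dMat (fun p => X p * g p) q v = _
  rw [Matrix.mul_inv_rev, dMat_mul hX.isOpen hX.smoothMat hg.smoothMat hq, hX.dMat_eq hq, mul_add]
  congr 1
  · simp only [mul_assoc]
    rw [← mul_assoc (X q)⁻¹, hX.inv_mul hq, one_mul]
  · simp only [mul_assoc]
    rw [← mul_assoc (X q)⁻¹, hX.inv_mul hq, one_mul]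

theorem dMat_toBlocks {g : M → Mat4} (q : M) (v : TangentSpace (𝓡 2) q) :
    dMat g q v = Matrix.fromBlocks (dMat (fun p => (g p).toBlocks₁₁) q v)
      (dMat (fun p => (g p).toBlocks₁₂) q v) (dMat (fun p => (g p).toBlocks₂₁) q v)
      (dMat (fun p => (g p).toBlocks₂₂) q v) := by
  rw [← dMat_fromBlocks]
  simp only [Matrix.fromBlocks_toBlocks]

/-- As g is block upper triangular, β does not enter here. The term with `toBlocks₁₂` lets a shear
modify α by multiples of γ without touching γ. -/
theorem IsGauge.theta_blocks {W : Set M} {X g : M → Mat4} (hX : IsFrameField W X)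
    (hg : IsGauge W g) {q : M} (hq : q ∈ W) (v : TangentSpace (𝓡 2) q) :
    gammaForm (fun p => X p * g p) q v
      = (g q).toBlocks₁₁ᵀ * gammaForm X q v * (g q).toBlocks₁₁ ∧
    alphaForm (fun p => X p * g p) q v
      = (g q).toBlocks₂₂ᵀ * alphaForm X q v * (g q).toBlocks₁₁
        - (g q).toBlocks₁₂ᵀ * gammaForm X q v * (g q).toBlocks₁₁
        + (g q).toBlocks₂₂ᵀ * dMat (fun p => (g p).toBlocks₁₁) q v := by
  have h := hX.thetaForm_gauge hg.toIsFrameField hq v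
  have h0 : dMat (fun p => (g p).toBlocks₂₁) q v = 0 := by
    rw [dMat_congr hg.isOpen hq hg.lower, dMat_const]
  have hl := hg.lower q hq
  rw [(blocks_of_lower (hg.symplectic q hq) hl).2, dMat_toBlocks, h0] at h
  have e1 : thetaForm X q v = Matrix.fromBlocks (alphaForm X q v) (thetaForm X q v).toBlocks₁₂
    (gammaForm X q v) (thetaForm X q v).toBlocks₂₂ := (Matrix.fromBlocks_toBlocks _).symm
  have e2 : g q = Matrix.fromBlocks (g q).toBlocks₁₁ (g q).toBlocks₁₂ 0 (g q).toBlocks₂₂ := by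
    conv_lhs => rw [← Matrix.fromBlocks_toBlocks (g q), hl]
  set A := (g q).toBlocks₁₁
  set C := (g q).toBlocks₁₂
  set D := (g q).toBlocks₂₂
  rw [e2, e1, Matrix.fromBlocks_multiply, Matrix.fromBlocks_multiply, Matrix.fromBlocks_multiply,
    Matrix.fromBlocks_add] at h
  constructor
  · rw [gammaForm, h]
    simp
  · rw [alphaForm, h]
    simp [add_mul, sub_eq_add_neg]

/-- How the difference of two Maurer-Cartan forms changes. -/
theorem IsGauge.theta_sub {W : Set M} {X X' g : M → Mat4} (hX : IsFrameField W X)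
    (hX' : IsFrameField W X') (hg : IsGauge W g) {q : M} (hq : q ∈ W)
    (v : TangentSpace (𝓡 2) q) {N : Matrix (Fin 2) (Fin 2) ℝ}
    (h : thetaForm X' q v - thetaForm X q v = Matrix.fromBlocks 0 N 0 0) :
    thetaForm (fun p => X' p * g p) q v - thetaForm (fun p => X p * g p) q v
      = Matrix.fromBlocks 0 ((g q).toBlocks₂₂ᵀ * N * (g q).toBlocks₂₂) 0 0 := by
  -- The inhomogeneous term g⁻¹dg is common to both frames and cancels.
  rw [hX.thetaForm_gauge hg.toIsFrameField hq, hX'.thetaForm_gauge hg.toIsFrameField hq,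
    add_sub_add_right_eq_sub, ← sub_mul, ← mul_sub, h]
  have hl := hg.lower q hq
  have e2 : g q = Matrix.fromBlocks (g q).toBlocks₁₁ (g q).toBlocks₁₂ 0 (g q).toBlocks₂₂ := by
    conv_lhs => rw [← Matrix.fromBlocks_toBlocks (g q), hl]
  rw [(blocks_of_lower (hg.symplectic q hq) hl).2]
  conv_lhs => rw [e2]
  rw [Matrix.fromBlocks_multiply, Matrix.fromBlocks_multiply]
  simp

end Gauge

/-! ### First and second order frame fields -/

section FirstOrder

variable {M : Type*} [TopologicalSpace M] [ChartedSpace Plane M]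

/-- `τ¹ + i τ²`. -/
def tauBar (f : M → R4) (X : M → Mat4) (q : M) (v : TangentSpace (𝓡 2) q) : ℂ :=
  cx fun i => tauForm f X q v (Sum.inl i)

theorem tauComplex_eq (f : M → R4) (X : M → Mat4) (q : M) (v : TangentSpace (𝓡 2) q) :
    tauComplex f X q v = conj (tauBar f X q v) := by
  apply Complex.ext <;> simp [tauComplex, tauBar, cx]

theorem mulVec_lower_eq_zero_iff {X : Mat4} (hX : IsUnit X.det) (x : R4) :
    x ∈ Submodule.span ℝ {X.col (Sum.inl 0), X.col (Sum.inl 1)}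
      ↔ ∀ i, (X⁻¹ *ᵥ x) (Sum.inr i) = 0 := by
  have hcol : ∀ j, X⁻¹ *ᵥ X.col j = Pi.single j 1 := by
    intro j
    rw [← Matrix.mulVec_single_one, Matrix.mulVec_mulVec, Matrix.nonsing_inv_mul _ hX,
      Matrix.one_mulVec]
  constructor
  · intro h i
    obtain ⟨a, b, rfl⟩ := Submodule.mem_span_pair.1 h
    rw [Matrix.mulVec_add, Matrix.mulVec_smul, Matrix.mulVec_smul, hcol, hcol]
    simp
  · intro h
    have e : x = X *ᵥ (X⁻¹ *ᵥ x) := by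
      rw [Matrix.mulVec_mulVec, Matrix.mul_nonsing_inv _ hX, Matrix.one_mulVec]
    generalize X⁻¹ *ᵥ x = y at h e
    subst e
    refine Submodule.mem_span_pair.2 ⟨y (Sum.inl 0), y (Sum.inl 1), ?_⟩
    ext i
    simp [Matrix.mulVec, dotProduct, Fintype.sum_sum_type, h, mul_comm]

namespace IsFirstOrder

variable {A : VolumeElement M} {f : M → R4} {U V : Set M} {X Y : M → Mat4}

theorem mono (h : IsFirstOrder A f U X) (hV : IsOpen V) (hVU : V ⊆ U) : IsFirstOrder A f V X :=
  ⟨h.toIsFrameField.mono hV hVU, fun q hq => h.span_eq q (hVU hq),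
    fun q hq => h.orientation q (hVU hq)⟩

theorem mulVec_tauForm (h : IsFirstOrder A f U X) {q : M} (hq : q ∈ U)
    (v : TangentSpace (𝓡 2) q) : X q *ᵥ tauForm f X q v = mvfderiv (𝓡 2) f q v := by
  rw [tauForm, Matrix.mulVec_mulVec, h.toIsFrameField.mul_inv hq, Matrix.one_mulVec]

theorem tauForm_inr (h : IsFirstOrder A f U X) {q : M} (hq : q ∈ U)
    (v : TangentSpace (𝓡 2) q) (i : Fin 2) : tauForm f X q v (Sum.inr i) = 0 := by
  have hm : mvfderiv (𝓡 2) f q v ∈ gaussPlane f q := ⟨v, rfl⟩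
  rw [← h.span_eq q hq,
    mulVec_lower_eq_zero_iff (symplectic_isUnit_det (h.symplectic q hq))] at hm
  exact hm i

theorem eq_zero_of_tauBar (h : IsFirstOrder A f U X) (hf : IsLagrangianImmersion f) {q : M}
    (hq : q ∈ U) {v : TangentSpace (𝓡 2) q} (hv : tauBar f X q v = 0) : v = 0 := by
  have h1 := cx_eq_zero hv
  have h2 : tauForm f X q v = 0 := by
    ext (i | i)
    · exact congrFun h1 i
    · exact h.tauForm_inr hq v i
  have h3 := h.mulVec_tauForm hq v
  rw [h2, Matrix.mulVec_zero] at h3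
  exact hf.immersion q (by rw [← h3, map_zero])

/-- The change of frame between two first order frame fields. -/
theorem isGauge (h : IsFirstOrder A f U X) (h' : IsFirstOrder A f V Y) :
    IsGauge (U ∩ V) (fun q => (X q)⁻¹ * Y q) where
  isOpen := h.isOpen.inter h'.isOpen
  smooth := (h.toIsFrameField.smoothMat_inv.mono Set.inter_subset_left).mul
    (h'.toIsFrameField.smoothMat.mono Set.inter_subset_right)
  symplectic q hq := (Matrix.symplecticGroup (Fin 2) ℝ).mul_mem
    (symplectic_inv_mem (h.symplectic q hq.1)) (h'.symplectic q hq.2)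
  lower q hq := by
    ext i j
    have hm : (Y q).col (Sum.inl j) ∈ gaussPlane f q := by
      rw [← h'.span_eq q hq.2]
      apply Submodule.subset_span
      fin_cases j <;> simp
    rw [← h.span_eq q hq.1,
      mulVec_lower_eq_zero_iff (symplectic_isUnit_det (h.symplectic q hq.1))] at hm
    exact hm i

theorem mul_gauge (h : IsFirstOrder A f U X) {q : M} (hq : q ∈ U) :
    X q * ((X q)⁻¹ * Y q) = Y q := by
  rw [← mul_assoc, h.toIsFrameField.mul_inv hq, one_mul]

end IsFirstOrder

theorem tauForm_gauge (f : M → R4) {W : Set M} {X g : M → Mat4} (hg : IsGauge W g) {q : M}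
    (hq : q ∈ W) (v : TangentSpace (𝓡 2) q) (h0 : ∀ i, tauForm f X q v (Sum.inr i) = 0) :
    (fun i => tauForm f (fun p => X p * g p) q v (Sum.inl i))
      = (g q).toBlocks₂₂ᵀ *ᵥ fun i => tauForm f X q v (Sum.inl i) := by
  have e : tauForm f (fun p => X p * g p) q v = (g q)⁻¹ *ᵥ tauForm f X q v := by
    rw [tauForm, tauForm, Matrix.mul_inv_rev, Matrix.mulVec_mulVec]
  rw [e, (blocks_of_lower (hg.symplectic q hq) (hg.lower q hq)).2]
  ext i
  simp [Matrix.mulVec, dotProduct, Fintype.sum_sum_type, h0]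

theorem tau_wedge_mulVec (N : Matrix (Fin 2) (Fin 2) ℝ) (x y : Fin 2 → ℝ) :
    (N *ᵥ x) 0 * (N *ᵥ y) 1 - (N *ᵥ y) 0 * (N *ᵥ x) 1 = N.det * (x 0 * y 1 - y 0 * x 1) := by
  simp [Matrix.mulVec, dotProduct, Fin.sum_univ_two, Matrix.det_fin_two]
  ring

theorem VolumeElement.exists_pos (A : VolumeElement M) (q : M) :
    ∃ v w : TangentSpace (𝓡 2) q, 0 < A.form q ![v, w] := by
  by_contra! h
  refine A.ne_zero q ?_
  ext u
  have hu : u = ![u 0, u 1] := by ext i : 1; fin_cases i <;> rfl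
  have h1 := h (u 0) (u 1)
  have h2 := h (u 1) (u 0)
  have h3 : A.form q ![u 1, u 0] = -A.form q ![u 0, u 1] := by
    have := (A.form q).map_swap ![u 0, u 1] (i := 0) (j := 1) (by decide)
    rw [← this]
    congr 1
    ext i : 1; fin_cases i <;> rfl
  rw [h3] at h2
  rw [hu]
  simp only [AlternatingMap.zero_apply]
  linarith

namespace IsFirstOrder

variable {A : VolumeElement M} {f : M → R4} {U V : Set M} {X Y : M → Mat4}

/-- Both frames make τ¹ ∧ τ² negative on positive bases, and the change of frame multiplies it by
the determinant of the lower right block, the inverse of the one in question. -/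
theorem det_pos (h : IsFirstOrder A f U X) (h' : IsFirstOrder A f V Y) {q : M}
    (hq : q ∈ U ∩ V) : 0 < ((X q)⁻¹ * Y q).toBlocks₁₁.det := by
  obtain ⟨v, w, hvw⟩ := A.exists_pos q
  have hg := h.isGauge h'
  have o1 := h.orientation q hq.1 v w hvw
  have o2 := h'.orientation q hq.2 v w hvw
  have e : ∀ v : TangentSpace (𝓡 2) q, (fun i => tauForm f Y q v (Sum.inl i))
      = ((X q)⁻¹ * Y q).toBlocks₂₂ᵀ *ᵥ fun i => tauForm f X q v (Sum.inl i) := by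
    intro v
    rw [← tauForm_gauge f hg hq v (h.tauForm_inr hq.1 v)]
    funext i
    simp only [tauForm, h.mul_gauge hq.1]
  have k := tau_wedge_mulVec ((X q)⁻¹ * Y q).toBlocks₂₂ᵀ
    (fun i => tauForm f X q v (Sum.inl i)) (fun i => tauForm f X q w (Sum.inl i))
  rw [← e, ← e, Matrix.det_transpose] at k
  have hd := det_mul_det_of_lower (hg.symplectic q hq) (hg.lower q hq)
  rw [k] at o2
  have : 0 < ((X q)⁻¹ * Y q).toBlocks₂₂.det := by
    by_contra hn
    nlinarith [mul_nonneg_of_nonpos_of_nonpos (not_lt.1 hn) o1.le]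
  nlinarith

theorem gauge (h : IsFirstOrder A f U X) {g : M → Mat4} (hg : IsGauge V g) (hVU : V ⊆ U)
    (hd : ∀ q ∈ V, 0 < (g q).toBlocks₁₁.det) : IsFirstOrder A f V (fun q => X q * g q) where
  toIsFrameField := (h.toIsFrameField.mono hg.isOpen hVU).gauge hg.toIsFrameField
  span_eq q hq := by
    rw [← h.span_eq q (hVU hq)]
    have hX := symplectic_isUnit_det (h.symplectic q (hVU hq))
    have hY : IsUnit (X q * g q).det := by
      rw [Matrix.det_mul]
      exact hX.mul (symplectic_isUnit_det (hg.symplectic q hq))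
    ext x
    rw [mulVec_lower_eq_zero_iff hX, mulVec_lower_eq_zero_iff hY, Matrix.mul_inv_rev,
      ← Matrix.mulVec_mulVec, (blocks_of_lower (hg.symplectic q hq) (hg.lower q hq)).2]
    set y := (X q)⁻¹ *ᵥ x
    set N := (g q).toBlocks₁₁ with hN
    have e : ∀ i, (Matrix.fromBlocks (g q).toBlocks₂₂ᵀ (-(g q).toBlocks₁₂ᵀ) 0 Nᵀ *ᵥ y)
        (Sum.inr i) = (Nᵀ *ᵥ fun j => y (Sum.inr j)) i := by
      intro i
      simp [Matrix.mulVec, dotProduct, Fintype.sum_sum_type]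
    simp only [e]
    constructor
    · intro hy
      have := Matrix.eq_zero_of_mulVec_eq_zero (M := Nᵀ) (by
        rw [Matrix.det_transpose]; exact (hd q hq).ne') (funext hy)
      exact fun i => congrFun this i
    · intro hy i
      rw [show (fun j => y (Sum.inr j)) = 0 from funext hy, Matrix.mulVec_zero]
      rfl
  orientation q hq v w hvw := by
    have e := fun v => tauForm_gauge f hg hq v (h.tauForm_inr (hVU hq) v)
    have k := tau_wedge_mulVec (g q).toBlocks₂₂ᵀ
      (fun i => tauForm f X q v (Sum.inl i)) (fun i => tauForm f X q w (Sum.inl i))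
    rw [← e, ← e, Matrix.det_transpose] at k
    rw [k]
    have hd' := det_mul_det_of_lower (hg.symplectic q hq) (hg.lower q hq)
    have : 0 < (g q).toBlocks₂₂.det := by
      by_contra hn
      nlinarith [hd q hq, mul_nonneg (hd q hq).le (neg_nonneg.2 (not_lt.1 hn))]
    exact mul_neg_of_pos_of_neg this (h.orientation q (hVU hq) v w hvw)

theorem conformalForm_eq (h : IsFirstOrder A f U X) {q : M} (hq : q ∈ U)
    (v : TangentSpace (𝓡 2) q) : conformalForm X q v = -(gammaForm X q v).det := by
  have hs := (h.toIsFrameField.gammaForm_symm hq v).1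
  have e : gammaForm X q v 0 1 = gammaForm X q v 1 0 := congrFun (congrFun hs 1) 0
  rw [conformalForm, Matrix.det_fin_two, e]
  ring

theorem gammaForm_eq (h : IsFirstOrder A f U X) (h' : IsFirstOrder A f V Y) {q : M}
    (hq : q ∈ U ∩ V) (v : TangentSpace (𝓡 2) q) :
    gammaForm Y q v = ((X q)⁻¹ * Y q).toBlocks₁₁ᵀ * gammaForm X q v
      * ((X q)⁻¹ * Y q).toBlocks₁₁ := by
  have hg := h.isGauge h'
  have hX := h.toIsFrameField.mono hg.isOpen Set.inter_subset_left
  rw [← (IsGauge.theta_blocks hX hg hq v).1]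
  have e := dMat_congr hg.isOpen hq (X := Y) (Y := fun p => X p * ((X p)⁻¹ * Y p))
    fun p hp => (h.mul_gauge hp.1).symm
  rw [gammaForm, gammaForm]
  congr 1
  change (Y q)⁻¹ * dMat Y q v = (X q * ((X q)⁻¹ * Y q))⁻¹ * dMat _ q v
  rw [e, h.mul_gauge hq.1]

/-- Between first order frames -det γ is multiplied by the square of a nonzero determinant, so
positivity passes from the frame given by `spacelike` to every other one. -/
theorem conformalForm_pos (h : IsFirstOrder A f U X) (hf : IsElliptic A f) {q : M} (hq : q ∈ U)
    {v : TangentSpace (𝓡 2) q} (hv : v ≠ 0) : 0 < conformalForm X q v := by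
  obtain ⟨V, Y, hqV, hY, hpos⟩ := hf.spacelike q
  have h1 := hpos v hv
  have h2 := hY.gammaForm_eq h ⟨hqV, hq⟩ v
  rw [hY.conformalForm_eq hqV] at h1
  rw [h.conformalForm_eq hq, h2, Matrix.det_mul, Matrix.det_mul, Matrix.det_transpose]
  have := hY.det_pos h ⟨hqV, hq⟩
  nlinarith [mul_pos (mul_pos this this) h1]

end IsFirstOrder

namespace IsSecondOrder

variable {A : VolumeElement M} {f : M → R4} {U V : Set M} {X Y : M → Mat4}

theorem mono (h : IsSecondOrder A f U X) (hV : IsOpen V) (hVU : V ⊆ U) : IsSecondOrder A f V X :=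
  ⟨h.toIsFirstOrder.mono hV hVU, fun q hq => h.trace_gamma q (hVU hq)⟩

theorem lin_gamma (h : IsSecondOrder A f U X) {q : M} (hq : q ∈ U) (v : TangentSpace (𝓡 2) q) :
    lin (gammaForm X q v) = 0 := by
  have hs := (h.toIsFrameField.gammaForm_symm hq v).1
  have e : gammaForm X q v 0 1 = gammaForm X q v 1 0 := congrFun (congrFun hs 1) 0
  have := h.trace_gamma q hq v
  apply Complex.ext <;> simp [lin, e, this]

theorem cnj_gamma (h : IsFirstOrder A f U X) {q : M} (hq : q ∈ U) (v : TangentSpace (𝓡 2) q) :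
    cnj (gammaForm X q v) = omegaForm X q v := by
  have hs := (h.toIsFrameField.gammaForm_symm hq v).1
  have e : gammaForm X q v 0 1 = gammaForm X q v 1 0 := congrFun (congrFun hs 1) 0
  apply Complex.ext <;> simp [cnj, omegaForm, e]

theorem of_lin_gamma (h : IsFirstOrder A f U X)
    (h0 : ∀ q ∈ U, ∀ v : TangentSpace (𝓡 2) q, lin (gammaForm X q v) = 0) :
    IsSecondOrder A f U X := by
  refine ⟨h, fun q hq v => ?_⟩
  have := congrArg Complex.re (h0 q hq v)
  simp only [lin, Complex.zero_re] at this
  linarith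

theorem eq_zero_of_omegaForm (h : IsSecondOrder A f U X) (hf : IsElliptic A f) {q : M}
    (hq : q ∈ U) {v : TangentSpace (𝓡 2) q} (hv : omegaForm X q v = 0) : v = 0 := by
  by_contra hne
  have h1 := h.toIsFirstOrder.conformalForm_pos hf hq hne
  rw [h.toIsFirstOrder.conformalForm_eq hq, det_eq_normSq_sub, h.lin_gamma hq,
    cnj_gamma h.toIsFirstOrder hq, hv] at h1
  simp at h1

end IsSecondOrder

theorem etaForm_eq (X : M → Mat4) (q : M) (v : TangentSpace (𝓡 2) q) :
    etaForm X q v = conj (cnj (alphaForm X q v)) := by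
  apply Complex.ext <;> simp [etaForm, cnj]

end FirstOrder

/-! ### Second order frame fields -/

section SecondOrder

variable {M : Type*} [TopologicalSpace M] [ChartedSpace Plane M]

theorem thetaForm_add_smul (X : M → Mat4) (q : M) (a b : ℝ) (v w : TangentSpace (𝓡 2) q) :
    thetaForm X q (a • v + b • w) = a • thetaForm X q v + b • thetaForm X q w := by
  rw [thetaForm, thetaForm, thetaForm, ← Matrix.mul_smul, ← Matrix.mul_smul, ← Matrix.mul_add]
  congr 1
  ext i j
  simp

theorem gammaForm_add_smul (X : M → Mat4) (q : M) (a b : ℝ) (v w : TangentSpace (𝓡 2) q) :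
    gammaForm X q (a • v + b • w) = a • gammaForm X q v + b • gammaForm X q w := by
  rw [gammaForm, thetaForm_add_smul]; rfl

theorem alphaForm_add_smul (X : M → Mat4) (q : M) (a b : ℝ) (v w : TangentSpace (𝓡 2) q) :
    alphaForm X q (a • v + b • w) = a • alphaForm X q v + b • alphaForm X q w := by
  rw [alphaForm, thetaForm_add_smul]; rfl

theorem tauForm_add_smul (f : M → R4) (X : M → Mat4) (q : M) (a b : ℝ)
    (v w : TangentSpace (𝓡 2) q) :
    tauForm f X q (a • v + b • w) = a • tauForm f X q v + b • tauForm f X q w := by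
  rw [tauForm, map_add, map_smul, map_smul, Matrix.mulVec_add, Matrix.mulVec_smul,
    Matrix.mulVec_smul]
  rfl

theorem lin_smul (a : ℝ) (N : Matrix (Fin 2) (Fin 2) ℝ) : lin (a • N) = a * lin N := by
  apply Complex.ext <;> simp [lin] <;> ring

theorem cnj_smul (a : ℝ) (N : Matrix (Fin 2) (Fin 2) ℝ) : cnj (a • N) = a * cnj N := by
  apply Complex.ext <;> simp [cnj] <;> ring

theorem omegaForm_add_smul (X : M → Mat4) (q : M) (a b : ℝ) (v w : TangentSpace (𝓡 2) q) :
    omegaForm X q (a • v + b • w) = a * omegaForm X q v + b * omegaForm X q w := by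
  simp only [omegaForm, gammaForm_add_smul]
  apply Complex.ext <;> simp <;> ring

theorem tauBar_add_smul (f : M → R4) (X : M → Mat4) (q : M) (a b : ℝ)
    (v w : TangentSpace (𝓡 2) q) :
    tauBar f X q (a • v + b • w) = a * tauBar f X q v + b * tauBar f X q w := by
  simp only [tauBar, tauForm_add_smul]
  apply Complex.ext <;> simp [cx]

theorem surjective_of_injective_complex {q : M} (φ : TangentSpace (𝓡 2) q → ℂ)
    (hl : ∀ (a b : ℝ) v w, φ (a • v + b • w) = a * φ v + b * φ w)
    (h0 : ∀ v, φ v = 0 → v = 0) : Function.Surjective φ := by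
  let L : TangentSpace (𝓡 2) q →ₗ[ℝ] ℂ :=
    { toFun := fun v => φ v
      map_add' := fun v w => by
        have := hl 1 1 v w
        simpa only [one_smul, Complex.ofReal_one, one_mul] using this
      map_smul' := fun a v => by
        have := hl a 0 v v
        rw [RingHom.id_apply, Complex.real_smul]
        simpa only [zero_smul, add_zero, Complex.ofReal_zero, zero_mul] using this }
  have hi : Function.Injective L := by
    rw [← LinearMap.ker_eq_bot, LinearMap.ker_eq_bot']
    exact fun v hv => h0 v hv
  have : Module.finrank ℝ (TangentSpace (𝓡 2) q) = Module.finrank ℝ ℂ := by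
    rw [Complex.finrank_real_complex]
    exact finrank_euclideanSpace_fin
  have : FiniteDimensional ℝ (TangentSpace (𝓡 2) q) :=
    inferInstanceAs (FiniteDimensional ℝ Plane)
  exact (LinearMap.injective_iff_surjective_of_finrank_eq_finrank ‹_›).1 hi

namespace IsSecondOrder

variable {A : VolumeElement M} {f : M → R4} {U V : Set M} {X Y : M → Mat4}

theorem omegaForm_surjective (h : IsSecondOrder A f U X) (hf : IsElliptic A f) {q : M}
    (hq : q ∈ U) : Function.Surjective (omegaForm X q) :=
  surjective_of_injective_complex _ (omegaForm_add_smul X q)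
    fun _ hv => h.eq_zero_of_omegaForm hf hq hv

/-- For N the leading block, `lin (ᵗN γ N)` is 2 Re(conj(lin N · cnj N) ω). It vanishes for all
values of ω, hence lin N · cnj N = 0, and det N > 0 decides which factor is zero. -/
theorem gauge_parts (h : IsSecondOrder A f U X) (h' : IsSecondOrder A f V Y)
    (hf : IsElliptic A f) {q : M} (hq : q ∈ U ∩ V) :
    cnj ((X q)⁻¹ * Y q).toBlocks₁₁ = 0 ∧ lin ((X q)⁻¹ * Y q).toBlocks₁₁ ≠ 0 := by
  have hd := h.det_pos h'.toIsFirstOrder hq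
  set N := ((X q)⁻¹ * Y q).toBlocks₁₁ with hN
  rw [det_eq_normSq_sub] at hd
  have ha : lin N ≠ 0 := by
    intro h0
    rw [h0] at hd
    simp only [map_zero, zero_sub] at hd
    linarith [Complex.normSq_nonneg (cnj N)]
  refine ⟨?_, ha⟩
  -- For this value of ω the trace condition becomes 2|lin N|²|cnj N|² = 0.
  obtain ⟨v, hv⟩ := h.omegaForm_surjective hf hq.1 (lin N * cnj N)
  have h1 := h'.lin_gamma hq.2 v
  rw [h.gammaForm_eq h'.toIsFirstOrder hq v, ← hN, lin_mul, lin_mul, cnj_mul, h.lin_gamma hq.1,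
    cnj_gamma h.toIsFirstOrder hq.1, hv, lin_transpose, cnj_transpose] at h1
  have h2 : ((Complex.normSq (lin N) * Complex.normSq (cnj N) : ℝ) : ℂ) * 2 = 0 := by
    rw [← h1]
    push_cast
    rw [Complex.normSq_eq_conj_mul_self, Complex.normSq_eq_conj_mul_self]
    simp
    ring
  have h3 : Complex.normSq (lin N) * Complex.normSq (cnj N) = 0 := by
    have := congrArg Complex.re h2
    simp at this
    simpa using this
  rcases mul_eq_zero.1 h3 with h4 | h4
  · exact absurd (Complex.normSq_eq_zero.1 h4) ha
  · exact Complex.normSq_eq_zero.1 h4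

end IsSecondOrder

theorem IsGauge.conformal_lower {W : Set M} {g : M → Mat4} (hg : IsGauge W g) {q : M}
    (hq : q ∈ W) (h0 : cnj (g q).toBlocks₁₁ = 0) (h1 : lin (g q).toBlocks₁₁ ≠ 0) :
    lin (g q).toBlocks₂₂ = (conj (lin (g q).toBlocks₁₁))⁻¹ ∧ cnj (g q).toBlocks₂₂ = 0 := by
  have h := (blocks_of_lower (hg.symplectic q hq) (hg.lower q hq)).1
  have e1 := congrArg lin h
  have e2 := congrArg cnj h
  rw [lin_mul, lin_transpose, cnj_transpose, h0, zero_mul, add_zero, lin_one] at e1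
  rw [cnj_mul, lin_transpose, cnj_transpose, h0, zero_mul, add_zero, cnj_one] at e2
  have hc : conj (lin (g q).toBlocks₁₁) ≠ 0 := by simpa using h1
  exact ⟨eq_inv_of_mul_eq_one_right e1, (mul_eq_zero.1 e2).resolve_left hc⟩

/-- Effect of a gauge with conformal leading part on `ω` and `τ`. -/
theorem IsGauge.omega_tau {A : VolumeElement M} {f : M → R4} {W : Set M} {X g : M → Mat4}
    (hX : IsSecondOrder A f W X) (hg : IsGauge W g) {q : M} (hq : q ∈ W)
    (h0 : cnj (g q).toBlocks₁₁ = 0) (h1 : lin (g q).toBlocks₁₁ ≠ 0)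
    (v : TangentSpace (𝓡 2) q) :
    lin (gammaForm (fun p => X p * g p) q v) = 0 ∧
    cnj (gammaForm (fun p => X p * g p) q v)
      = conj (lin (g q).toBlocks₁₁) ^ 2 * cnj (gammaForm X q v) ∧
    tauBar f (fun p => X p * g p) q v = (lin (g q).toBlocks₁₁)⁻¹ * tauBar f X q v := by
  obtain ⟨d1, d2⟩ := hg.conformal_lower hq h0 h1
  have e := (IsGauge.theta_blocks hX.toIsFrameField hg hq v).1
  refine ⟨?_, ?_, ?_⟩
  · rw [e, lin_mul, lin_mul, cnj_mul, hX.lin_gamma hq, lin_transpose, cnj_transpose, h0]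
    simp
  · rw [e, cnj_mul, lin_mul, cnj_mul, hX.lin_gamma hq, lin_transpose, cnj_transpose, h0]
    simp
    ring
  · rw [tauBar, tauForm_gauge f hg hq v (hX.tauForm_inr hq v), cx_mulVec, lin_transpose,
      cnj_transpose, d1, d2]
    simp [tauBar]

namespace IsSecondOrder

variable {A : VolumeElement M} {f : M → R4} {U V : Set M} {X Y : M → Mat4}

theorem gauge (h : IsSecondOrder A f U X) {g : M → Mat4} (hg : IsGauge V g) (hVU : V ⊆ U)
    (hd : ∀ q ∈ V, cnj (g q).toBlocks₁₁ = 0 ∧ lin (g q).toBlocks₁₁ ≠ 0) :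
    IsSecondOrder A f V (fun q => X q * g q) := by
  refine of_lin_gamma (h.toIsFirstOrder.gauge hg hVU fun q hq => ?_) fun q hq v =>
    (hg.omega_tau (h.mono hg.isOpen hVU) hq (hd q hq).1 (hd q hq).2 v).1
  rw [det_eq_normSq_sub, (hd q hq).1]
  simpa [Complex.normSq_pos] using (hd q hq).2

theorem fubini_eq (h : IsSecondOrder A f U X) (h' : IsSecondOrder A f V Y)
    (hf : IsElliptic A f) {q : M} (hq : q ∈ U ∩ V) (v : TangentSpace (𝓡 2) q) :
    tauComplex f Y q v ^ 2 * omegaForm Y q v = tauComplex f X q v ^ 2 * omegaForm X q v := by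
  obtain ⟨h0, h1⟩ := h.gauge_parts h' hf hq
  have hg := h.isGauge h'.toIsFirstOrder
  obtain ⟨-, e2, e3⟩ := hg.omega_tau (h.mono hg.isOpen Set.inter_subset_left) hq h0 h1 v
  have hY : ∀ p ∈ U ∩ V, Y p = X p * ((X p)⁻¹ * Y p) := fun p hp => (h.mul_gauge hp.1).symm
  have e4 : gammaForm (fun p => X p * ((X p)⁻¹ * Y p)) q v = gammaForm Y q v := by
    rw [gammaForm, gammaForm]
    congr 1
    change (X q * ((X q)⁻¹ * Y q))⁻¹ * dMat _ q v = (Y q)⁻¹ * dMat Y q v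
    rw [← dMat_congr hg.isOpen hq hY, ← hY q hq]
  have e5 : tauBar f (fun p => X p * ((X p)⁻¹ * Y p)) q v = tauBar f Y q v := by
    simp only [tauBar, tauForm, ← hY q hq]
  rw [e4, cnj_gamma h'.toIsFirstOrder hq.2, cnj_gamma h.toIsFirstOrder hq.1] at e2
  rw [e5] at e3
  rw [tauComplex_eq, tauComplex_eq, e2, e3]
  have hc : conj (lin ((X q)⁻¹ * Y q).toBlocks₁₁) ≠ 0 := by simpa using h1
  rw [map_mul, map_inv₀]
  field_simp

/-- Independence of the frame allows the frame chosen by `Classical.epsilon` to be replaced by X. -/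
theorem fubiniCubicForm_eq (h : IsSecondOrder A f U X) (hf : IsElliptic A f) {q : M}
    (hq : q ∈ U) :
    fubiniCubicForm A f q = fun v => tauComplex f X q v ^ 2 * omegaForm X q v := by
  have hex : ∃ F, IsFubiniAt A f q F := ⟨_, U, X, hq, h, rfl⟩
  obtain ⟨V, Y, hqV, hY, e⟩ := Classical.epsilon_spec hex
  rw [fubiniCubicForm, e]
  funext v
  exact h.fubini_eq hY hf ⟨hq, hqV⟩ v

end IsSecondOrder

variable [IsManifold (𝓡 2) ∞ M]

/-- A gauge with leading block A makes γ trace-free when tr(ᵗAγA) = tr(γ AᵗA) = 0, that is, when AᵗA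
is trace-orthogonal to the plane of symmetric matrices swept out by γ. This plane is positive for
-det, so its orthogonal line is spanned by a definite matrix [[P, Q], [Q, R]], and A is a lower
triangular Cholesky factor of a multiple of it. -/
theorem exists_secondOrder {A : VolumeElement M} {f : M → R4} (hf : IsElliptic A f) (q₀ : M) :
    ∃ (U : Set M) (X : M → Mat4), q₀ ∈ U ∧ IsSecondOrder A f U X := by
  obtain ⟨V, X, hqV, hX', -⟩ := hf.spacelike q₀
  set U := V ∩ (chartAt Plane q₀).source with hU
  have hUo : IsOpen U := hX'.isOpen.inter (chartAt Plane q₀).open_source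
  have hS : U ⊆ (chartAt Plane q₀).source := Set.inter_subset_right
  have hX : IsFirstOrder A f U X := hX'.mono hUo Set.inter_subset_left
  set γ : Fin 2 → M → Matrix (Fin 2) (Fin 2) ℝ := fun k q => gammaForm X q (coordField q₀ k q)
  have hγs : ∀ k i j, SmoothOn U (fun q => γ k q i j) := fun k i j =>
    hX.smoothMat_theta hS k (Sum.inr i) (Sum.inl j)
  have hsymm : ∀ q ∈ U, ∀ k, γ k q 0 1 = γ k q 1 0 := fun q hq k =>
    congrFun (congrFun (hX.toIsFrameField.gammaForm_symm hq (coordField q₀ k q)).1 1) 0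
  -- the vector orthogonal to the image of `γ`
  set P : M → ℝ := fun q => 2 * (γ 0 q 1 0 * γ 1 q 1 1 - γ 0 q 1 1 * γ 1 q 1 0) with hP
  set Q : M → ℝ := fun q => γ 0 q 1 1 * γ 1 q 0 0 - γ 0 q 0 0 * γ 1 q 1 1 with hQ
  set R : M → ℝ := fun q => 2 * (γ 0 q 0 0 * γ 1 q 1 0 - γ 0 q 1 0 * γ 1 q 0 0) with hR
  have hdisc : ∀ q ∈ U, 0 < P q * R q - Q q ^ 2 := by
    intro q hq
    have hpos : ∀ a b : ℝ, ¬(a = 0 ∧ b = 0) →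
        0 < conformalForm X q (a • coordField q₀ 0 q + b • coordField q₀ 1 q) := by
      intro a b hab
      exact hX.conformalForm_pos hf hq fun h0 => hab (coordField_independent q₀ (hS hq) h0)
    have hform : ∀ a b : ℝ, conformalForm X q (a • coordField q₀ 0 q + b • coordField q₀ 1 q)
        = -((a * γ 0 q 0 0 + b * γ 1 q 0 0) * (a * γ 0 q 1 1 + b * γ 1 q 1 1))
          + (a * γ 0 q 1 0 + b * γ 1 q 1 0) ^ 2 := by
      intro a b
      rw [conformalForm, gammaForm_add_smul]
      rfl
    have h1 := hpos 1 0 (by simp)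
    rw [hform] at h1
    set E := γ 0 q 1 0 ^ 2 - γ 0 q 0 0 * γ 0 q 1 1 with hE
    have hE0 : 0 < E := by rw [hE]; linarith
    -- Let E, F, G be the Gram coefficients of the conformal form on ∂₀, ∂₁. Its value at -F∂₀ + E∂₁
    -- is E(EG - F²), and PR - Q² = 4(EG - F²).
    have h2 := hpos (-(γ 0 q 1 0 * γ 1 q 1 0 -
      (γ 0 q 0 0 * γ 1 q 1 1 + γ 1 q 0 0 * γ 0 q 1 1) / 2)) E (fun h => hE0.ne' h.2)
    rw [hform] at h2
    have h3 : 0 < E * (P q * R q - Q q ^ 2) := by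
      have : E * (P q * R q - Q q ^ 2) = 4 * (-((-(γ 0 q 1 0 * γ 1 q 1 0 -
      (γ 0 q 0 0 * γ 1 q 1 1 + γ 1 q 0 0 * γ 0 q 1 1) / 2) * γ 0 q 0 0 + E * γ 1 q 0 0) *
        (-(γ 0 q 1 0 * γ 1 q 1 0 -
      (γ 0 q 0 0 * γ 1 q 1 1 + γ 1 q 0 0 * γ 0 q 1 1) / 2) * γ 0 q 1 1 + E * γ 1 q 1 1))
          + (-(γ 0 q 1 0 * γ 1 q 1 0 -
      (γ 0 q 0 0 * γ 1 q 1 1 + γ 1 q 0 0 * γ 0 q 1 1) / 2) * γ 0 q 1 0 + E * γ 1 q 1 0) ^ 2) := by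
        rw [hE]
        simp only [hP, hQ, hR]
        ring
      rw [this]
      linarith
    exact (mul_pos_iff_of_pos_left hE0).1 h3
  have hP0 : ∀ q ∈ U, P q ≠ 0 := by
    intro q hq h0
    have := hdisc q hq
    rw [h0] at this
    nlinarith [sq_nonneg (Q q)]
  have hPs : SmoothOn U P := (SmoothOn.const 2).mul
    (((hγs 0 1 0).mul (hγs 1 1 1)).sub ((hγs 0 1 1).mul (hγs 1 1 0)))
  have hQs : SmoothOn U Q :=
    ((hγs 0 1 1).mul (hγs 1 0 0)).sub ((hγs 0 0 0).mul (hγs 1 1 1))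
  have hRs : SmoothOn U R := (SmoothOn.const 2).mul
    (((hγs 0 0 0).mul (hγs 1 1 0)).sub ((hγs 0 1 0).mul (hγs 1 0 0)))
  -- For A = [[1, 0], [x, y]] the matrix AᵗA is [[1, x], [x, x² + y²]]; proportionality to [[P, Q],
  -- [Q, R]] fixes x and y².
  set x : M → ℝ := fun q => Q q / P q with hx
  set y2 : M → ℝ := fun q => R q / P q - x q * x q with hy2
  have hxs : SmoothOn U x := hQs.div hPs hP0
  have hy2s : SmoothOn U y2 := (hRs.div hPs hP0).sub (hxs.mul hxs)
  have hy2pos : ∀ q ∈ U, 0 < y2 q := by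
    intro q hq
    have h0 := hP0 q hq
    have : y2 q = (P q * R q - Q q ^ 2) / P q ^ 2 := by
      simp only [hy2, hx]
      field_simp
    rw [this]
    exact div_pos (hdisc q hq) (by positivity)
  set y : M → ℝ := fun q => Real.sqrt (y2 q) with hy
  have hys : SmoothOn U y := SmoothOn.comp_contDiffOn (g := Real.sqrt) (T := {0}ᶜ)
    (fun t ht => (Real.contDiffAt_sqrt ht).contDiffWithinAt) hy2s fun q hq => (hy2pos q hq).ne'
  have hypos : ∀ q ∈ U, 0 < y q := fun q hq => Real.sqrt_pos.2 (hy2pos q hq)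
  have hysq : ∀ q ∈ U, y q * y q = y2 q := fun q hq => Real.mul_self_sqrt (hy2pos q hq).le
  have hmat : ∀ {a b c d : M → ℝ}, SmoothOn U a → SmoothOn U b → SmoothOn U c → SmoothOn U d →
      SmoothMat U (fun q => !![a q, b q; c q, d q]) := by
    intro a b c d ha hb hc hd i j
    fin_cases i <;> fin_cases j <;> assumption
  have hg := IsGauge.of_blocks (A := fun q => !![1, 0; x q, y q]) (C := fun _ => 0)
    (D := fun q => !![1, -x q / y q; 0, 1 / y q]) hUo
    (hmat (SmoothOn.const 1) (SmoothOn.const 0) hxs hys) (SmoothMat.const 0)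
    (hmat (SmoothOn.const 1) (hxs.neg.div hys fun q hq => (hypos q hq).ne') (SmoothOn.const 0)
      ((SmoothOn.const 1).div hys fun q hq => (hypos q hq).ne'))
    (fun q hq => by
      have := (hypos q hq).ne'
      ext i j
      fin_cases i <;> fin_cases j <;> simp [Matrix.mul_apply, Fin.sum_univ_two] <;> field_simp
      ring)
    (fun q _ => by simp)
  refine ⟨U, _, ⟨hqV, mem_chart_source Plane q₀⟩,
    hX.gauge hg subset_rfl fun q hq => ?_, fun q hq v => ?_⟩
  · simpa [Matrix.det_fin_two] using hypos q hq
  · rw [(IsGauge.theta_blocks hX.toIsFrameField hg hq v).1]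
    obtain ⟨a, rfl⟩ := exists_eq_smul_coordField q₀ (hS hq) v
    rw [gammaForm_add_smul]
    have h1 : x q * P q = Q q := by simp only [hx]; field_simp [hP0 q hq]
    have h2 : (x q * x q + y q * y q) * P q = R q := by
      rw [hysq q hq]; simp only [hy2]; field_simp [hP0 q hq]; ring
    have h3 : ∀ k, γ k q 0 0 + 2 * x q * γ k q 1 0 + (x q * x q + y q * y q) * γ k q 1 1 = 0 := by
      intro k
      refine (mul_eq_zero.1 (?_ : P q * _ = 0)).resolve_left (hP0 q hq)
      have : P q * γ k q 0 0 + 2 * Q q * γ k q 1 0 + R q * γ k q 1 1 = 0 := by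
        simp only [hP, hQ, hR]
        fin_cases k <;> simp <;> ring
      rw [← this, ← h1, ← h2]
      ring
    have h40 := h3 0
    have h41 := h3 1
    have s0 := hsymm q hq 0
    have s1 := hsymm q hq 1
    simp only [γ] at h40 h41 s0 s1
    simp [Matrix.mul_apply, Fin.sum_univ_two, s0, s1]
    linear_combination a 0 * h40 + a 1 * h41

end SecondOrder

/-! ### Structure equations in coordinates -/

section StructureEquations

variable {M : Type*} [TopologicalSpace M] [ChartedSpace Plane M]

/-- `β`, where `θ = [[α, β], [γ, -ᵗα]]`. -/
def betaForm (X : M → Mat4) (q : M) (v : TangentSpace (𝓡 2) q) : Matrix (Fin 2) (Fin 2) ℝ :=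
  (thetaForm X q v).toBlocks₁₂

/-- The components of the antilinear part of `γ`. -/
def omegaC (q₀ : M) (X : M → Mat4) (k : Fin 2) (p : M) : ℂ :=
  cnj (gammaForm X p (coordField q₀ k p))

/-- The components of the linear part of `α`. -/
def rhoC (q₀ : M) (X : M → Mat4) (k : Fin 2) (p : M) : ℂ :=
  lin (alphaForm X p (coordField q₀ k p))

/-- The components of the antilinear part of `α`. -/
def etaC (q₀ : M) (X : M → Mat4) (k : Fin 2) (p : M) : ℂ :=
  cnj (alphaForm X p (coordField q₀ k p))

/-- The components of `τ¹ + i τ²`. -/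
def tauC (q₀ : M) (f : M → R4) (X : M → Mat4) (k : Fin 2) (p : M) : ℂ :=
  tauBar f X p (coordField q₀ k p)

namespace IsFrameField

variable {U : Set M} {X : M → Mat4}

theorem thetaForm_eq (h : IsFrameField U X) {q : M} (hq : q ∈ U) (v : TangentSpace (𝓡 2) q) :
    thetaForm X q v = Matrix.fromBlocks (alphaForm X q v) (betaForm X q v) (gammaForm X q v)
      (-(alphaForm X q v)ᵀ) := by
  conv_lhs => rw [← Matrix.fromBlocks_toBlocks (thetaForm X q v)]
  rw [(h.gammaForm_symm hq v).2.2]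
  rfl

variable [IsManifold (𝓡 2) ∞ M]

theorem maurerCartan_blocks (h : IsFrameField U X) {q₀ : M}
    (hS : U ⊆ (chartAt Plane q₀).source) {q : M} (hq : q ∈ U) :
    (dMat (fun p => gammaForm X p (coordField q₀ 1 p)) q (coordField q₀ 0 q)
        - dMat (fun p => gammaForm X p (coordField q₀ 0 p)) q (coordField q₀ 1 q)
      = gammaForm X q (coordField q₀ 1 q) * alphaForm X q (coordField q₀ 0 q)
        - (alphaForm X q (coordField q₀ 1 q))ᵀ * gammaForm X q (coordField q₀ 0 q)
        - (gammaForm X q (coordField q₀ 0 q) * alphaForm X q (coordField q₀ 1 q)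
        - (alphaForm X q (coordField q₀ 0 q))ᵀ * gammaForm X q (coordField q₀ 1 q))) ∧
    (dMat (fun p => alphaForm X p (coordField q₀ 1 p)) q (coordField q₀ 0 q)
        - dMat (fun p => alphaForm X p (coordField q₀ 0 p)) q (coordField q₀ 1 q)
      = alphaForm X q (coordField q₀ 1 q) * alphaForm X q (coordField q₀ 0 q)
        + betaForm X q (coordField q₀ 1 q) * gammaForm X q (coordField q₀ 0 q)
        - (alphaForm X q (coordField q₀ 0 q) * alphaForm X q (coordField q₀ 1 q)
        + betaForm X q (coordField q₀ 0 q) * gammaForm X q (coordField q₀ 1 q))) ∧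
    (dMat (fun p => betaForm X p (coordField q₀ 1 p)) q (coordField q₀ 0 q)
        - dMat (fun p => betaForm X p (coordField q₀ 0 p)) q (coordField q₀ 1 q)
      = alphaForm X q (coordField q₀ 1 q) * betaForm X q (coordField q₀ 0 q)
        - betaForm X q (coordField q₀ 1 q) * (alphaForm X q (coordField q₀ 0 q))ᵀ
        - (alphaForm X q (coordField q₀ 0 q) * betaForm X q (coordField q₀ 1 q)
        - betaForm X q (coordField q₀ 0 q) * (alphaForm X q (coordField q₀ 1 q))ᵀ)) := by
  have hmc := h.maurerCartan hS hq
  rw [h.thetaForm_eq hq, h.thetaForm_eq hq, Matrix.fromBlocks_multiply,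
    Matrix.fromBlocks_multiply] at hmc
  refine ⟨(congrArg Matrix.toBlocks₂₁ hmc).trans ?_, (congrArg Matrix.toBlocks₁₁ hmc).trans ?_,
    (congrArg Matrix.toBlocks₁₂ hmc).trans ?_⟩
  · ext i j; simp [Matrix.toBlocks₂₁]; ring
  · ext i j; simp [Matrix.toBlocks₁₁]
  · ext i j; simp [Matrix.toBlocks₁₂]; ring

theorem smoothMat_alpha (h : IsFrameField U X) {q₀ : M} (hS : U ⊆ (chartAt Plane q₀).source)
    (k : Fin 2) : SmoothMat U (fun q => alphaForm X q (coordField q₀ k q)) :=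
  fun i j => h.smoothMat_theta hS k (Sum.inl i) (Sum.inl j)

theorem smoothMat_beta (h : IsFrameField U X) {q₀ : M} (hS : U ⊆ (chartAt Plane q₀).source)
    (k : Fin 2) : SmoothMat U (fun q => betaForm X q (coordField q₀ k q)) :=
  fun i j => h.smoothMat_theta hS k (Sum.inl i) (Sum.inr j)

theorem smoothMat_gamma (h : IsFrameField U X) {q₀ : M} (hS : U ⊆ (chartAt Plane q₀).source)
    (k : Fin 2) : SmoothMat U (fun q => gammaForm X q (coordField q₀ k q)) :=
  fun i j => h.smoothMat_theta hS k (Sum.inr i) (Sum.inl j)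

theorem smoothOn_omegaC (h : IsFrameField U X) {q₀ : M} (hS : U ⊆ (chartAt Plane q₀).source)
    (k : Fin 2) : SmoothOn U (omegaC q₀ X k) := (h.smoothMat_gamma hS k).cnj

theorem smoothOn_rhoC (h : IsFrameField U X) {q₀ : M} (hS : U ⊆ (chartAt Plane q₀).source)
    (k : Fin 2) : SmoothOn U (rhoC q₀ X k) := (h.smoothMat_alpha hS k).lin

theorem smoothOn_etaC (h : IsFrameField U X) {q₀ : M} (hS : U ⊆ (chartAt Plane q₀).source)
    (k : Fin 2) : SmoothOn U (etaC q₀ X k) := (h.smoothMat_alpha hS k).cnj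

/-- `d(df) = 0` for the components of `df` in a frame field. -/
theorem tau_structure (h : IsFrameField U X) {q₀ : M} (hS : U ⊆ (chartAt Plane q₀).source)
    {f : M → R4} (hf : SmoothOn U f) :
    (∀ k i, SmoothOn U (fun p => tauForm f X p (coordField q₀ k p) i)) ∧
    ∀ q ∈ U, ∀ i, pd q₀ 0 (fun p => tauForm f X p (coordField q₀ 1 p) i) q
        - pd q₀ 1 (fun p => tauForm f X p (coordField q₀ 0 p) i) q
      = (thetaForm X q (coordField q₀ 1 q) *ᵥ tauForm f X q (coordField q₀ 0 q)) i
        - (thetaForm X q (coordField q₀ 0 q) *ᵥ tauForm f X q (coordField q₀ 1 q)) i := by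
  -- As a one-column matrix f is subject to the product rule `dMat_mul`; the argument is then that
  -- of `maurerCartan`.
  let F : M → Matrix Idx (Fin 1) ℝ := fun p => Matrix.of fun i _ => f p i
  have hF : SmoothMat U F := fun i _ => (contMDiffOn_pi_space.1 hf) i
  have hdF : ∀ k, SmoothMat U (fun q => dMat F q (coordField q₀ k q)) := fun k i j =>
    SmoothOn.pd q₀ k h.isOpen hS (hF i j)
  let T : Fin 2 → M → Matrix Idx (Fin 1) ℝ := fun k q => (X q)⁻¹ * dMat F q (coordField q₀ k q)
  have hT : ∀ k, SmoothMat U (T k) := fun k => h.smoothMat_inv.mul (hdF k)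
  have hTe : ∀ k, ∀ q ∈ U, ∀ i, tauForm f X q (coordField q₀ k q) i = T k q i 0 := by
    intro k q hq i
    simp only [tauForm, T, Matrix.mulVec, dotProduct, Matrix.mul_apply]
    refine Finset.sum_congr rfl fun j _ => ?_
    congr 1
    exact (mvfderiv_apply (hf.diffAt h.isOpen hq) j _).symm
  refine ⟨fun k i => (hT k i 0).congr fun q hq => hTe k q hq i, fun q hq i => ?_⟩
  have key : ∀ j k, dMat (fun p => dMat F p (coordField q₀ k p)) q (coordField q₀ j q)
      = X q * (thetaForm X q (coordField q₀ j q) * T k q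
        + dMat (T k) q (coordField q₀ j q)) := by
    intro j k
    rw [dMat_congr h.isOpen hq (Y := fun p => X p * T k p) fun p hp => by
        simp only [T]; rw [← Matrix.mul_assoc, h.mul_inv hp, Matrix.one_mul],
      dMat_mul h.isOpen h.smoothMat (hT k) hq, h.dMat_eq hq, Matrix.mul_add,
      Matrix.mul_assoc]
  have hc : dMat (fun p => dMat F p (coordField q₀ 1 p)) q (coordField q₀ 0 q)
      = dMat (fun p => dMat F p (coordField q₀ 0 p)) q (coordField q₀ 1 q) := by
    ext i j
    exact pd_comm q₀ h.isOpen hS (hF i j) hq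
  rw [key, key] at hc
  have h2 := congrArg (fun N : Matrix Idx (Fin 1) ℝ => (X q)⁻¹ * N) hc
  simp only [← Matrix.mul_assoc, h.inv_mul hq, Matrix.one_mul] at h2
  have h3 := congrFun (congrFun h2 i) 0
  simp only [Matrix.add_apply, Matrix.mul_apply] at h3
  have e : ∀ j k, pd q₀ j (fun p => tauForm f X p (coordField q₀ k p) i) q
      = dMat (T k) q (coordField q₀ j q) i 0 := fun j k => by
    rw [pd, mvfderiv_congr_of_mem h.isOpen hq fun p hp => hTe k p hp i]
    rfl
  rw [e, e]
  simp only [Matrix.mulVec, dotProduct, hTe _ q hq]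
  linarith

end IsFrameField

theorem mulVec_sum_inl (N : Mat4) (w : R4) (h0 : ∀ i, w (Sum.inr i) = 0) :
    (∀ i, (N *ᵥ w) (Sum.inl i) = (N.toBlocks₁₁ *ᵥ fun j => w (Sum.inl j)) i) ∧
    (∀ i, (N *ᵥ w) (Sum.inr i) = (N.toBlocks₂₁ *ᵥ fun j => w (Sum.inl j)) i) := by
  constructor <;> intro i <;>
    simp [Matrix.mulVec, dotProduct, Fintype.sum_sum_type, h0, Matrix.toBlocks₁₁,
      Matrix.toBlocks₂₁]

/-- If φ ∧ φ̄ vanished, φ(∂₁) conj φ(∂₀) would be real, and a nontrivial real combination of ∂₀, ∂₁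
would lie in the kernel. Applied to ω, τ̄ and dz, this justifies all later divisions by their
components and by ω ∧ ω̄ or dz ∧ dz̄. -/
theorem wedge_ne_zero {q₀ q : M} [IsManifold (𝓡 2) ∞ M] (hq : q ∈ (chartAt Plane q₀).source)
    (φ : TangentSpace (𝓡 2) q → ℂ)
    (hl : ∀ (a b : ℝ) v w, φ (a • v + b • w) = a * φ v + b * φ w)
    (h0 : ∀ v, φ v = 0 → v = 0) :
    φ (coordField q₀ 0 q) ≠ 0 ∧ φ (coordField q₀ 0 q) * conj (φ (coordField q₀ 1 q))
      - φ (coordField q₀ 1 q) * conj (φ (coordField q₀ 0 q)) ≠ 0 := by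
  have hne : φ (coordField q₀ 0 q) ≠ 0 := by
    intro h
    have h1 := h0 _ h
    have := coordField_independent q₀ hq (a := 1) (b := 0) (by simp [h1])
    exact one_ne_zero this.1
  refine ⟨hne, fun hw => ?_⟩
  set x := φ (coordField q₀ 0 q) with hx
  set y := φ (coordField q₀ 1 q) with hy
  have h1 := hl (-(y * conj x).re) (Complex.normSq x) (coordField q₀ 0 q) (coordField q₀ 1 q)
  have h2 : (-(y * conj x).re : ℂ) * x + (Complex.normSq x : ℂ) * y = 0 := by
    have hre : ((y * conj x).re : ℂ) = y * conj x := by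
      apply Complex.conj_eq_iff_re.1
      rw [map_mul, Complex.conj_conj]
      linear_combination hw
    rw [hre, Complex.normSq_eq_conj_mul_self]
    ring
  rw [← hx, ← hy, Complex.ofReal_neg, h2] at h1
  have h3 := coordField_independent q₀ hq (h0 _ h1)
  exact hne (Complex.normSq_eq_zero.1 h3.2)

namespace IsSecondOrder

variable {A : VolumeElement M} {f : M → R4} {U V : Set M} {X Y : M → Mat4}
variable [IsManifold (𝓡 2) ∞ M]

/-- The two parts of the γ block of dθ = -θ ∧ θ. The antilinear one is dω = 2ρ̄ ∧ ω. In the linear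
one the derivatives vanish with `lin γ`, and what remains says that the coefficient of ω in `cnj α`
is real. -/
theorem omega_structure (h : IsSecondOrder A f U X) {q₀ : M}
    (hS : U ⊆ (chartAt Plane q₀).source) {q : M} (hq : q ∈ U) :
    pd q₀ 0 (omegaC q₀ X 1) q - pd q₀ 1 (omegaC q₀ X 0) q
      = 2 * (conj (rhoC q₀ X 0 q) * omegaC q₀ X 1 q - conj (rhoC q₀ X 1 q) * omegaC q₀ X 0 q) ∧
    omegaC q₀ X 1 q * conj (etaC q₀ X 0 q) - etaC q₀ X 1 q * conj (omegaC q₀ X 0 q)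
      - omegaC q₀ X 0 q * conj (etaC q₀ X 1 q) + etaC q₀ X 0 q * conj (omegaC q₀ X 1 q) = 0 := by
  have hmc := (h.toIsFrameField.maurerCartan_blocks hS hq).1
  have e1 := congrArg cnj hmc
  have e2 := congrArg lin hmc
  have hl := fun k => h.lin_gamma hq (coordField q₀ k q)
  have d1 := fun j k => mvfderiv_cnj h.isOpen (h.toIsFrameField.smoothMat_gamma hS k) hq
    (coordField q₀ j q)
  have d2 : ∀ j k, lin (dMat (fun p => gammaForm X p (coordField q₀ k p)) q (coordField q₀ j q))
      = 0 := by
    intro j k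
    rw [← mvfderiv_lin h.isOpen (h.toIsFrameField.smoothMat_gamma hS k) hq,
      mvfderiv_congr_of_mem h.isOpen hq (w := fun _ => 0) fun p hp => h.lin_gamma hp _,
      mvfderiv_const']
  simp only [cnj_sub, cnj_mul, hl, lin_transpose, cnj_transpose, ← d1] at e1
  simp only [lin_sub, lin_mul, hl, d2, cnj_transpose] at e2
  constructor
  · change _ = (_ : ℂ) at e1
    simp only [pd, omegaC, rhoC]
    rw [show (fun p => cnj (gammaForm X p (coordField q₀ 1 p))) = omegaC q₀ X 1 from rfl,
      show (fun p => cnj (gammaForm X p (coordField q₀ 0 p))) = omegaC q₀ X 0 from rfl] at e1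
    refine e1.trans ?_
    simp
    ring
  · simp only [omegaC, etaC]
    simp at e2
    linear_combination -e2

/-- The components of d(df) = 0 along X₁, X₂ and along X₃, X₄. The latter contain no derivative, as
df has no components there, and amount to ω ∧ τ = 0. -/
theorem tau_equations (h : IsSecondOrder A f U X) (hf : SmoothOn U f) {q₀ : M}
    (hS : U ⊆ (chartAt Plane q₀).source) :
    (∀ k, SmoothOn U (tauC q₀ f X k)) ∧ ∀ q ∈ U,
    pd q₀ 0 (tauC q₀ f X 1) q - pd q₀ 1 (tauC q₀ f X 0) q
      = rhoC q₀ X 1 q * tauC q₀ f X 0 q + etaC q₀ X 1 q * conj (tauC q₀ f X 0 q)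
        - (rhoC q₀ X 0 q * tauC q₀ f X 1 q + etaC q₀ X 0 q * conj (tauC q₀ f X 1 q)) ∧
    omegaC q₀ X 1 q * conj (tauC q₀ f X 0 q) = omegaC q₀ X 0 q * conj (tauC q₀ f X 1 q) := by
  obtain ⟨hs, hst⟩ := h.toIsFrameField.tau_structure hS hf
  have hsm : ∀ k, SmoothOn U (tauC q₀ f X k) := by
    intro k
    have e : ∀ p, tauC q₀ f X k p = (tauForm f X p (coordField q₀ k p) (Sum.inl 0) : ℂ)
        + (tauForm f X p (coordField q₀ k p) (Sum.inl 1) : ℂ) * Complex.I := fun p => by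
      apply Complex.ext <;> simp [tauC, tauBar, cx]
    rw [show tauC q₀ f X k = _ from funext e]
    exact (SmoothOn.ofReal (hs k _)).add ((SmoothOn.ofReal (hs k _)).mul (SmoothOn.const _))
  refine ⟨hsm, fun q hq => ⟨?_, ?_⟩⟩
  · have hd : ∀ j k, pd q₀ j (tauC q₀ f X k) q = cx fun i =>
        pd q₀ j (fun p => tauForm f X p (coordField q₀ k p) (Sum.inl i)) q := by
      intro j k
      apply Complex.ext
      · exact (mvfderiv_re ((hsm k).diffAt h.isOpen hq) _).symm
      · exact (mvfderiv_im ((hsm k).diffAt h.isOpen hq) _).symm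
    have e : ∀ j k, (rhoC q₀ X j q * tauC q₀ f X k q + etaC q₀ X j q * conj (tauC q₀ f X k q))
        = cx fun i => (thetaForm X q (coordField q₀ j q) *ᵥ
          tauForm f X q (coordField q₀ k q)) (Sum.inl i) := by
      intro j k
      simp only [(mulVec_sum_inl _ _ (h.tauForm_inr hq (coordField q₀ k q))).1]
      exact (cx_mulVec _ _).symm
    rw [hd, hd, e, e]
    apply Complex.ext
    · exact hst q hq (Sum.inl 0)
    · exact hst q hq (Sum.inl 1)
  · have e : ∀ j k, omegaC q₀ X j q * conj (tauC q₀ f X k q)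
        = cx fun i => (thetaForm X q (coordField q₀ j q) *ᵥ
          tauForm f X q (coordField q₀ k q)) (Sum.inr i) := by
      intro j k
      simp only [(mulVec_sum_inl _ _ (h.tauForm_inr hq (coordField q₀ k q))).2]
      refine Eq.trans ?_ (cx_mulVec _ _).symm
      change _ = lin (gammaForm X q (coordField q₀ j q)) * _ + _
      rw [h.lin_gamma hq, zero_mul, zero_add]
      rfl
    have z : ∀ i k, pd q₀ i (fun p => tauForm f X p (coordField q₀ k p) (Sum.inr 0)) q = 0 ∧
        pd q₀ i (fun p => tauForm f X p (coordField q₀ k p) (Sum.inr 1)) q = 0 := by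
      intro i k
      constructor <;>
      · rw [pd, mvfderiv_congr_of_mem h.isOpen hq (w := fun _ => 0) fun p hp =>
          h.tauForm_inr hp _ _, mvfderiv_const']
    have h0 := hst q hq (Sum.inr 0)
    have h1 := hst q hq (Sum.inr 1)
    rw [(z _ _).1, (z _ _).1, sub_self] at h0
    rw [(z _ _).2, (z _ _).2, sub_self] at h1
    rw [e, e]
    apply Complex.ext
    · exact sub_eq_zero.1 h0.symm
    · exact sub_eq_zero.1 h1.symm

omit [IsManifold (𝓡 2) ∞ M] in
theorem omegaC_eq (h : IsFirstOrder A f U X) {q₀ q : M} (hq : q ∈ U) (k : Fin 2) :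
    omegaC q₀ X k q = omegaForm X q (coordField q₀ k q) := cnj_gamma h hq _

theorem omegaC_wedge (h : IsSecondOrder A f U X) (hf : IsElliptic A f) {q₀ q : M}
    (hS : U ⊆ (chartAt Plane q₀).source) (hq : q ∈ U) :
    omegaC q₀ X 0 q ≠ 0 ∧ omegaC q₀ X 0 q * conj (omegaC q₀ X 1 q)
      - omegaC q₀ X 1 q * conj (omegaC q₀ X 0 q) ≠ 0 := by
  rw [omegaC_eq h.toIsFirstOrder hq, omegaC_eq h.toIsFirstOrder hq]
  exact wedge_ne_zero (hS hq) _ (omegaForm_add_smul X q) fun v hv => h.eq_zero_of_omegaForm hf hq hv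

/-- `τ = t ω`. -/
theorem exists_tau_eq (h : IsSecondOrder A f U X) (hf : IsElliptic A f) {q : M} (hq : q ∈ U) :
    ∃ t : ℂ, t ≠ 0 ∧ ∀ v, tauComplex f X q v = t * omegaForm X q v := by
  have hUo : IsOpen (U ∩ (chartAt Plane q).source) :=
    h.isOpen.inter (chartAt Plane q).open_source
  have h' := h.mono hUo Set.inter_subset_left
  have hq' : q ∈ U ∩ (chartAt Plane q).source := ⟨hq, mem_chart_source Plane q⟩
  have hS : U ∩ (chartAt Plane q).source ⊆ (chartAt Plane q).source := Set.inter_subset_right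
  have e := ((h'.tau_equations hf.smooth.contMDiffOn hS).2 q hq').2
  have hw := (h'.omegaC_wedge hf hS hq').1
  have ht := (wedge_ne_zero (hS hq') _ (tauBar_add_smul f X q) fun v hv =>
    h.eq_zero_of_tauBar hf.toIsLagrangianImmersion hq hv).1
  refine ⟨conj (tauC q f X 0 q) / omegaC q X 0 q, div_ne_zero ((map_ne_zero _).2 ht) hw,
    fun v => ?_⟩
  obtain ⟨a, rfl⟩ := exists_eq_smul_coordField q (hS hq') v
  rw [tauComplex_eq, tauBar_add_smul, omegaForm_add_smul, ← omegaC_eq h.toIsFirstOrder hq,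
    ← omegaC_eq h.toIsFirstOrder hq]
  change conj (_ * tauC q f X 0 q + _ * tauC q f X 1 q) = _
  rw [map_add, map_mul, map_mul, Complex.conj_ofReal, Complex.conj_ofReal]
  field_simp
  linear_combination -(a 1 : ℂ) * e

end IsSecondOrder

/-- The cubic identity forces φ' to be a complex multiple aφ although both are only assumed
real-linear. Then c = t'a/t relates the two pairs exactly as a conformal gauge does. -/
theorem cubic_rigidity {q : M} {φ φ' : TangentSpace (𝓡 2) q → ℂ}
    (hl : ∀ (a b : ℝ) v w, φ (a • v + b • w) = a * φ v + b * φ w)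
    (hl' : ∀ (a b : ℝ) v w, φ' (a • v + b • w) = a * φ' v + b * φ' w)
    (h0 : ∀ v, φ v = 0 → v = 0) {t t' : ℂ} (ht : t ≠ 0)
    (h : ∀ v, (t' * φ' v) ^ 2 * φ' v = (t * φ v) ^ 2 * φ v) :
    ∃ c : ℂ, c ≠ 0 ∧ ∀ v, c ^ 2 * φ' v = φ v ∧ t' * φ' v = c * (t * φ v) := by
  have hs := surjective_of_injective_complex φ hl h0
  obtain ⟨v₁, h1⟩ := hs 1
  obtain ⟨v₂, h2⟩ := hs Complex.I
  have hv : ∀ v, v = (φ v).re • v₁ + (φ v).im • v₂ := by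
    intro v
    have e : φ ((1 : ℝ) • v + (-1 : ℝ) • ((φ v).re • v₁ + (φ v).im • v₂)) = 0 := by
      rw [hl, hl, h1, h2]
      have := Complex.re_add_im (φ v)
      push_cast
      linear_combination -this
    have := h0 _ e
    rw [one_smul, neg_one_smul] at this
    exact eq_of_sub_eq_zero (by rw [sub_eq_add_neg]; exact this)
  set a := φ' v₁ with ha
  set b := φ' v₂ with hb
  have k1 := h v₁
  have k2 := h v₂
  have k3 := h ((1 : ℝ) • v₁ + (1 : ℝ) • v₂)
  have k4 := h ((1 : ℝ) • v₁ + (-1 : ℝ) • v₂)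
  rw [hl, hl', h1, h2, ← ha, ← hb] at k3 k4
  rw [h1, ← ha] at k1
  rw [h2, ← hb] at k2
  push_cast at k3 k4
  have ha3 : t' ^ 2 * a ^ 3 = t ^ 2 := by linear_combination k1
  have hne : t' ^ 2 * a ^ 3 ≠ 0 := by rw [ha3]; exact pow_ne_zero 2 ht
  have ht' : t' ≠ 0 := by rintro rfl; simp at hne
  have ha0 : a ≠ 0 := by rintro h; rw [h] at hne; simp at hne
  -- Polarization: (a + b)³ - (a - b)³ - 2b³ = 6a²b, hence t'²a²b = t²i, to be compared with t'²a³ =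
  -- t².
  have hba : b = a * Complex.I := by
    have e : (t' ^ 2 * a ^ 2) * (b - a * Complex.I) = 0 := by
      linear_combination (1 / 6 : ℂ) * k3 - (1 / 6 : ℂ) * k4 - (1 / 3 : ℂ) * k2
        - Complex.I * ha3
    have := (mul_eq_zero.1 e).resolve_left (mul_ne_zero (pow_ne_zero 2 ht') (pow_ne_zero 2 ha0))
    exact sub_eq_zero.1 this
  have hφ : ∀ v, φ' v = a * φ v := by
    intro v
    conv_lhs => rw [hv v]
    rw [hl', ← ha, ← hb, hba]
    conv_rhs => rw [← Complex.re_add_im (φ v)]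
    ring
  refine ⟨t' * a / t, div_ne_zero (mul_ne_zero ht' ha0) ht, fun v => ?_⟩
  rw [hφ v]
  constructor
  · field_simp
    linear_combination φ v * ha3
  · field_simp

end StructureEquations

/-! ### Matching frame fields of two immersions with the same Fubini cubic form -/

section Matching

variable {M : Type*} [TopologicalSpace M] [ChartedSpace Plane M]

/-- The frame field `X'` has the same forms `α`, `γ` as `X`. -/
structure AgreesUpToBeta (W : Set M) (X X' : M → Mat4) : Prop extends IsFrameField W X' where
  alpha_eq : ∀ q ∈ W, ∀ v, alphaForm X' q v = alphaForm X q v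
  gamma_eq : ∀ q ∈ W, ∀ v, gammaForm X' q v = gammaForm X q v

theorem AgreesUpToBeta.mono {W V : Set M} {X X' : M → Mat4} (h : AgreesUpToBeta W X X')
    (hV : IsOpen V) (hVW : V ⊆ W) : AgreesUpToBeta V X X' :=
  ⟨h.toIsFrameField.mono hV hVW, fun q hq => h.alpha_eq q (hVW hq),
    fun q hq => h.gamma_eq q (hVW hq)⟩

theorem alphaForm_eq_of_parts {q₀ q : M} [IsManifold (𝓡 2) ∞ M]
    (hq : q ∈ (chartAt Plane q₀).source) {X X' : M → Mat4}
    (h1 : ∀ k, rhoC q₀ X' k q = rhoC q₀ X k q) (h2 : ∀ k, etaC q₀ X' k q = etaC q₀ X k q)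
    (v : TangentSpace (𝓡 2) q) : alphaForm X' q v = alphaForm X q v := by
  obtain ⟨a, rfl⟩ := exists_eq_smul_coordField q₀ hq v
  rw [alphaForm_add_smul, alphaForm_add_smul]
  congr 2
  · exact parts_ext (h1 0) (h2 0)
  · exact parts_ext (h1 1) (h2 1)

theorem IsFirstOrder.tauForm_eq_of_tauBar {A : VolumeElement M} {f f' : M → R4} {U V : Set M}
    {X X' : M → Mat4} (h : IsFirstOrder A f U X) (h' : IsFirstOrder A f' V X') {q : M}
    (hq : q ∈ U) (hq' : q ∈ V) {v : TangentSpace (𝓡 2) q}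
    (e : tauBar f' X' q v = tauBar f X q v) : tauForm f' X' q v = tauForm f X q v := by
  ext (i | i)
  · have h1 := congrArg Complex.re e
    have h2 := congrArg Complex.im e
    fin_cases i
    · exact h1
    · exact h2
  · rw [h.tauForm_inr hq, h'.tauForm_inr hq']

variable [IsManifold (𝓡 2) ∞ M]
variable {A : VolumeElement M} {f f' : M → R4}

/-- A second order frame field of `f'` with the forms `γ` and `τ` of a given one of `f`. -/
theorem exists_matching_gamma_tau (hf : IsElliptic A f) (hf' : IsElliptic A f')
    (hF : fubiniCubicForm A f' = fubiniCubicForm A f) {U : Set M} {X : M → Mat4}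
    (h : IsSecondOrder A f U X) {q₀ : M} (hq₀ : q₀ ∈ U) :
    ∃ (W : Set M) (Y : M → Mat4), q₀ ∈ W ∧ W ⊆ U ∧ W ⊆ (chartAt Plane q₀).source ∧
      IsSecondOrder A f' W Y ∧ (∀ q ∈ W, ∀ v, gammaForm Y q v = gammaForm X q v) ∧
      ∀ q ∈ W, ∀ v, tauBar f' Y q v = tauBar f X q v := by
  obtain ⟨V, Z, hqV, hZ⟩ := exists_secondOrder hf' q₀
  set W := U ∩ V ∩ (chartAt Plane q₀).source with hW
  have hWo : IsOpen W := (h.isOpen.inter hZ.isOpen).inter (chartAt Plane q₀).open_source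
  have hS : W ⊆ (chartAt Plane q₀).source := Set.inter_subset_right
  have hWU : W ⊆ U := fun q hq => hq.1.1
  have hX := h.mono hWo hWU
  have hZ' := hZ.mono hWo (fun q hq => hq.1.2)
  have hT : ∀ q ∈ W, tauC q₀ f X 0 q ≠ 0 := fun q hq =>
    (wedge_ne_zero (hS hq) _ (tauBar_add_smul f X q) fun v hv =>
      hX.eq_zero_of_tauBar hf.toIsLagrangianImmersion hq hv).1
  have hT' : ∀ q ∈ W, tauC q₀ f' Z 0 q ≠ 0 := fun q hq =>
    (wedge_ne_zero (hS hq) _ (tauBar_add_smul f' Z q) fun v hv =>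
      hZ'.eq_zero_of_tauBar hf'.toIsLagrangianImmersion hq hv).1
  have hTs := (hX.tau_equations hf.smooth.contMDiffOn hS).1 0
  have hTs' := (hZ'.tau_equations hf'.smooth.contMDiffOn hS).1 0
  -- A smooth expression for the conjugate of the factor c that `cubic_rigidity` gives separately at
  -- each point.
  set a : M → ℂ := fun q => tauC q₀ f' Z 0 q / tauC q₀ f X 0 q with ha
  have has : SmoothOn W a := SmoothOn.div hTs' hTs hT
  have ha0 : ∀ q ∈ W, a q ≠ 0 := fun q hq => div_ne_zero (hT' q hq) (hT q hq)
  have hg := IsGauge.conformal hWo has ha0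
  have hY := hZ'.gauge hg subset_rfl fun q hq => ⟨by simp, by simpa using ha0 q hq⟩
  have key : ∀ q ∈ W, ∀ v, conj (a q) ^ 2 * omegaForm Z q v = omegaForm X q v ∧
      tauBar f' Z q v = a q * tauBar f X q v := by
    intro q hq
    obtain ⟨t, ht, htau⟩ := hX.exists_tau_eq hf hq
    obtain ⟨t', -, htau'⟩ := hZ'.exists_tau_eq hf' hq
    have hFq := congrFun hF q
    rw [hZ'.fubiniCubicForm_eq hf' hq, hX.fubiniCubicForm_eq hf hq] at hFq
    obtain ⟨c, -, hc⟩ := cubic_rigidity (omegaForm_add_smul X q) (omegaForm_add_smul Z q)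
      (fun v hv => hX.eq_zero_of_omegaForm hf hq hv) ht (t' := t') fun v => by
        rw [← htau, ← htau']; exact congrFun hFq v
    have htb : ∀ v, tauBar f' Z q v = conj c * tauBar f X q v := by
      intro v
      have := (hc v).2
      rw [← htau, ← htau', tauComplex_eq, tauComplex_eq] at this
      have := congrArg conj this
      simpa using this
    have hac : a q = conj c := by
      have := htb (coordField q₀ 0 q)
      simp only [ha, tauC]
      rw [this]
      exact mul_div_cancel_right₀ _ (hT q hq)
    intro v
    rw [hac, Complex.conj_conj]
    exact ⟨(hc v).1, htb v⟩
  refine ⟨W, _, ⟨⟨hq₀, hqV⟩, mem_chart_source Plane q₀⟩, hWU, hS, hY, fun q hq v => ?_,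
    fun q hq v => ?_⟩
  · obtain ⟨e1, e2, -⟩ := hg.omega_tau hZ' hq (by simp) (by simpa using ha0 q hq) v
    refine parts_ext (by rw [e1, hX.lin_gamma hq]) ?_
    rw [e2, IsSecondOrder.cnj_gamma hZ'.toIsFirstOrder hq,
      IsSecondOrder.cnj_gamma hX.toIsFirstOrder hq, ← (key q hq v).1]
    simp
  · obtain ⟨-, -, e3⟩ := hg.omega_tau hZ' hq (by simp) (by simpa using ha0 q hq) v
    rw [e3, (key q hq v).2]
    have := ha0 q hq
    simp [this]

/-- Subtract the structure equations of X and Y, which share ω and τ. From dω, conj(Δρ) ∧ ω = 0, so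
Δρ = bω̄. As τ̄ is a multiple of ω̄, this drops out of dτ̄ and leaves Δ(cnj α) ∧ ω = 0, so Δ(cnj α)
= rω, with r real by the linear part of the γ equation. The shear with block C = `matOf r b` changes
α by -ᵗCγ, whose parts are -bω̄ and -rω, and preserves γ and τ. -/
theorem exists_matching (hf : IsElliptic A f) (hf' : IsElliptic A f')
    (hF : fubiniCubicForm A f' = fubiniCubicForm A f) {U : Set M} {X : M → Mat4}
    (h : IsSecondOrder A f U X) {q₀ : M} (hq₀ : q₀ ∈ U) :
    ∃ (W : Set M) (X' : M → Mat4), q₀ ∈ W ∧ W ⊆ U ∧ AgreesUpToBeta W X X' ∧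
      ∀ q ∈ W, ∀ v, X' q *ᵥ tauForm f X q v = mvfderiv (𝓡 2) f' q v := by
  obtain ⟨W, Y, hqW, hWU, hS, hY, hγ, hτ⟩ := exists_matching_gamma_tau hf hf' hF h hq₀
  have hWo := hY.isOpen
  have hX := h.mono hWo hWU
  have hω : ∀ q ∈ W, ∀ k, omegaC q₀ Y k q = omegaC q₀ X k q := fun q hq k => by
    rw [omegaC, omegaC, hγ q hq]
  have hT : ∀ q ∈ W, ∀ k, tauC q₀ f' Y k q = tauC q₀ f X k q := fun q hq k => hτ q hq _
  have hw := fun q (hq : q ∈ W) => hX.omegaC_wedge hf hS hq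
  have hωs := hX.toIsFrameField.smoothOn_omegaC hS
  set b : M → ℂ := fun q => (rhoC q₀ Y 0 q - rhoC q₀ X 0 q) / conj (omegaC q₀ X 0 q) with hb
  set r : M → ℂ := fun q => (etaC q₀ Y 0 q - etaC q₀ X 0 q) / omegaC q₀ X 0 q with hr
  have hbs : SmoothOn W b := SmoothOn.div (SmoothOn.sub (hY.toIsFrameField.smoothOn_rhoC hS 0)
    (hX.toIsFrameField.smoothOn_rhoC hS 0)) (SmoothOn.conj (hωs 0))
    fun q hq => (map_ne_zero _).2 (hw q hq).1
  have hrs : SmoothOn W r := SmoothOn.div (SmoothOn.sub (hY.toIsFrameField.smoothOn_etaC hS 0)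
    (hX.toIsFrameField.smoothOn_etaC hS 0)) (hωs 0) fun q hq => (hw q hq).1
  have key : ∀ q ∈ W, (∀ k, rhoC q₀ Y k q = rhoC q₀ X k q + b q * conj (omegaC q₀ X k q)) ∧
      (∀ k, etaC q₀ Y k q = etaC q₀ X k q + r q * omegaC q₀ X k q) ∧ ((r q).re : ℂ) = r q := by
    intro q hq
    obtain ⟨o1, o2⟩ := hX.omega_structure hS hq
    obtain ⟨o1', o2'⟩ := hY.omega_structure hS hq
    obtain ⟨t1, t2⟩ := (hX.tau_equations hf.smooth.contMDiffOn hS).2 q hq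
    obtain ⟨t1', -⟩ := (hY.tau_equations hf'.smooth.contMDiffOn hS).2 q hq
    have p1 : ∀ j k, pd q₀ j (omegaC q₀ Y k) q = pd q₀ j (omegaC q₀ X k) q := fun j k => by
      rw [pd, pd, mvfderiv_congr_of_mem hWo hq fun p hp => hω p hp k]
    have p2 : ∀ j k, pd q₀ j (tauC q₀ f' Y k) q = pd q₀ j (tauC q₀ f X k) q := fun j k => by
      rw [pd, pd, mvfderiv_congr_of_mem hWo hq fun p hp => hT p hp k]
    rw [p1, p1, hω q hq, hω q hq, o1] at o1'
    rw [hω q hq, hω q hq] at o2'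
    rw [p2, p2, hT q hq, hT q hq, t1] at t1'
    obtain ⟨w1, w2⟩ := hw q hq
    have w1c : conj (omegaC q₀ X 0 q) ≠ 0 := (map_ne_zero _).2 w1
    have hTne : tauC q₀ f X 0 q ≠ 0 :=
      (wedge_ne_zero (hS hq) _ (tauBar_add_smul f X q) fun v hv =>
        hX.eq_zero_of_tauBar hf.toIsLagrangianImmersion hq hv).1
    have hTc : conj (tauC q₀ f X 0 q) ≠ 0 := (map_ne_zero _).2 hTne
    have hρ : ∀ k, rhoC q₀ Y k q = rhoC q₀ X k q + b q * conj (omegaC q₀ X k q) := by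
      have e := congrArg conj o1'
      simp only [map_mul, map_sub, Complex.conj_conj, map_ofNat] at e
      intro k
      simp only [hb]
      field_simp
      fin_cases k
      · simp only [Fin.zero_eta]
        ring
      · simp only [Fin.mk_one]
        linear_combination (1 / 2 : ℂ) * e
    have t2c := congrArg conj t2
    simp only [map_mul, Complex.conj_conj] at t2c
    have hη : ∀ k, etaC q₀ Y k q = etaC q₀ X k q + r q * omegaC q₀ X k q := by
      have r0 := hρ 0
      have r1 := hρ 1
      have e : (etaC q₀ Y 1 q - etaC q₀ X 1 q) * conj (tauC q₀ f X 0 q)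
          = (etaC q₀ Y 0 q - etaC q₀ X 0 q) * conj (tauC q₀ f X 1 q) := by
        rw [r0, r1] at t1'
        linear_combination -t1' - b q * t2c
      have e' : (etaC q₀ Y 1 q - etaC q₀ X 1 q) * omegaC q₀ X 0 q
          = (etaC q₀ Y 0 q - etaC q₀ X 0 q) * omegaC q₀ X 1 q := by
        apply mul_right_cancel₀ hTc
        linear_combination omegaC q₀ X 0 q * e - (etaC q₀ Y 0 q - etaC q₀ X 0 q) * t2
      intro k
      simp only [hr]
      field_simp
      fin_cases k
      · simp only [Fin.zero_eta]
        ring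
      · simp only [Fin.mk_one]
        linear_combination e'
    refine ⟨hρ, hη, ?_⟩
    apply Complex.conj_eq_iff_re.1
    rw [hη 0, hη 1] at o2'
    simp only [map_add, map_mul] at o2'
    have : (conj (r q) - r q) * (omegaC q₀ X 0 q * conj (omegaC q₀ X 1 q)
      - omegaC q₀ X 1 q * conj (omegaC q₀ X 0 q)) = 0 := by
      linear_combination o2 - o2'
    exact sub_eq_zero.1 ((mul_eq_zero.1 this).resolve_right w2)
  have hg := IsGauge.shear hWo hrs.re hbs
  have hX' := hY.gauge hg subset_rfl fun q _ => ⟨by simp, by simp⟩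
  have htheta := fun q (hq : q ∈ W) v => IsGauge.theta_blocks hY.toIsFrameField hg hq v
  have hγ' : ∀ q ∈ W, ∀ v, gammaForm (fun p => Y p * Matrix.fromBlocks 1
      (matOf ((r p).re : ℂ) (b p)) 0 1) q v = gammaForm X q v := fun q hq v => by
    rw [(htheta q hq v).1, ← hγ q hq]; simp
  refine ⟨W, _, hqW, hWU, ⟨hX'.toIsFrameField, fun q hq v => ?_, hγ'⟩, fun q hq v => ?_⟩
  · obtain ⟨k1, k2, k3⟩ := key q hq
    have ha : ∀ v, alphaForm (fun p => Y p * Matrix.fromBlocks 1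
      (matOf ((r p).re : ℂ) (b p)) 0 1) q v = alphaForm Y q v
        - (matOf ((r q).re : ℂ) (b q))ᵀ * gammaForm Y q v := by
      intro v
      rw [(htheta q hq v).2]
      simp [dMat_const]
    refine alphaForm_eq_of_parts (hS hq) (fun k => ?_) (fun k => ?_) v
    · have := k1 k
      simp only [rhoC] at this ⊢
      rw [ha, lin_sub, lin_mul, hY.lin_gamma hq, hγ q hq, this]
      simp [omegaC]
    · have := k2 k
      simp only [etaC] at this ⊢
      rw [ha, cnj_sub, cnj_mul, hY.lin_gamma hq, hγ q hq, this, lin_transpose, lin_matOf, k3]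
      have hrc : conj (r q) = r q := Complex.conj_eq_iff_re.2 k3
      rw [hrc]
      simp [omegaC]
  · rw [← hX'.mulVec_tauForm hq v]
    congr 1
    refine (hX.toIsFirstOrder.tauForm_eq_of_tauBar hX'.toIsFirstOrder hq hq ?_).symm
    rw [(hg.omega_tau hY hq (by simp) (by simp) v).2.2, ← hτ q hq]
    simp

/-! ### The difference of the forms `β` -/

/-- The components of the antilinear part of the difference of the forms `β`. -/
def betaDiffC (q₀ : M) (X X' : M → Mat4) (k : Fin 2) (p : M) : ℂ :=
  cnj (betaForm X' p (coordField q₀ k p)) - cnj (betaForm X p (coordField q₀ k p))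

namespace AgreesUpToBeta

variable {W : Set M} {X X' : M → Mat4}

theorem smoothOn_betaDiffC (h : AgreesUpToBeta W X X') (hX : IsFrameField W X) {q₀ : M}
    (hS : W ⊆ (chartAt Plane q₀).source) (k : Fin 2) : SmoothOn W (betaDiffC q₀ X X' k) :=
  SmoothOn.sub (h.toIsFrameField.smoothMat_beta hS k).cnj (hX.smoothMat_beta hS k).cnj

/-- With α and γ shared, the α block of the Maurer-Cartan equation says Δβ ∧ γ = 0. Its linear part
is σ ∧ ω̄ = 0. Its antilinear part is l ∧ ω = 0 for l = Δ(lin β). Symmetry of β makes l real, so l ∧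
ω̄ = 0 as well and l = 0. -/
theorem lin_beta (h : AgreesUpToBeta W X X') (hX : IsSecondOrder A f W X) (hf : IsElliptic A f)
    {q₀ : M} (hS : W ⊆ (chartAt Plane q₀).source) {q : M} (hq : q ∈ W) :
    (∀ k, lin (betaForm X' q (coordField q₀ k q)) = lin (betaForm X q (coordField q₀ k q))) ∧
    betaDiffC q₀ X X' 1 q * conj (omegaC q₀ X 0 q)
      = betaDiffC q₀ X X' 0 q * conj (omegaC q₀ X 1 q) := by
  have m := (hX.toIsFrameField.maurerCartan_blocks hS hq).2.1
  have m' := (h.toIsFrameField.maurerCartan_blocks hS hq).2.1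
  have d : ∀ j k, dMat (fun p => alphaForm X' p (coordField q₀ k p)) q (coordField q₀ j q)
      = dMat (fun p => alphaForm X p (coordField q₀ k p)) q (coordField q₀ j q) := fun j k => by
    rw [dMat_congr h.isOpen hq fun p hp => h.alpha_eq p hp _]
  simp only [d, m, h.alpha_eq q hq, h.gamma_eq q hq] at m'
  have e1 := congrArg lin m'
  have e2 := congrArg cnj m'
  have hl := fun k => hX.lin_gamma hq (coordField q₀ k q)
  simp only [lin_sub, lin_add, lin_mul, hl, mul_zero, zero_add] at e1
  simp only [cnj_sub, cnj_add, cnj_mul, hl, map_zero, mul_zero, add_zero] at e2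
  have hreal : ∀ k, conj (lin (betaForm X' q (coordField q₀ k q))
      - lin (betaForm X q (coordField q₀ k q))) = lin (betaForm X' q (coordField q₀ k q))
      - lin (betaForm X q (coordField q₀ k q)) := by
    intro k
    rw [← lin_sub, ← lin_transpose, Matrix.transpose_sub]
    congr 2
    · exact (h.toIsFrameField.gammaForm_symm hq _).2.1
    · exact (hX.toIsFrameField.gammaForm_symm hq _).2.1
  obtain ⟨w1, w2⟩ := hX.omegaC_wedge hf hS hq
  set l : Fin 2 → ℂ := fun k => lin (betaForm X' q (coordField q₀ k q))
      - lin (betaForm X q (coordField q₀ k q)) with hldef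
  have e3 : l 1 * omegaC q₀ X 0 q = l 0 * omegaC q₀ X 1 q := by
    simp only [hldef, omegaC]
    linear_combination -e2
  have e4 : l 1 * conj (omegaC q₀ X 0 q) = l 0 * conj (omegaC q₀ X 1 q) := by
    have := congrArg conj e3
    rwa [map_mul, map_mul, hreal, hreal] at this
  have l0 : l 0 = 0 := by
    have : l 0 * (omegaC q₀ X 0 q * conj (omegaC q₀ X 1 q)
        - omegaC q₀ X 1 q * conj (omegaC q₀ X 0 q)) = 0 := by
      linear_combination conj (omegaC q₀ X 0 q) * e3 - omegaC q₀ X 0 q * e4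
    exact (mul_eq_zero.1 this).resolve_right w2
  have l1 : l 1 = 0 := by
    rw [l0, zero_mul] at e3
    exact (mul_eq_zero.1 e3).resolve_right w1
  refine ⟨fun k => ?_, ?_⟩
  · fin_cases k
    · exact sub_eq_zero.1 l0
    · exact sub_eq_zero.1 l1
  · simp only [betaDiffC, omegaC]
    linear_combination -e1

/-- Differences of the two parts of the β block. The derivatives cancel in the linear part because
`lin β` is already shared. The antilinear part dσ = -2ρ ∧ σ has the sign opposite to dω = 2ρ̄ ∧ ω.
-/
theorem betaDiff_structure (h : AgreesUpToBeta W X X') (hX : IsSecondOrder A f W X)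
    (hf : IsElliptic A f) {q₀ : M} (hS : W ⊆ (chartAt Plane q₀).source) {q : M} (hq : q ∈ W) :
    etaC q₀ X 1 q * conj (betaDiffC q₀ X X' 0 q) - betaDiffC q₀ X X' 1 q * conj (etaC q₀ X 0 q)
      - etaC q₀ X 0 q * conj (betaDiffC q₀ X X' 1 q)
      + betaDiffC q₀ X X' 0 q * conj (etaC q₀ X 1 q) = 0 ∧
    pd q₀ 0 (betaDiffC q₀ X X' 1) q - pd q₀ 1 (betaDiffC q₀ X X' 0) q
      = 2 * (rhoC q₀ X 1 q * betaDiffC q₀ X X' 0 q - rhoC q₀ X 0 q * betaDiffC q₀ X X' 1 q) := by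
  have m := (hX.toIsFrameField.maurerCartan_blocks hS hq).2.2
  have m' := (h.toIsFrameField.maurerCartan_blocks hS hq).2.2
  have hb := hX.toIsFrameField.smoothMat_beta hS
  have hb' := h.toIsFrameField.smoothMat_beta hS
  have dl : ∀ j k, lin (dMat (fun p => betaForm X' p (coordField q₀ k p)) q (coordField q₀ j q))
      = lin (dMat (fun p => betaForm X p (coordField q₀ k p)) q (coordField q₀ j q)) := by
    intro j k
    rw [← mvfderiv_lin h.isOpen (hb' k) hq, ← mvfderiv_lin h.isOpen (hb k) hq,
      mvfderiv_congr_of_mem h.isOpen hq fun p hp => (h.lin_beta hX hf hS hp).1 k]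
  have dc : ∀ j k, pd q₀ j (betaDiffC q₀ X X' k) q
      = cnj (dMat (fun p => betaForm X' p (coordField q₀ k p)) q (coordField q₀ j q))
        - cnj (dMat (fun p => betaForm X p (coordField q₀ k p)) q (coordField q₀ j q)) := by
    intro j k
    rw [← mvfderiv_cnj h.isOpen (hb' k) hq, ← mvfderiv_cnj h.isOpen (hb k) hq]
    exact mvfderiv_sub' ((hb' k).cnj.diffAt h.isOpen hq) ((hb k).cnj.diffAt h.isOpen hq) _
  have hl := (h.lin_beta hX hf hS hq).1
  simp only [h.alpha_eq q hq] at m'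
  have a1 := congrArg lin m
  have a2 := congrArg lin m'
  have b1 := congrArg cnj m
  have b2 := congrArg cnj m'
  simp only [lin_sub, lin_mul, lin_transpose, cnj_transpose, dl, hl] at a1 a2
  simp only [cnj_sub, cnj_mul, lin_transpose, cnj_transpose, hl, Complex.conj_conj] at b1 b2
  constructor
  · simp only [betaDiffC, etaC, map_sub]
    linear_combination a1 - a2
  · rw [dc, dc]
    simp only [betaDiffC, rhoC]
    linear_combination b2 - b1

end AgreesUpToBeta

/-! ### Local congruence -/

/-- From dX = Xθ and dX' = X'θ it follows that X'X⁻¹ has zero derivative. If S is its constant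
value, `hτ` reads df' = S df. -/
theorem exists_local_congruence {q₀ : M} {W : Set M} {r : ℝ} (hW : IsOpen W) (hq₀ : q₀ ∈ W)
    (hS : W ⊆ (chartAt Plane q₀).source)
    (hball : (chartAt Plane q₀).target ∩ (chartAt Plane q₀).symm ⁻¹' W
        = Metric.ball (chartAt Plane q₀ q₀) r)
    (hfs : SmoothOn W f) (hfs' : SmoothOn W f')
    {X X' : M → Mat4} (hX : IsFirstOrder A f W X) (hX' : IsFrameField W X')
    (hτ : ∀ q ∈ W, ∀ v, X' q *ᵥ tauForm f X q v = mvfderiv (𝓡 2) f' q v)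
    (hθ : ∀ q ∈ W, ∀ k, thetaForm X' q (coordField q₀ k q) = thetaForm X q (coordField q₀ k q)) :
    ∃ (b : R4) (S : Mat4), S ∈ Matrix.symplecticGroup (Fin 2) ℝ ∧
      ∀ q ∈ W, f' q = b + S *ᵥ f q := by
  have hXf := hX.toIsFrameField
  let S : M → Mat4 := fun q => X' q * (X q)⁻¹
  have hSs : SmoothMat W S := hX'.smoothMat.mul hXf.smoothMat_inv
  have hSX : ∀ q ∈ W, X' q = S q * X q := fun q hq => by
    simp only [S]; rw [mul_assoc, hXf.inv_mul hq, mul_one]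
  have hdS : ∀ q ∈ W, ∀ k, dMat S q (coordField q₀ k q) = 0 := by
    intro q hq k
    have e := hX'.dMat_eq hq (coordField q₀ k q)
    rw [dMat_congr hW hq hSX, dMat_mul hW hSs hXf.smoothMat hq, hXf.dMat_eq hq, hθ q hq,
      ← mul_assoc, ← hSX q hq, add_eq_right] at e
    have e2 := congrArg (fun N => N * (X q)⁻¹) e
    simp only [zero_mul, mul_assoc, hXf.mul_inv hq, mul_one] at e2
    exact e2
  have hSc : ∀ q ∈ W, S q = S q₀ := by
    intro q hq
    ext i j
    exact eq_of_pd_eq_zero q₀ hW hS hball (hSs i j)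
      (fun k p hp => congrFun (congrFun (hdS p hp k) i) j) hq hq₀
  have hfi : ∀ i, SmoothOn W (fun q => f q i) := fun i => contMDiffOn_pi_space.1 hfs i
  have hfi' : ∀ i, SmoothOn W (fun q => f' q i) := fun i => contMDiffOn_pi_space.1 hfs' i
  have hsum : ∀ i, SmoothOn W (fun q => ∑ j, S q₀ i j * f q j) := fun i =>
    SmoothOn.sum fun j _ => SmoothOn.mul (SmoothOn.const _) (hfi j)
  have hconst : ∀ q ∈ W, ∀ i, f' q i - ∑ j, S q₀ i j * f q j
      = f' q₀ i - ∑ j, S q₀ i j * f q₀ j := by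
    intro q hq i
    refine eq_of_pd_eq_zero q₀ hW hS hball (u := fun q => f' q i - ∑ j, S q₀ i j * f q j)
      (SmoothOn.sub (hfi' i) (hsum i)) (fun k p hp => ?_) hq hq₀
    have d1 := (hfi' i).diffAt hW hp
    have d2 := (hsum i).diffAt hW hp
    rw [pd, mvfderiv_sub' d1 d2, mvfderiv_apply (hfs'.diffAt hW hp),
      (mvfderiv_sum (s := Finset.univ) (u := fun j q => S q₀ i j * f q j)
        (fun j _ => (SmoothOn.mul (SmoothOn.const (S q₀ i j)) (hfi j)).diffAt hW hp) _).2,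
      ← hτ p hp, hSX p hp, hSc p hp, ← Matrix.mulVec_mulVec, hX.mulVec_tauForm hp,
      sub_eq_zero, eq_comm]
    change (∑ j, _) = ∑ j, S q₀ i j * _
    refine Finset.sum_congr rfl fun j _ => ?_
    rw [mvfderiv_mul' mdifferentiableAt_const ((hfi j).diffAt hW hp), mvfderiv_const',
      mvfderiv_apply (hfs.diffAt hW hp)]
    simp
  refine ⟨fun i => f' q₀ i - ∑ j, S q₀ i j * f q₀ j, S q₀,
    (Matrix.symplecticGroup (Fin 2) ℝ).mul_mem (hX'.symplectic q₀ hq₀)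
      (symplectic_inv_mem (hX.symplectic q₀ hq₀)), fun q hq => ?_⟩
  ext i
  simp only [Pi.add_apply, Matrix.mulVec, dotProduct]
  rw [← hconst q hq i]
  ring

end Matching

/-! ### Calculus in a complex coordinate -/

section ComplexCoordinate

variable {M : Type*} [TopologicalSpace M] [ChartedSpace Plane M]
variable {U : Set M} {z : M → ℂ}

theorem IsComplexCoordinate.mono (h : IsComplexCoordinate U z) {V : Set M} (hV : IsOpen V)
    (hVU : V ⊆ U) : IsComplexCoordinate V z :=
  ⟨hV, h.smooth.mono hVU, h.injOn.mono hVU, fun q hq => h.bijective q (hVU hq)⟩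

/-- `ContinuousLinearMap.inverse` is 0 on non-invertible maps; bijectivity of dz excludes this
default, so `dZ` and `dZbar` are the true derivatives. -/
theorem IsComplexCoordinate.inverse_apply (h : IsComplexCoordinate U z) {q : M} (hq : q ∈ U) :
    (∀ c, mvfderiv (𝓡 2) z q ((mvfderiv (𝓡 2) z q).inverse c) = c) ∧
    ∀ v, (mvfderiv (𝓡 2) z q).inverse (mvfderiv (𝓡 2) z q v) = v := by
  obtain ⟨h1, h2⟩ := h.bijective q hq
  let L : Plane ≃L[ℝ] ℂ := ContinuousLinearEquiv.ofBijective (mvfderiv (𝓡 2) z q : Plane →L[ℝ] ℂ)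
    (LinearMap.ker_eq_bot.2 h1) (LinearMap.range_eq_top.2 h2)
  have hL : (mvfderiv (𝓡 2) z q).inverse = (L.symm : ℂ →L[ℝ] Plane) :=
    ContinuousLinearMap.inverse_equiv L
  rw [hL]
  exact ⟨fun c => L.apply_symm_apply c, fun v => L.symm_apply_apply v⟩

theorem IsComplexCoordinate.eq_add (h : IsComplexCoordinate U z) {q : M} (hq : q ∈ U)
    (v : TangentSpace (𝓡 2) q) :
    v = (mvfderiv (𝓡 2) z q v).re • (mvfderiv (𝓡 2) z q).inverse 1
      + (mvfderiv (𝓡 2) z q v).im • (mvfderiv (𝓡 2) z q).inverse Complex.I := by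
  rw [← map_smul, ← map_smul, ← map_add]
  have e : (mvfderiv (𝓡 2) z q v).re • (1 : ℂ) + (mvfderiv (𝓡 2) z q v).im • Complex.I
      = mvfderiv (𝓡 2) z q v := by
    conv_rhs => rw [← Complex.re_add_im (mvfderiv (𝓡 2) z q v)]
    simp
  rw [e, (h.inverse_apply hq).2]

/-- `du = u_z dz + u_z̄ dz̄`. -/
theorem IsComplexCoordinate.mvfderiv_eq (h : IsComplexCoordinate U z) (u : M → ℂ) {q : M}
    (hq : q ∈ U) (v : TangentSpace (𝓡 2) q) :
    mvfderiv (𝓡 2) u q v = dZ z u q * mvfderiv (𝓡 2) z q v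
      + dZbar z u q * conj (mvfderiv (𝓡 2) z q v) := by
  have hv := h.eq_add hq v
  have e : mvfderiv (𝓡 2) u q v
      = ((mvfderiv (𝓡 2) z q v).re : ℂ) * mvfderiv (𝓡 2) u q ((mvfderiv (𝓡 2) z q).inverse 1)
      + ((mvfderiv (𝓡 2) z q v).im : ℂ)
        * mvfderiv (𝓡 2) u q ((mvfderiv (𝓡 2) z q).inverse Complex.I) := by
    conv_lhs => rw [hv]
    rw [map_add, map_smul, map_smul, Complex.real_smul, Complex.real_smul]
  rw [e, dZ, dZbar]
  generalize mvfderiv (𝓡 2) z q v = c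
  obtain ⟨x, y⟩ := c
  have e1 : (⟨x, y⟩ : ℂ) = x + y * Complex.I := by apply Complex.ext <;> simp
  have e2 : conj (⟨x, y⟩ : ℂ) = x - y * Complex.I := by apply Complex.ext <;> simp
  change (x : ℂ) * _ + (y : ℂ) * _ = _
  rw [e2, e1]
  linear_combination (y : ℂ) * mvfderiv (𝓡 2) u q ((mvfderiv (𝓡 2) z q).inverse Complex.I)
    * Complex.I_sq

theorem dZ_congr {u w : M → ℂ} (hU : IsOpen U) {q : M} (hq : q ∈ U) (e : ∀ p ∈ U, u p = w p) :
    dZ z u q = dZ z w q ∧ dZbar z u q = dZbar z w q := by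
  simp only [dZ, dZbar, mvfderiv_congr_of_mem hU hq e, and_self]

theorem dZ_mul {u w : M → ℂ} {q : M} (hu : DiffAt u q) (hw : DiffAt w q) :
    dZ z (fun p => u p * w p) q = u q * dZ z w q + dZ z u q * w q ∧
    dZbar z (fun p => u p * w p) q = u q * dZbar z w q + dZbar z u q * w q := by
  simp only [dZ, dZbar, mvfderiv_mul' hu hw]
  constructor <;> ring

theorem dZ_sub {u w : M → ℂ} {q : M} (hu : DiffAt u q) (hw : DiffAt w q) :
    dZbar z (fun p => u p - w p) q = dZbar z u q - dZbar z w q := by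
  simp only [dZbar, mvfderiv_sub' hu hw]
  ring

theorem dZ_conj {u : M → ℂ} {q : M} (hu : DiffAt u q) :
    dZbar z (fun p => conj (u p)) q = conj (dZ z u q) := by
  simp only [dZ, dZbar, mvfderiv_conj hu]
  simp [Complex.conj_ofNat]

theorem dZ_zero (q : M) : dZ z (fun _ => 0) q = 0 := by
  simp [dZ, mvfderiv_const']

variable [IsManifold (𝓡 2) ∞ M]

namespace IsComplexCoordinate

theorem wedge (h : IsComplexCoordinate U z) {q₀ : M} (hS : U ⊆ (chartAt Plane q₀).source)
    {q : M} (hq : q ∈ U) :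
    pd q₀ 0 z q ≠ 0 ∧ pd q₀ 0 z q * conj (pd q₀ 1 z q) - pd q₀ 1 z q * conj (pd q₀ 0 z q) ≠ 0 := by
  refine wedge_ne_zero (hS hq) (fun v => mvfderiv (𝓡 2) z q v) (fun a b v w => ?_) fun v hv => ?_
  · rw [map_add, map_smul, map_smul, Complex.real_smul, Complex.real_smul]
  · exact (h.bijective q hq).1 (by rw [hv, map_zero])

/-- Cramer's rule for du = u_z dz + u_z̄ dz̄ evaluated on ∂₀, ∂₁. -/
theorem smooth_dZ (h : IsComplexCoordinate U z) {q₀ : M} (hS : U ⊆ (chartAt Plane q₀).source)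
    {u : M → ℂ} (hu : SmoothOn U u) : SmoothOn U (dZ z u) ∧ SmoothOn U (dZbar z u) := by
  have hz := fun k => SmoothOn.pd q₀ k h.isOpen hS h.smooth
  have hu' := fun k => SmoothOn.pd q₀ k h.isOpen hS hu
  have hw : SmoothOn U fun q => pd q₀ 0 z q * conj (pd q₀ 1 z q)
      - pd q₀ 1 z q * conj (pd q₀ 0 z q) :=
    ((hz 0).mul (hz 1).conj).sub ((hz 1).mul (hz 0).conj)
  have e := fun q (hq : q ∈ U) k => h.mvfderiv_eq u hq (coordField q₀ k q)
  constructor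
  · refine ((((hu' 0).mul (hz 1).conj).sub ((hu' 1).mul (hz 0).conj)).div hw
      fun q hq => (h.wedge hS hq).2).congr fun q hq => ?_
    have h2 := (h.wedge hS hq).2
    rw [eq_div_iff h2]
    have e0 := e q hq 0
    have e1 := e q hq 1
    simp only [pd] at *
    rw [e0, e1]
    ring
  · refine ((((hu' 1).mul (hz 0)).sub ((hu' 0).mul (hz 1))).div hw
      fun q hq => (h.wedge hS hq).2).congr fun q hq => ?_
    have h2 := (h.wedge hS hq).2
    rw [eq_div_iff h2]
    have e0 := e q hq 0
    have e1 := e q hq 1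
    simp only [pd] at *
    rw [e0, e1]
    ring

theorem dZ_comm (h : IsComplexCoordinate U z) {q₀ : M} (hS : U ⊆ (chartAt Plane q₀).source)
    {u : M → ℂ} (hu : SmoothOn U u) {q : M} (hq : q ∈ U) :
    dZ z (dZbar z u) q = dZbar z (dZ z u) q := by
  have hz := fun k => SmoothOn.pd q₀ k h.isOpen hS h.smooth
  obtain ⟨s1, s2⟩ := h.smooth_dZ hS hu
  have e : ∀ j k, pd q₀ j (pd q₀ k u) q
      = dZ z u q * pd q₀ j (pd q₀ k z) q + pd q₀ j (dZ z u) q * pd q₀ k z q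
        + (dZbar z u q * conj (pd q₀ j (pd q₀ k z) q)
          + pd q₀ j (dZbar z u) q * conj (pd q₀ k z q)) := by
    intro j k
    have d1 := s1.diffAt h.isOpen hq
    have d2 := s2.diffAt h.isOpen hq
    have d3 := (hz k).diffAt h.isOpen hq
    have d4 := (hz k).conj.diffAt h.isOpen hq
    rw [pd, mvfderiv_congr_of_mem (u := pd q₀ k u) h.isOpen hq (w := fun p => dZ z u p * pd q₀ k z p
      + dZbar z u p * conj (pd q₀ k z p)) fun p hp => h.mvfderiv_eq u hp _,
      mvfderiv_add' (d1.mul' d3) (d2.mul' d4), mvfderiv_mul' d1 d3, mvfderiv_mul' d2 d4,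
      mvfderiv_conj d3]
    rfl
  have hc := pd_comm q₀ h.isOpen hS hu hq
  rw [e, e, pd_comm q₀ h.isOpen hS h.smooth hq] at hc
  have k1 := fun j => h.mvfderiv_eq (dZ z u) hq (coordField q₀ j q)
  have k2 := fun j => h.mvfderiv_eq (dZbar z u) hq (coordField q₀ j q)
  have k10 := k1 0
  have k11 := k1 1
  have k20 := k2 0
  have k21 := k2 1
  have hw := (h.wedge hS hq).2
  simp only [pd] at hc k10 k11 k20 k21 hw
  rw [k10, k11, k20, k21] at hc
  refine sub_eq_zero.1 ((mul_eq_zero.1 ?_).resolve_right hw)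
  linear_combination hc

/-- `(u_z / u)_z̄ = (u_z̄ / u)_z`. -/
theorem dZbar_log (h : IsComplexCoordinate U z) {q₀ : M} (hS : U ⊆ (chartAt Plane q₀).source)
    {u : M → ℂ} (hu : SmoothOn U u) (h0 : ∀ p ∈ U, u p ≠ 0) {q : M} (hq : q ∈ U) :
    dZbar z (fun p => dZ z u p * (u p)⁻¹) q = dZ z (fun p => dZbar z u p * (u p)⁻¹) q := by
  obtain ⟨s1, s2⟩ := h.smooth_dZ hS hu
  have hi := hu.inv h0
  have d := hu.diffAt h.isOpen hq
  -- In place of a logarithm: differentiate u_z = (u_z/u)·u by z̄ and u_z̄ = (u_z̄/u)·u by z, and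
  -- compare.
  have f1 := (dZ_mul (z := z) ((s1.mul hi).diffAt h.isOpen hq) d).2
  have f2 := (dZ_mul (z := z) ((s2.mul hi).diffAt h.isOpen hq) d).1
  rw [(dZ_congr h.isOpen hq (w := dZ z u) fun p hp => by
    rw [mul_assoc, inv_mul_cancel₀ (h0 p hp), mul_one]).2] at f1
  rw [(dZ_congr h.isOpen hq (w := dZbar z u) fun p hp => by
    rw [mul_assoc, inv_mul_cancel₀ (h0 p hp), mul_one]).1, h.dZ_comm hS hu hq] at f2
  apply mul_right_cancel₀ (h0 q hq)
  linear_combination f2 - f1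

/-- As w_z = 0, logarithmic differentiation of ū w̄ = u w gives ū_z/ū = u_z/u - w̄_z/w̄. By
`dZbar_log` the z̄-derivatives on the right are (u_z̄/u)_z and (w̄_z̄/w̄)_z, and the latter is 0
since w̄_z̄ is the conjugate of w_z. -/
theorem hermitianCoeff_eq_zero (h : IsComplexCoordinate U z) {q₀ : M}
    (hS : U ⊆ (chartAt Plane q₀).source) {u w : M → ℂ} (hu : SmoothOn U u) (hw : SmoothOn U w)
    (hu0 : ∀ p ∈ U, u p ≠ 0) (hw0 : ∀ p ∈ U, w p ≠ 0) (hdw : ∀ p ∈ U, dZ z w p = 0)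
    (hreal : ∀ p ∈ U, conj (u p) * conj (w p) = u p * w p) {q : M} (hq : q ∈ U) :
    hermitianCoeff z u q = 0 := by
  have hwc0 : ∀ p ∈ U, conj (w p) ≠ 0 := fun p hp => (map_ne_zero _).2 (hw0 p hp)
  have huc0 : ∀ p ∈ U, conj (u p) ≠ 0 := fun p hp => (map_ne_zero _).2 (hu0 p hp)
  have hF : ∀ p ∈ U, dZ z (fun x => conj (u x)) p * (conj (u p))⁻¹
      = dZ z u p * (u p)⁻¹ - dZ z (fun x => conj (w x)) p * (conj (w p))⁻¹ := by
    intro p hp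
    have du := hu.diffAt h.isOpen hp
    have dw := hw.diffAt h.isOpen hp
    have duc := hu.conj.diffAt h.isOpen hp
    have dwc := hw.conj.diffAt h.isOpen hp
    have e := (dZ_congr (z := z) h.isOpen hp hreal).1
    rw [(dZ_mul duc dwc).1, (dZ_mul du dw).1, hdw p hp] at e
    have r := hreal p hp
    have n1 := hu0 p hp
    have n2 := huc0 p hp
    have n3 := hwc0 p hp
    have n4 := hw0 p hp
    have e' : dZ z (fun x => conj (u x)) p * u p * conj (w p)
        = dZ z u p * conj (u p) * conj (w p) - dZ z (fun x => conj (w x)) p * conj (u p) * u p := by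
      linear_combination u p * e - dZ z u p * r
    field_simp
    linear_combination e'
  have s1 := (h.smooth_dZ hS hu).1.mul (hu.inv hu0)
  have s2 := (h.smooth_dZ hS hw.conj).1.mul (hw.conj.inv hwc0)
  rw [hermitianCoeff, (dZ_congr h.isOpen hq hF).2,
    dZ_sub (s1.diffAt h.isOpen hq) (s2.diffAt h.isOpen hq), h.dZbar_log hS hu hu0 hq,
    h.dZbar_log hS hw.conj hwc0 hq, (dZ_congr
      (u := fun p => dZbar z (fun x => conj (w x)) p * (conj (w p))⁻¹) h.isOpen hq
      (w := fun _ => 0) fun p hp => by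
      rw [dZ_conj (hw.diffAt h.isOpen hp), hdw p hp]; simp).1, dZ_zero]
  ring

end IsComplexCoordinate

end ComplexCoordinate

/-! ### Existence of adapted frames -/

section Adapted

variable {M : Type*} [TopologicalSpace M] [ChartedSpace Plane M]
variable {A : VolumeElement M} {f : M → R4} {U V : Set M} {X Y : M → Mat4}

theorem thetaForm_congr (hU : IsOpen U) (e : ∀ p ∈ U, X p = Y p) {q : M} (hq : q ∈ U)
    (v : TangentSpace (𝓡 2) q) : thetaForm X q v = thetaForm Y q v := by
  change (X q)⁻¹ * dMat X q v = (Y q)⁻¹ * dMat Y q v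
  rw [dMat_congr hU hq e, e q hq]

/-- Smooth functions have smooth fourth roots near points where they do not vanish, up to a
constant factor. -/
theorem SmoothOn.exists_fourth_root {c : M → ℂ} (hU : IsOpen U) (hc : SmoothOn U c) {q : M}
    (hq : q ∈ U) (h0 : c q ≠ 0) :
    ∃ (V : Set M) (b : M → ℂ), IsOpen V ∧ q ∈ V ∧ V ⊆ U ∧ SmoothOn V b ∧
      (∀ p ∈ V, b p ≠ 0) ∧ ∀ p ∈ V, b p ^ 4 * c q = c p := by
  have hs : SmoothOn U fun p => c p / c q := SmoothOn.div hc (SmoothOn.const _) fun _ _ => h0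
  -- The quotient is 1 at q, so near q the principal logarithm is smooth along it.
  have hmem : U ∩ (fun p => c p / c q) ⁻¹' Complex.slitPlane ∈ nhds q := by
    refine Filter.inter_mem (hU.mem_nhds hq) ?_
    refine (hs.continuousOn.continuousAt (hU.mem_nhds hq)).preimage_mem_nhds ?_
    rw [div_self h0]
    exact Complex.isOpen_slitPlane.mem_nhds Complex.one_mem_slitPlane
  obtain ⟨V, hVs, hV, hqV⟩ := mem_nhds_iff.1 hmem
  have hlog : ContDiffOn ℝ ∞ (fun w : ℂ => Complex.exp (Complex.log w / 4)) Complex.slitPlane := by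
    intro w hw
    have h1 : ContDiffAt ℝ ∞ Complex.log w :=
      ContDiffAt.restrict_scalars ℝ (Complex.contDiffAt_log (n := ∞) hw)
    have h2 : ContDiff ℝ ∞ Complex.exp := Complex.contDiff_exp
    exact (h2.contDiffAt.comp w (h1.div_const 4)).contDiffWithinAt
  refine ⟨V, fun p => Complex.exp (Complex.log (c p / c q) / 4), hV, hqV, fun p hp => (hVs hp).1,
    SmoothOn.comp_contDiffOn (g := fun w => Complex.exp (Complex.log w / 4)) hlog
      (hs.mono fun p hp => (hVs hp).1) fun p hp => (hVs hp).2,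
    fun p _ => Complex.exp_ne_zero _, fun p hp => ?_⟩
  have hne : c p / c q ≠ 0 := Complex.slitPlane_ne_zero (hVs hp).2
  rw [← Complex.exp_nat_mul, show ((4 : ℕ) : ℂ) * (Complex.log (c p / c q) / 4)
    = Complex.log (c p / c q) by push_cast; ring, Complex.exp_log hne, div_mul_cancel₀ _ h0]

variable [IsManifold (𝓡 2) ∞ M]

/-- A primitive z of the closed form b²ω has bijective differential because ω has; the inverse
function theorem makes z injective on a smaller set. -/
theorem IsSecondOrder.exists_coordinate (h : IsSecondOrder A f U X) (hf : IsElliptic A f) {q : M}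
    (hS : U ⊆ (chartAt Plane q).source) (hq : q ∈ U) {b : M → ℂ} (hb : SmoothOn U b)
    (h0 : ∀ p ∈ U, b p ≠ 0)
    (hd : ∀ p ∈ U, pd q 0 (fun p => b p ^ 2 * omegaC q X 1 p) p
      = pd q 1 (fun p => b p ^ 2 * omegaC q X 0 p) p) :
    ∃ (V : Set M) (z : M → ℂ), q ∈ V ∧ V ⊆ U ∧ IsComplexCoordinate V z ∧
      ∀ p ∈ V, ∀ v, mvfderiv (𝓡 2) z p v = b p ^ 2 * omegaForm X p v := by
  obtain ⟨W, r, -, hW, hqW, hWU, hWS, hball⟩ := exists_coordinate_disc q (h.isOpen.mem_nhds hq)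
  have hs : ∀ k, SmoothOn U fun p => b p ^ 2 * omegaC q X k p := fun k => by
    simp only [pow_two]
    exact (hb.mul hb).mul (h.toIsFrameField.smoothOn_omegaC hS k)
  obtain ⟨z, hz, hdz⟩ := exists_primitive q (E := ℂ) hW hWS hball
    (a := fun k p => b p ^ 2 * omegaC q X k p) (fun k => (hs k).mono hWU)
    fun p hp => hd p (hWU hp)
  have hdz' : ∀ p ∈ W, ∀ v, mvfderiv (𝓡 2) z p v = b p ^ 2 * omegaForm X p v := by
    intro p hp v
    have e := fun k => hdz k p hp
    obtain ⟨a, rfl⟩ := exists_eq_smul_coordField q (hWS hp) v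
    have e0 := e 0
    have e1 := e 1
    simp only [pd, IsSecondOrder.omegaC_eq h.toIsFirstOrder (hWU hp)] at e0 e1
    rw [map_add, map_smul, map_smul, e0, e1, omegaForm_add_smul, Complex.real_smul,
      Complex.real_smul]
    ring
  have hbij : ∀ p ∈ W, Function.Bijective (mvfderiv (𝓡 2) z p) := by
    intro p hp
    have hbp := pow_ne_zero 2 (h0 p (hWU hp))
    constructor
    · refine (injective_iff_map_eq_zero _).2 fun v hv => ?_
      rw [hdz' p hp] at hv
      exact h.eq_zero_of_omegaForm hf (hWU hp) ((mul_eq_zero.1 hv).resolve_left hbp)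
    · intro c
      obtain ⟨v, hv⟩ := h.omegaForm_surjective hf (hWU hp) ((b p ^ 2)⁻¹ * c)
      exact ⟨v, by rw [hdz' p hp, hv, mul_inv_cancel_left₀ hbp]⟩
  obtain ⟨V, hV, hqV, hVW, hinj⟩ := exists_injOn_of_bijective hW hz hqW (hbij q hqW)
  exact ⟨V, z, hqV, hVW.trans hWU, ⟨hV, hz.mono hVW, hinj, fun p hp => hbij p (hVW hp)⟩,
    fun p hp => hdz' p (hVW hp)⟩

/-- A second order frame with `ω = dz` can be sheared to a frame that is adapted to `z`. -/
theorem IsSecondOrder.exists_adapted (h : IsSecondOrder A f U X) {q₀ : M}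
    (hS : U ⊆ (chartAt Plane q₀).source) {z : M → ℂ} (hz : IsComplexCoordinate U z)
    (hdz : ∀ p ∈ U, ∀ v, omegaForm X p v = mvfderiv (𝓡 2) z p v) :
    ∃ Y, IsAdapted A f U z Y := by
  have hw : ∀ k, ∀ p ∈ U, omegaC q₀ X k p = pd q₀ k z p := fun k p hp => by
    rw [IsSecondOrder.omegaC_eq h.toIsFirstOrder hp, hdz p hp, pd]
  have hne : ∀ p ∈ U, omegaC q₀ X 0 p ≠ 0 ∧ omegaC q₀ X 0 p * conj (omegaC q₀ X 1 p)
      - omegaC q₀ X 1 p * conj (omegaC q₀ X 0 p) ≠ 0 := fun p hp => by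
    rw [hw 0 p hp, hw 1 p hp]
    exact hz.wedge hS hp
  have sw := fun k => h.toIsFrameField.smoothOn_omegaC hS k
  have sr := fun k => h.toIsFrameField.smoothOn_rhoC hS k
  have se := fun k => h.toIsFrameField.smoothOn_etaC hS k
  -- Since ω = dz is closed, dω = 2ρ̄ ∧ ω gives ρ = bω̄. Decompose `cnj α` = cω + κω̄, where c is
  -- real by `omega_structure`. The shear with parameters c, b removes bω̄ and cω, which leaves `lin
  -- α = 0` and η = κ̄ω.
  let b : M → ℂ := fun p => rhoC q₀ X 0 p / conj (omegaC q₀ X 0 p)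
  let c : M → ℂ := fun p => (etaC q₀ X 0 p * conj (omegaC q₀ X 1 p)
    - etaC q₀ X 1 p * conj (omegaC q₀ X 0 p)) / (omegaC q₀ X 0 p * conj (omegaC q₀ X 1 p)
      - omegaC q₀ X 1 p * conj (omegaC q₀ X 0 p))
  have sb : SmoothOn U b := (sr 0).div (sw 0).conj fun p hp => (map_ne_zero _).2 (hne p hp).1
  have sc : SmoothOn U c := (((se 0).mul (sw 1).conj).sub ((se 1).mul (sw 0).conj)).div
    (((sw 0).mul (sw 1).conj).sub ((sw 1).mul (sw 0).conj)) fun p hp => (hne p hp).2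
  have hg := IsGauge.shear h.isOpen sc.re sb
  have hY := h.gauge hg subset_rfl fun p _ => by
    rw [Matrix.toBlocks_fromBlocks₁₁, cnj_one, lin_one]
    exact ⟨rfl, one_ne_zero⟩
  have hcre : ∀ p ∈ U, ((c p).re : ℂ) = c p := by
    intro p hp
    rw [← Complex.conj_eq_iff_re]
    have hr := (h.omega_structure hS hp).2
    have n2 := (hne p hp).2
    have n3 : conj (omegaC q₀ X 0 p) * omegaC q₀ X 1 p
        - conj (omegaC q₀ X 1 p) * omegaC q₀ X 0 p ≠ 0 := by
      intro hc
      apply n2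
      linear_combination -hc
    simp only [c, map_div₀, map_sub, map_mul, Complex.conj_conj]
    rw [div_eq_div_iff n3 n2]
    linear_combination (omegaC q₀ X 0 p * conj (omegaC q₀ X 1 p)
      - omegaC q₀ X 1 p * conj (omegaC q₀ X 0 p)) * hr
  have hα := fun p (hp : p ∈ U) v => (hg.theta_blocks h.toIsFrameField hp v).2
  have hγ := fun p (hp : p ∈ U) v => (hg.theta_blocks h.toIsFrameField hp v).1
  simp only [Matrix.toBlocks_fromBlocks₁₁, Matrix.toBlocks_fromBlocks₁₂,
    Matrix.toBlocks_fromBlocks₂₂, Matrix.transpose_one, one_mul, mul_one, dMat_const,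
    add_zero] at hα hγ
  have hlin : ∀ p ∈ U, ∀ v, lin (alphaForm (fun p => X p
      * Matrix.fromBlocks 1 (matOf ((c p).re : ℂ) (b p)) 0 1) p v) = 0 := by
    have hk : ∀ p ∈ U, ∀ k, rhoC q₀ X k p = b p * conj (omegaC q₀ X k p) := by
      intro p hp k
      have n1 : conj (omegaC q₀ X 0 p) ≠ 0 := (map_ne_zero _).2 (hne p hp).1
      have e := (h.omega_structure hS hp).1
      rw [show pd q₀ 0 (omegaC q₀ X 1) p = pd q₀ 0 (pd q₀ 1 z) p from
          congrArg (fun L => L (coordField q₀ 0 p)) (mvfderiv_congr_of_mem h.isOpen hp (hw 1)),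
        show pd q₀ 1 (omegaC q₀ X 0) p = pd q₀ 1 (pd q₀ 0 z) p from
          congrArg (fun L => L (coordField q₀ 1 p)) (mvfderiv_congr_of_mem h.isOpen hp (hw 0)),
        pd_comm q₀ h.isOpen hS hz.smooth hp, sub_self] at e
      have e2 := congrArg conj e
      simp only [map_zero, map_mul, map_sub, Complex.conj_conj, Complex.conj_ofNat] at e2
      fin_cases k
      · simp [b, div_mul_cancel₀ _ n1]
      · simp only [b, Fin.mk_one]
        rw [div_mul_eq_mul_div, eq_div_iff n1]
        linear_combination e2 / 2
    intro p hp v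
    rw [hα p hp, lin_sub, lin_mul, lin_transpose, cnj_transpose, h.lin_gamma hp,
      lin_matOf, cnj_matOf]
    obtain ⟨a, rfl⟩ := exists_eq_smul_coordField q₀ (hS hp) v
    have k0 := hk p hp 0
    have k1 := hk p hp 1
    simp only [rhoC, omegaC] at k0 k1
    rw [alphaForm_add_smul, gammaForm_add_smul]
    simp only [lin_add, lin_smul, cnj_add, cnj_smul, map_add, map_mul, Complex.conj_ofReal]
    rw [k0, k1]
    ring
  have hc : ∀ p ∈ U, c p * (omegaC q₀ X 0 p * conj (omegaC q₀ X 1 p)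
      - omegaC q₀ X 1 p * conj (omegaC q₀ X 0 p)) = etaC q₀ X 0 p * conj (omegaC q₀ X 1 p)
      - etaC q₀ X 1 p * conj (omegaC q₀ X 0 p) := fun p hp => div_mul_cancel₀ _ (hne p hp).2
  clear_value c
  refine ⟨_, ⟨hY, fun p hp => ?_⟩, hz, fun p hp v => ?_, fun p hp v => ?_, fun p hp v => ?_⟩
  · have n1 : conj (omegaC q₀ X 0 p) ≠ 0 := (map_ne_zero _).2 (hne p hp).1
    refine ⟨conj ((etaC q₀ X 0 p - c p * omegaC q₀ X 0 p) / conj (omegaC q₀ X 0 p)), fun v => ?_⟩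
    have hk : ∀ k, etaC q₀ X k p - c p * omegaC q₀ X k p
        = (etaC q₀ X 0 p - c p * omegaC q₀ X 0 p) / conj (omegaC q₀ X 0 p)
          * conj (omegaC q₀ X k p) := by
      intro k
      fin_cases k
      · simp [div_mul_cancel₀ _ n1]
      · simp only [Fin.mk_one]
        rw [div_mul_eq_mul_div, eq_div_iff n1]
        linear_combination hc p hp
    generalize (etaC q₀ X 0 p - c p * omegaC q₀ X 0 p) / conj (omegaC q₀ X 0 p) = κ at hk
    have k0 := hk 0
    have k1 := hk 1
    rw [etaForm_eq, ← IsSecondOrder.cnj_gamma hY.toIsFirstOrder hp, hγ p hp, hα p hp, cnj_sub,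
      cnj_mul, lin_transpose, lin_matOf, h.lin_gamma hp, hcre p hp,
      show conj (c p) = c p by rw [← hcre p hp, Complex.conj_ofReal]]
    obtain ⟨a, rfl⟩ := exists_eq_smul_coordField q₀ (hS hp) v
    simp only [etaC, omegaC] at k0 k1
    rw [alphaForm_add_smul, gammaForm_add_smul]
    simp only [cnj_add, cnj_smul, map_zero, mul_zero, add_zero]
    rw [show (a 0 : ℂ) * cnj (alphaForm X p (coordField q₀ 0 p))
        + (a 1 : ℂ) * cnj (alphaForm X p (coordField q₀ 1 p))
        - c p * ((a 0 : ℂ) * cnj (gammaForm X p (coordField q₀ 0 p))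
        + (a 1 : ℂ) * cnj (gammaForm X p (coordField q₀ 1 p)))
      = κ * conj ((a 0 : ℂ) * cnj (gammaForm X p (coordField q₀ 0 p))
        + (a 1 : ℂ) * cnj (gammaForm X p (coordField q₀ 1 p))) by
          simp only [map_add, map_mul, Complex.conj_ofReal]
          linear_combination (a 0 : ℂ) * k0 + (a 1 : ℂ) * k1, map_mul, Complex.conj_conj]
  · rw [← hdz p hp, ← IsSecondOrder.cnj_gamma hY.toIsFirstOrder hp, hγ p hp,
      IsSecondOrder.cnj_gamma h.toIsFirstOrder hp]
  · have := congrArg Complex.re (hlin p hp v)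
    simp only [lin, Complex.zero_re] at this
    linarith
  · have := congrArg Complex.im (hlin p hp v)
    simp only [lin, Complex.zero_im] at this
    linarith

end Adapted

/-! ### Rigidity of the last block of the Maurer-Cartan form -/

section Rigidity

variable {M : Type*} [TopologicalSpace M] [ChartedSpace Plane M]
variable {A : VolumeElement M} {f f' : M → R4} {U V W : Set M} {X X' Y : M → Mat4}

/-- The vanishing of `η` does not depend on the third order frame. -/
theorem IsThirdOrder.etaForm_eq_zero (h : IsThirdOrder A f U X) (h' : IsThirdOrder A f V Y)
    (hf : IsElliptic A f) {q : M} (hq : q ∈ U ∩ V) (h0 : ∀ v, etaForm X q v = 0)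
    (v : TangentSpace (𝓡 2) q) : etaForm Y q v = 0 := by
  have hg := h.toIsFirstOrder.isGauge h'.toIsFirstOrder
  have hparts := fun p hp => h.toIsSecondOrder.gauge_parts h'.toIsSecondOrder hf (q := p) hp
  have hX := h.toIsFrameField.mono hg.isOpen Set.inter_subset_left
  have hY : ∀ p ∈ U ∩ V, X p * ((X p)⁻¹ * Y p) = Y p := fun p hp =>
    h.toIsFirstOrder.mul_gauge hp.1
  have hθ := fun v => thetaForm_congr hg.isOpen hY hq v
  obtain ⟨a0, a1⟩ := hparts q hq
  obtain ⟨d0, d1⟩ := hg.conformal_lower hq a0 a1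
  have hα : ∀ v, alphaForm Y q v = _ := fun v =>
    (congrArg Matrix.toBlocks₁₁ (hθ v)).symm.trans (hg.theta_blocks hX hq v).2
  have hγ : ∀ v, gammaForm Y q v = _ := fun v =>
    (congrArg Matrix.toBlocks₂₁ (hθ v)).symm.trans (hg.theta_blocks hX hq v).1
  have hsm : SmoothMat (U ∩ V) fun p => ((X p)⁻¹ * Y p).toBlocks₁₁ :=
    fun i j => hg.smoothMat (Sum.inl i) (Sum.inl j)
  have hdA : ∀ v, cnj (dMat (fun p => ((X p)⁻¹ * Y p).toBlocks₁₁) q v) = 0 := by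
    intro v
    rw [← mvfderiv_cnj hg.isOpen hsm hq, mvfderiv_congr_of_mem hg.isOpen hq (w := fun _ => 0)
      fun p hp => (hparts p hp).1, mvfderiv_const']
  have hω : ∀ v, omegaForm Y q v
      = conj (lin ((X q)⁻¹ * Y q).toBlocks₁₁) ^ 2 * omegaForm X q v := by
    intro v
    rw [← IsSecondOrder.cnj_gamma h'.toIsFirstOrder hq.2, hγ, cnj_mul, cnj_mul, lin_mul,
      lin_transpose, cnj_transpose, h.toIsSecondOrder.lin_gamma hq.1,
      IsSecondOrder.cnj_gamma h.toIsFirstOrder hq.1, a0]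
    simp
    ring
  have hη : ∀ v, cnj (alphaForm Y q v) = -(conj (lin ((X q)⁻¹ * Y q).toBlocks₁₂)
      * omegaForm X q v * conj (lin ((X q)⁻¹ * Y q).toBlocks₁₁)) := by
    intro v
    have e := h0 v
    rw [etaForm_eq, map_eq_zero] at e
    rw [hα, cnj_add, cnj_sub, cnj_mul, cnj_mul, cnj_mul, cnj_mul, cnj_mul, lin_mul, lin_mul,
      lin_transpose, cnj_transpose, lin_transpose, cnj_transpose, d1, hdA, a0, e,
      h.toIsSecondOrder.lin_gamma hq.1, IsSecondOrder.cnj_gamma h.toIsFirstOrder hq.1]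
    simp
  -- By `hη` the form η of Y is a multiple of ω̄, and third order makes it a multiple of ω.
  -- Evaluating where ω is 1 and where it is i shows that it is zero.
  obtain ⟨c, hc⟩ := h'.eta_bidegree q hq.2
  obtain ⟨w, hw⟩ := h'.toIsSecondOrder.omegaForm_surjective hf hq.2 1
  obtain ⟨u, hu⟩ := h'.toIsSecondOrder.omegaForm_surjective hf hq.2 Complex.I
  have a2 : conj (lin ((X q)⁻¹ * Y q).toBlocks₁₁) ≠ 0 := (map_ne_zero _).2 a1
  have key : ∀ v, conj (c * omegaForm Y q v) * conj (lin ((X q)⁻¹ * Y q).toBlocks₁₁)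
      = -(conj (lin ((X q)⁻¹ * Y q).toBlocks₁₂) * omegaForm Y q v) := by
    intro v
    rw [← hc, etaForm_eq, Complex.conj_conj, hη, hω]
    ring
  have k1 := key w
  have k2 := key u
  rw [hw, mul_one, mul_one] at k1
  rw [hu, map_mul, Complex.conj_I] at k2
  have k3 : conj c * conj (lin ((X q)⁻¹ * Y q).toBlocks₁₁) = 0 := by
    linear_combination (1 / 2 : ℂ) * k1 + (Complex.I / 2) * k2
      + (conj c * conj (lin ((X q)⁻¹ * Y q).toBlocks₁₁)
        - conj (lin ((X q)⁻¹ * Y q).toBlocks₁₂)) / 2 * Complex.I_sq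
  have hc0 : c = 0 := (map_eq_zero _).1 ((mul_eq_zero.1 k3).resolve_right a2)
  rw [hc, hc0, zero_mul]

variable [IsManifold (𝓡 2) ∞ M]

namespace AgreesUpToBeta

/-- σ scales by a⁻² and ω by ā², so σ̄ω is invariant and σ ≠ 0 does not depend on the frame. This
moves the problem to whichever frame `hermitianForm` was computed with. -/
theorem gauge (h : AgreesUpToBeta W X X') (hX : IsSecondOrder A f W X) (hf : IsElliptic A f)
    {q₀ : M} (hS : W ⊆ (chartAt Plane q₀).source) (hY : IsSecondOrder A f W Y) :
    AgreesUpToBeta W Y (fun p => X' p * ((X p)⁻¹ * Y p)) ∧ ∀ q ∈ W, ∀ k,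
      betaDiffC q₀ Y (fun p => X' p * ((X p)⁻¹ * Y p)) k q
        = (lin ((X q)⁻¹ * Y q).toBlocks₁₁)⁻¹ ^ 2 * betaDiffC q₀ X X' k q := by
  have hg : IsGauge W fun p => (X p)⁻¹ * Y p := by
    simpa using hX.toIsFirstOrder.isGauge hY.toIsFirstOrder
  have hXY : ∀ p ∈ W, X p * ((X p)⁻¹ * Y p) = Y p := fun p hp => hX.toIsFirstOrder.mul_gauge hp
  have hθ := fun q (hq : q ∈ W) v => thetaForm_congr hg.isOpen hXY hq v
  have hβ : ∀ q ∈ W, ∀ v, thetaForm X' q v - thetaForm X q v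
      = Matrix.fromBlocks 0 (betaForm X' q v - betaForm X q v) 0 0 := by
    intro q hq v
    rw [h.toIsFrameField.thetaForm_eq hq, hX.toIsFrameField.thetaForm_eq hq, h.alpha_eq q hq,
      h.gamma_eq q hq, sub_eq_add_neg, Matrix.fromBlocks_neg, Matrix.fromBlocks_add]
    simp [sub_eq_add_neg]
  have hsub := fun q (hq : q ∈ W) v => (hg.theta_sub hX.toIsFrameField h.toIsFrameField hq v
    (hβ q hq v))
  have hsub' : ∀ q ∈ W, ∀ v, thetaForm (fun p => X' p * ((X p)⁻¹ * Y p)) q v - thetaForm Y q v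
      = Matrix.fromBlocks 0 (((X q)⁻¹ * Y q).toBlocks₂₂ᵀ * (betaForm X' q v - betaForm X q v)
        * ((X q)⁻¹ * Y q).toBlocks₂₂) 0 0 := fun q hq v => by
    rw [← hθ q hq, hsub q hq]
  refine ⟨⟨h.toIsFrameField.gauge hg.toIsFrameField, fun q hq v => ?_, fun q hq v => ?_⟩,
    fun q hq k => ?_⟩
  · exact sub_eq_zero.1 (congrArg Matrix.toBlocks₁₁ (hsub' q hq v))
  · exact sub_eq_zero.1 (congrArg Matrix.toBlocks₂₁ (hsub' q hq v))
  · have e : betaForm (fun p => X' p * ((X p)⁻¹ * Y p)) q (coordField q₀ k q)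
        - betaForm Y q (coordField q₀ k q)
        = ((X q)⁻¹ * Y q).toBlocks₂₂ᵀ * (betaForm X' q (coordField q₀ k q)
          - betaForm X q (coordField q₀ k q)) * ((X q)⁻¹ * Y q).toBlocks₂₂ :=
      congrArg Matrix.toBlocks₁₂ (hsub' q hq _)
    obtain ⟨a0, a1⟩ := hX.gauge_parts hY hf ⟨hq, hq⟩
    obtain ⟨d0, d1⟩ := hg.conformal_lower hq a0 a1
    rw [betaDiffC, betaDiffC, ← cnj_sub, e, cnj_mul, cnj_mul, lin_mul, lin_transpose,
      cnj_transpose, d0, d1, lin_sub, (h.lin_beta hX hf hS hq).1 k, cnj_sub]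
    simp
    ring

/-- With b⁴ proportional to σ̄/ω, the form b²ω is, up to a constant, a square root of σ̄ω. In it the
ρ̄ terms of dω = 2ρ̄ ∧ ω and dσ̄ = -2ρ̄ ∧ σ̄ cancel, so it is closed. A primitive is the coordinate
z, and the conformal gauge by b̄ turns ω into dz. -/
theorem exists_adapted (h : AgreesUpToBeta W X X') (hX : IsSecondOrder A f W X)
    (hf : IsElliptic A f) {q : M} (hS : W ⊆ (chartAt Plane q).source) (hq : q ∈ W)
    (h0 : betaDiffC q X X' 0 q ≠ 0) :
    ∃ (V : Set M) (z : M → ℂ) (Y : M → Mat4), q ∈ V ∧ IsAdapted A f V z Y := by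
  have sw := fun k => hX.toIsFrameField.smoothOn_omegaC hS k
  have ss := fun k => h.smoothOn_betaDiffC hX.toIsFrameField hS k
  have hw := fun p (hp : p ∈ W) => hX.omegaC_wedge hf hS hp
  have sc : SmoothOn W fun p => conj (betaDiffC q X X' 0 p) / omegaC q X 0 p :=
    (ss 0).conj.div (sw 0) fun p hp => (hw p hp).1
  obtain ⟨V, b, hV, hqV, hVW, hb, hb0, hbc⟩ := sc.exists_fourth_root hX.isOpen hq
    (div_ne_zero ((map_ne_zero _).2 h0) (hw q hq).1)
  have hc0 : conj (betaDiffC q X X' 0 q) / omegaC q X 0 q ≠ 0 :=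
    div_ne_zero ((map_ne_zero _).2 h0) (hw q hq).1
  generalize conj (betaDiffC q X X' 0 q) / omegaC q X 0 q = c₀ at hbc hc0
  have hs : ∀ k, ∀ p ∈ V, conj (betaDiffC q X X' k p)
      = c₀ * (b p ^ 2 * (b p ^ 2 * omegaC q X k p)) := by
    intro k p hp
    have n0 := (hw p (hVW hp)).1
    have e0 : conj (betaDiffC q X X' 0 p) = b p ^ 4 * c₀ * omegaC q X 0 p := by
      rw [hbc p hp, div_mul_cancel₀ _ n0]
    fin_cases k
    · simp only [Fin.zero_eta, e0]
      ring
    · have e1 := congrArg conj (h.lin_beta hX hf hS (hVW hp)).2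
      simp only [map_mul, Complex.conj_conj] at e1
      simp only [Fin.mk_one]
      apply mul_right_cancel₀ n0
      rw [e1, e0]
      ring
  have sw' := fun k => (sw k).mono hVW
  have sB : SmoothOn V fun p => b p ^ 2 := by
    simp only [pow_two]
    exact hb.mul hb
  have sF := fun k => sB.mul (sw' k)
  have hXV := hX.mono hV hVW
  have hd : ∀ p ∈ V, pd q 0 (fun p => b p ^ 2 * omegaC q X 1 p) p
      = pd q 1 (fun p => b p ^ 2 * omegaC q X 0 p) p := by
    intro p hp
    have dB := sB.diffAt hV hp
    have dw := fun k => SmoothOn.diffAt (sw' k) hV hp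
    have dF := fun k => (sF k).diffAt hV hp
    have hF : ∀ j k, pd q j (fun p => b p ^ 2 * omegaC q X k p) p
        = b p ^ 2 * pd q j (omegaC q X k) p + pd q j (fun p => b p ^ 2) p * omegaC q X k p :=
      fun j k => mvfderiv_mul' dB (dw k) _
    have hs' : ∀ j k, conj (pd q j (betaDiffC q X X' k) p)
        = c₀ * (b p ^ 2 * pd q j (fun p => b p ^ 2 * omegaC q X k p) p
          + pd q j (fun p => b p ^ 2) p * (b p ^ 2 * omegaC q X k p)) := by
      intro j k
      have ds := SmoothOn.diffAt ((ss k).mono hVW) hV hp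
      simp only [pd]
      rw [← mvfderiv_conj ds, mvfderiv_congr_of_mem hV hp (hs k),
        mvfderiv_mul' ((SmoothOn.const c₀).diffAt hV hp) (dB.mul' (dF k)),
        mvfderiv_mul' dB (dF k), mvfderiv_const', zero_mul, add_zero]
    have d2 := congrArg conj (h.betaDiff_structure hX hf hS (hVW hp)).2
    have d1 := (hXV.omega_structure (hVW.trans hS) hp).1
    simp only [map_sub, map_mul, Complex.conj_ofNat] at d2
    rw [hs', hs', hs 0 p hp, hs 1 p hp] at d2
    have f01 := hF 0 1
    have f10 := hF 1 0
    -- Put B = b² and F = Bω, so σ̄ = c₀BF. Eliminating dB between dF = dB ∧ ω + B dω and dσ̄ =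
    -- c₀(dB ∧ F + B dF) leaves 2c₀B dF = 0.
    have n : 2 * c₀ * b p ^ 2 ≠ 0 :=
      mul_ne_zero (mul_ne_zero two_ne_zero hc0) (pow_ne_zero _ (hb0 p hp))
    refine sub_eq_zero.1 ((mul_eq_zero.1 ?_).resolve_left n)
    linear_combination d2 + c₀ * b p ^ 2 * (f01 - f10) + c₀ * b p ^ 4 * d1
  obtain ⟨V', z, hqV', hV'V, hz, hdz⟩ := hXV.exists_coordinate hf (hVW.trans hS) hqV hb hb0 hd
  have hg := IsGauge.conformal hz.isOpen (SmoothOn.conj (hb.mono hV'V))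
    fun p hp => (map_ne_zero _).2 (hb0 p (hV'V hp))
  have hp0 : ∀ p ∈ V', cnj (Matrix.fromBlocks (matOf (conj (b p)) 0) 0 0
        (matOf (conj (conj (b p)))⁻¹ 0) : Mat4).toBlocks₁₁ = 0 ∧
      lin (Matrix.fromBlocks (matOf (conj (b p)) 0) 0 0
        (matOf (conj (conj (b p)))⁻¹ 0) : Mat4).toBlocks₁₁ ≠ 0 := fun p hp => by
    rw [Matrix.toBlocks_fromBlocks₁₁, cnj_matOf, lin_matOf]
    exact ⟨rfl, (map_ne_zero _).2 (hb0 p (hV'V hp))⟩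
  have hX1 := hXV.gauge hg hV'V hp0
  obtain ⟨Y, hY⟩ := hX1.exists_adapted ((hV'V.trans hVW).trans hS) hz fun p hp v => by
    obtain ⟨-, e, -⟩ := hg.omega_tau (hXV.mono hz.isOpen hV'V) hp (hp0 p hp).1 (hp0 p hp).2 v
    rw [IsSecondOrder.cnj_gamma hX1.toIsFirstOrder hp, Matrix.toBlocks_fromBlocks₁₁, lin_matOf,
      Complex.conj_conj, IsSecondOrder.cnj_gamma hXV.toIsFirstOrder (hV'V hp)] at e
    rw [e, hdz p hp]
  exact ⟨V', z, Y, hqV', hY⟩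

/-- In the adapted frame σ = δ dz̄ and ρ = 0, so dσ = 0 means δ_z = 0, and the linear part of
`betaDiff_structure` says that cδ is real. Both functions stay nonzero near q, so the statement on
complex coordinates applies with u = c and w = δ. -/
theorem hermitianCoeff_eq_zero (h : AgreesUpToBeta W X X') (hW : W ⊆ U) {z c : M → ℂ}
    (hX : IsAdapted A f U z X)
    (hc : ∀ p ∈ U, ∀ v, etaForm X p v = c p * mvfderiv (𝓡 2) z p v) (hf : IsElliptic A f)
    {q₀ q : M} (hS : W ⊆ (chartAt Plane q₀).source) (hq : q ∈ W) (hc0 : c q ≠ 0)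
    (h0 : betaDiffC q₀ X X' 0 q ≠ 0) : hermitianCoeff z c q = 0 := by
  have hXW := hX.toIsSecondOrder.mono h.isOpen hW
  have hzW := hX.coordinate.mono h.isOpen hW
  have sz := fun k => SmoothOn.pd q₀ k hzW.isOpen hS hzW.smooth
  have hwz := fun p (hp : p ∈ W) => hzW.wedge hS hp
  have hω : ∀ k, ∀ p ∈ W, omegaC q₀ X k p = pd q₀ k z p := fun k p hp => by
    rw [IsSecondOrder.omegaC_eq hXW.toIsFirstOrder hp, hX.omega_eq p (hW hp), pd]
  have hρ : ∀ k, ∀ p ∈ W, rhoC q₀ X k p = 0 := fun k p hp => by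
    rw [rhoC, lin, hX.trace_alpha p (hW hp), hX.skew_alpha p (hW hp)]
    simp only [zero_div]
    rfl
  have hη : ∀ k, ∀ p ∈ W, etaC q₀ X k p = conj (c p * pd q₀ k z p) := fun k p hp => by
    rw [pd, ← hc p (hW hp), etaForm_eq, Complex.conj_conj, etaC]
  have ss := fun k => h.smoothOn_betaDiffC hXW.toIsFrameField hS k
  have sc : SmoothOn W c := by
    refine ((hXW.toIsFrameField.smoothOn_etaC hS 0).conj.div (sz 0)
      fun p hp => (hwz p hp).1).congr fun p hp => ?_
    rw [hη 0 p hp, Complex.conj_conj, mul_div_cancel_right₀ _ (hwz p hp).1]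
  have sδ : SmoothOn W fun p => betaDiffC q₀ X X' 0 p / conj (pd q₀ 0 z p) :=
    (ss 0).div (sz 0).conj fun p hp => (map_ne_zero _).2 (hwz p hp).1
  have hs : ∀ k, ∀ p ∈ W, betaDiffC q₀ X X' k p
      = betaDiffC q₀ X X' 0 p / conj (pd q₀ 0 z p) * conj (pd q₀ k z p) := by
    intro k p hp
    have n0 : conj (pd q₀ 0 z p) ≠ 0 := (map_ne_zero _).2 (hwz p hp).1
    fin_cases k
    · simp only [Fin.zero_eta, div_mul_cancel₀ _ n0]
    · have e := (h.lin_beta hXW hf hS hp).2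
      rw [hω 0 p hp, hω 1 p hp] at e
      simp only [Fin.mk_one]
      rw [div_mul_eq_mul_div, eq_div_iff n0, e]
  have hδ0 : betaDiffC q₀ X X' 0 q / conj (pd q₀ 0 z q) ≠ 0 :=
    div_ne_zero h0 ((map_ne_zero _).2 (hwz q hq).1)
  have hmem : W ∩ {p | c p ≠ 0 ∧ betaDiffC q₀ X X' 0 p / conj (pd q₀ 0 z p) ≠ 0} ∈ nhds q :=
    Filter.inter_mem (h.isOpen.mem_nhds hq)
      ((sc.eventually_ne h.isOpen hq hc0).and (sδ.eventually_ne h.isOpen hq hδ0))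
  generalize hδ : (fun p => betaDiffC q₀ X X' 0 p / conj (pd q₀ 0 z p)) = δ at sδ
  replace hδ := fun p => congrFun hδ p
  simp only [hδ] at hs hmem
  obtain ⟨V, hVs, hV, hqV⟩ := mem_nhds_iff.1 hmem
  have hVW : V ⊆ W := fun p hp => (hVs hp).1
  refine (hzW.mono hV hVW).hermitianCoeff_eq_zero (hVW.trans hS) (sc.mono hVW) (sδ.mono hVW)
    (fun p hp => (hVs hp).2.1) (fun p hp => (hVs hp).2.2) (fun p hp => ?_) (fun p hp => ?_) hqV
  · have hpW := hVW hp
    have d2 := (h.betaDiff_structure hXW hf hS hpW).2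
    rw [hρ 0 p hpW, hρ 1 p hpW] at d2
    have dδ := sδ.diffAt h.isOpen hpW
    have hds : ∀ j k, pd q₀ j (betaDiffC q₀ X X' k) p
        = δ p * conj (pd q₀ j (pd q₀ k z) p) + pd q₀ j δ p * conj (pd q₀ k z p) := by
      intro j k
      have dz := (sz k).diffAt h.isOpen hpW
      have dzc := (sz k).conj.diffAt h.isOpen hpW
      rw [pd, mvfderiv_congr_of_mem h.isOpen hpW (hs k), mvfderiv_mul' dδ dzc, mvfderiv_conj dz]
      rfl
    have k0 := hzW.mvfderiv_eq δ hpW (coordField q₀ 0 p)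
    have k1 := hzW.mvfderiv_eq δ hpW (coordField q₀ 1 p)
    rw [hds, hds, pd_comm q₀ h.isOpen hS hzW.smooth hpW] at d2
    refine (mul_eq_zero.1 ?_).resolve_right (hwz p hpW).2
    simp only [pd] at d2 k0 k1 ⊢
    rw [k0, k1] at d2
    linear_combination d2
  · have hpW := hVW hp
    have d1 := (h.betaDiff_structure hXW hf hS hpW).1
    rw [hη 0 p hpW, hη 1 p hpW, hs 0 p hpW, hs 1 p hpW] at d1
    simp only [map_mul, Complex.conj_conj] at d1
    refine sub_eq_zero.1 ((mul_eq_zero.1 ?_).resolve_right (hwz p hpW).2)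
    linear_combination d1

/-- For generic immersions the last block of the Maurer-Cartan form is determined by the others. -/
theorem thetaForm_eq (h : AgreesUpToBeta W X X') (hX : IsSecondOrder A f W X)
    (hf : IsGeneric A f) {q : M} (hq : q ∈ W) (v : TangentSpace (𝓡 2) q) :
    thetaForm X' q v = thetaForm X q v := by
  have hW₁ : IsOpen (W ∩ (chartAt Plane q).source) := h.isOpen.inter (chartAt Plane q).open_source
  have hq₁ : q ∈ W ∩ (chartAt Plane q).source := ⟨hq, mem_chart_source _ q⟩
  have h₁ := h.mono hW₁ Set.inter_subset_left
  have hX₁ := hX.mono hW₁ Set.inter_subset_left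
  have hell := hf.toIsElliptic
  have hzero : betaDiffC q X X' 0 q = 0 := by
    by_contra h0
    obtain ⟨V, z, Y, hqV, hY⟩ := h₁.exists_adapted hX₁ hell Set.inter_subset_right hq₁ h0
    -- The values chosen by `Classical.epsilon` have their defining property only once some frame
    -- exists; Y provides this for ℋ and 𝒫. The frames X₃ and X₂ behind the chosen values may be
    -- different from Y and from each other.
    have hexH : ∃ H, IsHopfAt A f q H := by
      obtain ⟨t, -, ht⟩ := hY.toIsSecondOrder.exists_tau_eq hell hqV
      exact ⟨_, V, Y, t, hqV, hY.toIsThirdOrder, ht, rfl⟩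
    have hexP : ∃ P, IsHermitianFormAt A f q P := by
      choose! c hc using hY.eta_bidegree
      exact ⟨_, V, z, Y, c, hqV, hY, fun p hp v => by rw [hc p hp, hY.omega_eq p hp], rfl⟩
    obtain ⟨U₃, X₃, t, hqU₃, hX₃, -, eH⟩ := Classical.epsilon_spec hexH
    obtain ⟨U₂, z₂, X₂, c, hqU₂, hX₂, hc, eP⟩ := Classical.epsilon_spec hexP
    -- If h vanished at q in the frame X₂, then η would vanish there in X₃ too, and ℋ(q) would be 0.
    have hc0 : c q ≠ 0 := by
      intro hc0
      refine hf.hopf_ne_zero q ?_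
      rw [normalizedHopf, eH]
      funext v
      rw [hX₂.toIsThirdOrder.etaForm_eq_zero hX₃ hell ⟨hqU₂, hqU₃⟩ (fun v => by
        rw [hc q hqU₂, hc0, zero_mul]) v]
      simp
    refine hf.hermitian_ne_zero q ?_
    rw [hermitianForm, eP]
    have hW₂ : IsOpen (U₂ ∩ (W ∩ (chartAt Plane q).source)) := hX₂.isOpen.inter hW₁
    have hS₂ : U₂ ∩ (W ∩ (chartAt Plane q).source) ⊆ (chartAt Plane q).source := fun p hp => hp.2.2
    have hq₂ : q ∈ U₂ ∩ (W ∩ (chartAt Plane q).source) := ⟨hqU₂, hq₁⟩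
    have hX' := hX₁.mono hW₂ Set.inter_subset_right
    have hX₂' := hX₂.toIsSecondOrder.mono hW₂ Set.inter_subset_left
    obtain ⟨g1, g2⟩ := (h₁.mono hW₂ Set.inter_subset_right).gauge hX' hell hS₂ hX₂'
    have hne := g2 q hq₂ 0
    have hl := (hX'.gauge_parts hX₂' hell ⟨hq₂, hq₂⟩).2
    funext v
    rw [g1.hermitianCoeff_eq_zero Set.inter_subset_left hX₂ hc hell hS₂ hq₂ hc0 (by
      rw [hne]
      exact mul_ne_zero (pow_ne_zero _ (inv_ne_zero hl)) h0), zero_mul]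
    rfl
  obtain ⟨l1, l2⟩ := h₁.lin_beta hX₁ hell Set.inter_subset_right hq₁
  have hw := (hX₁.omegaC_wedge hell Set.inter_subset_right hq₁).1
  have hzero' : ∀ k, betaDiffC q X X' k q = 0 := by
    intro k
    fin_cases k
    · exact hzero
    · rw [hzero, zero_mul] at l2
      exact (mul_eq_zero.1 l2).resolve_right ((map_ne_zero _).2 hw)
  have hk : ∀ k, thetaForm X' q (coordField q k q) = thetaForm X q (coordField q k q) := by
    intro k
    rw [h.toIsFrameField.thetaForm_eq hq, hX.toIsFrameField.thetaForm_eq hq, h.alpha_eq q hq,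
      h.gamma_eq q hq, parts_ext (l1 k) (sub_eq_zero.1 (hzero' k))]
  obtain ⟨a, rfl⟩ := exists_eq_smul_coordField q hq₁.2 v
  rw [thetaForm_add_smul, thetaForm_add_smul, hk, hk]

end AgreesUpToBeta

end Rigidity

/-! ### From local to global congruence -/

section Congruence

variable {M : Type*} [TopologicalSpace M] [ChartedSpace Plane M] [IsManifold (𝓡 2) ∞ M]
variable {A : VolumeElement M} {f f' : M → R4}

/-- The image of an elliptic Lagrangian immersion lies locally in no proper affine subspace. -/
theorem IsElliptic.eq_zero_of_mulVec_eq_const (hf : IsElliptic A f) {q : M} {T : Mat4} {c : R4}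
    (h : ∀ᶠ p in nhds q, T *ᵥ f p = c) : T = 0 := by
  obtain ⟨U, X, hqU, hX⟩ := exists_secondOrder hf q
  obtain ⟨V, hVs, hV, hqV⟩ := mem_nhds_iff.1 (Filter.inter_mem h (hX.isOpen.mem_nhds hqU))
  have hXV := hX.mono hV fun p hp => (hVs hp).2
  have hdf : ∀ p ∈ V, ∀ v, T *ᵥ mvfderiv (𝓡 2) f p v = 0 := by
    intro p hp v
    have e := mvfderiv_clm (LinearMap.toContinuousLinearMap T.mulVecLin)
      (hf.smooth.contMDiffOn.mono (Set.subset_univ V) |> fun h => SmoothOn.diffAt h hV hp) v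
    simp only [LinearMap.coe_toContinuousLinearMap', Matrix.mulVecLin_apply] at e
    rw [← e, mvfderiv_congr_of_mem hV hp (w := fun _ => c) fun x hx => (hVs hx).1,
      mvfderiv_const']
  have hcol : ∀ p ∈ V, ∀ i j, (T * X p) i (Sum.inl j) = 0 := by
    intro p hp i j
    have hmem : (X p).col (Sum.inl j) ∈ gaussPlane f p := by
      rw [← hXV.span_eq p hp]
      fin_cases j
      · exact Submodule.subset_span (Set.mem_insert _ _)
      · exact Submodule.subset_span (Set.mem_insert_of_mem _ rfl)
    obtain ⟨v, hv⟩ := hmem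
    have e := congrFun (hdf p hp v) i
    change (T *ᵥ (mvfderiv (𝓡 2) f p).toLinearMap v) i = 0 at e
    rw [hv] at e
    exact e
  -- T annihilates X₁ and X₂ near q. Differentiating this along v gives (TX₃, TX₄) γ(v) = 0, and
  -- ω(v) = 1 makes γ(v) invertible with determinant -1.
  obtain ⟨v, hv⟩ := hXV.omegaForm_surjective hf hqV 1
  have hdet : IsUnit (gammaForm X q v).det := by
    rw [det_eq_normSq_sub, hXV.lin_gamma hqV, IsSecondOrder.cnj_gamma hXV.toIsFirstOrder hqV, hv]
    simp
  have hθ : ∀ i j, (T * X q * thetaForm X q v) i (Sum.inl j) = 0 := by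
    intro i j
    have e := dMat_mul hV (SmoothMat.const T) hXV.toIsFrameField.smoothMat hqV v
    rw [dMat_const, Matrix.zero_mul, zero_add, hXV.toIsFrameField.dMat_eq hqV,
      ← Matrix.mul_assoc] at e
    rw [← e]
    change mvfderiv (𝓡 2) (fun p => (T * X p) i (Sum.inl j)) q v = 0
    rw [mvfderiv_congr_of_mem hV hqV (w := fun _ => 0) fun p hp => hcol p hp i j, mvfderiv_const']
  have hN : (Matrix.of fun i k => (T * X q) i (Sum.inr k)) * gammaForm X q v = 0 := by
    ext i j
    have e := hθ i j
    rw [Matrix.mul_apply, Fintype.sum_sum_type] at e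
    simpa [hcol q hqV, Matrix.mul_apply, gammaForm, Matrix.toBlocks₂₁] using e
  have hN' : (Matrix.of fun i k => (T * X q) i (Sum.inr k)) = 0 := by
    have e := congrArg (· * (gammaForm X q v)⁻¹) hN
    simpa [Matrix.mul_assoc, Matrix.mul_nonsing_inv _ hdet] using e
  have hTX : T * X q = 0 := by
    ext i (j | j)
    · exact hcol q hqV i j
    · exact congrFun (congrFun hN' i) j
  have e := congrArg (· * (X q)⁻¹) hTX
  simpa [Matrix.mul_assoc, hXV.toIsFrameField.mul_inv hqV] using e

theorem IsElliptic.affine_unique (hf : IsElliptic A f) {q : M} {b c : R4} {S T : Mat4}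
    (h : ∀ᶠ p in nhds q, b + S *ᵥ f p = c + T *ᵥ f p) : b = c ∧ S = T := by
  have hST : S = T := sub_eq_zero.1 (hf.eq_zero_of_mulVec_eq_const (c := c - b) (q := q) (by
    filter_upwards [h] with p hp
    rw [Matrix.sub_mulVec, sub_eq_sub_iff_add_eq_add, add_comm, hp, add_comm]))
  subst hST
  exact ⟨add_right_cancel h.self_of_nhds, rfl⟩

theorem IsGeneric.exists_local_congruence (hf : IsGeneric A f) (hf' : IsElliptic A f')
    (hF : fubiniCubicForm A f' = fubiniCubicForm A f) (q : M) :
    ∃ (b : R4) (S : Mat4), S ∈ Matrix.symplecticGroup (Fin 2) ℝ ∧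
      ∀ᶠ p in nhds q, f' p = b + S *ᵥ f p := by
  obtain ⟨U, X, hqU, hX⟩ := exists_secondOrder hf.toIsElliptic q
  obtain ⟨W, X', hqW, hWU, hXX', hτ⟩ := exists_matching hf.toIsElliptic hf' hF hX hqU
  obtain ⟨V, r, -, hV, hqV, hVW, hVS, hball⟩ :=
    exists_coordinate_disc q (hXX'.isOpen.mem_nhds hqW)
  have hXW := hX.mono hXX'.isOpen hWU
  obtain ⟨b, S, hS, e⟩ := LagrangianSurface.exists_local_congruence hV hqV hVS hball
    hf.smooth.contMDiffOn hf'.smooth.contMDiffOn (hXW.toIsFirstOrder.mono hV hVW)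
    (hXX'.toIsFrameField.mono hV hVW) (fun p hp => hτ p (hVW hp))
    fun p hp k => hXX'.thetaForm_eq hXW hf (hVW hp) _
  exact ⟨b, S, hS, Filter.eventually_of_mem (hV.mem_nhds hqV) e⟩

end Congruence

end LagrangianSurface

end

/-! ### Globalization by connectedness -/

theorem proposition2 {M : Type*} [TopologicalSpace M] [ConnectedSpace M]
    [ChartedSpace LagrangianSurface.Plane M] [IsManifold (𝓡 2) ∞ M]
    (A : LagrangianSurface.VolumeElement M)
    (f f' : M → LagrangianSurface.R4)
    (hf : LagrangianSurface.IsGeneric A f)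
    (hf' : LagrangianSurface.IsElliptic A f')
    (hF : LagrangianSurface.fubiniCubicForm A f' = LagrangianSurface.fubiniCubicForm A f) :
    ∃ (b : LagrangianSurface.R4) (S : Matrix (Fin 2 ⊕ Fin 2) (Fin 2 ⊕ Fin 2) ℝ),
      S ∈ Matrix.symplecticGroup (Fin 2) ℝ ∧ ∀ q, f' q = b + S *ᵥ f q := by
  obtain ⟨q₀⟩ := (inferInstance : Nonempty M)
  obtain ⟨b, S, hS, h₀⟩ := hf.exists_local_congruence hf' hF q₀
  have hopen : IsOpen {q | ∀ᶠ p in nhds q, f' p = b + S *ᵥ f p} := isOpen_setOfPred_eventually_nhds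
  -- At a limit point q some pair (c, T) works on a neighbourhood. This neighbourhood contains
  -- points near which (b, S) works as well, and `affine_unique` identifies the two pairs.
  have hclosed : IsClosed {q | ∀ᶠ p in nhds q, f' p = b + S *ᵥ f p} := by
    refine isClosed_of_closure_subset fun q hq => ?_
    obtain ⟨c, T, -, h⟩ := hf.exists_local_congruence hf' hF q
    obtain ⟨p, hp, hpG⟩ := mem_closure_iff_nhds.1 hq _ h.eventually_nhds
    obtain ⟨rfl, rfl⟩ := hf.toIsElliptic.affine_unique (q := p) (b := b) (c := c) (S := S) (T := T)
      (by filter_upwards [hp, hpG] with x h1 h2 using h2.symm.trans h1)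
    exact h
  have huniv := IsClopen.eq_univ ⟨hclosed, hopen⟩ ⟨q₀, h₀⟩
  refine ⟨b, S, hS, fun q => ?_⟩
  have hq : q ∈ {q | ∀ᶠ p in nhds q, f' p = b + S *ᵥ f p} := huniv ▸ Set.mem_univ q
  exact hq.self_of_nhds
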